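/- Let $1\le K$, $n$, $p$ be integers, $A\in\mathbb R^{p\times K}$, $\beta\in\mathbb R^K$, and consider the factor regression model $$X=AZ+E,\qquad y=Z^\top\beta+\varepsilon,$$ where $Z\in\mathbb R^K$, $E\in\mathbb R^p$, $\varepsilon\in\mathbb R$ are mean-zero and mutually independent, with $\Sigma_Z=\mathrm{Cov}(Z)$, $\Sigma_E=\mathrm{Cov}(E)$, $\sigma_\varepsilon^2=\mathrm{Var}(\varepsilon)$. Assume that $A$ and $\Sigma_Z$ have rank $K$, and that for a constant $M>0$: $E=\Sigma_E^{1/2}\tilde E$ where $\tilde E$ has independent entries with mean zero, unit variance and sub-Gaussian norm at most $M$; $Z=\Sigma_Z^{1/2}\tilde Z$ and $\varepsilon=\sigma_\varepsilon\tilde\varepsilon$ where $\tilde Z$ and $\tilde\varepsilon$ have mean zero and sub-Gaussian norm at most $M$. Here $\|U\|_{\psi_2}=\inf\{t>0:\mathbb E\exp(U^2/t^2)\le 2\}$ for a real random variable and $\|V\|_{\psi_2}=\sup_{\|u\|=1}\|V^\top u\|_{\psi_2}$ for a random vector. The data are $(X_i,y_i)=(AZ_i+E_i,\;Z_i^\top\beta+\varepsilon_i)$,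 $i=1,\dots,n$, where $(Z_i,E_i,\varepsilon_i)$ are i.i.d. copies of $(Z,E,\varepsilon)$; $\mathbf X\in\mathbb R^{n\times p}$ has rows $X_i^\top$ and $\mathbf y=(y_1,\dots,y_n)^\top$. Let $\widehat\alpha$ be the vector of least Euclidean norm among the minimizers of $u\mapsto\|\mathbf X u-\mathbf y\|$ (so $\widehat\alpha=\mathbf X^+\mathbf y$), let $R(\alpha)=\mathbb E_{X,y}[(X^\top\alpha-y)^2]$ be the risk at a new independent data point, and write $\lambda_k(Q)$ for the $k$-th largest eigenvalue of a symmetric matrix $Q$, $\|Q\|$ for its operator norm, $\|v\|_Q^2=v^\top Qv$, and $\mathrm{r_e}(Q)=\mathrm{tr}(Q)/\|Q\|$ for $Q\ne0$, $\mathrm{r_e}(0)=1$. For every $M>0$ there are constants $C,c>0$ depending only on $M$ such that the following holds. Suppose that $n>CK$, $\mathrm{r_e}(\Sigma_E)>Cn$, and, for positive constants $z_1,z_2,e_1,e_2,r_1,r_2,b$, $$z_1\le\lambda_K(\Sigma_Z)\le z_2,\quad e_1\le\|\Sigma_E\|\le e_2,\quad r_1p\le\mathrm{r_e}(\Sigma_E)\le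 r_2p,\quad \|\beta\|^2_{\Sigma_Z}\le bK .$$ Then $R$ has a minimizer over $\mathbb R^p$, and for every minimizer $\alpha^*$ of $R$: 1. with probability at least $1-c/n$ (over the data), $$R(\widehat\alpha)-R(\alpha^*)\le R(\widehat\alpha)-\sigma_\varepsilon^2\le D\left\{\frac{K}{\lambda_K(A^\top A)}\cdot\frac pn+\sigma_\varepsilon^2\Big(\frac np+\frac Kn\Big)\log n\right\},$$ where $D>0$ depends only on $M,z_1,z_2,e_1,e_2,r_1,r_2,b$; 2. if moreover $\lambda_K(A^\top A)\ge a\,p/K$ for a constant $a>0$, then with probability at least $1-c/n$, $$R(\widehat\alpha)-R(\alpha^*)\le R(\widehat\alpha)-\sigma_\varepsilon^2\le D'\left\{\frac{K^2}{n}+\sigma_\varepsilon^2\Big(\frac np+\frac Kn\Big)\log n\right\},$$ where $D'>0$ depends only on $M,z_1,z_2,e_1,e_2,r_1,r_2,b,a$. -/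

import Mathlib

open MeasureTheory ProbabilityTheory

noncomputable section

namespace FactorRegression

/-! ### Matrices -/

/-- The `k`-th largest eigenvalue `lam_k(Q)`, `1 ≤ k ≤ d`, of a symmetric `d × d` matrix, so that
`lam_1(Q) ≥ lam_2(Q) ≥ ... ≥ lam_d(Q)`. (It is `0` where the notion makes no sense.) -/
def kthEigenvalue {d : ℕ} (k : ℕ) (Q : Matrix (Fin d) (Fin d) ℝ) : ℝ :=
  open scoped Classical in
  if h : Q.IsHermitian ∧ 1 ≤ k ∧ k ≤ d then
    h.1.eigenvalues₀ ⟨k - 1, by rw [Fintype.card_fin]; omega⟩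
  else 0

/-- The operator norm of a square matrix with respect to the Euclidean norm. -/
def opNorm {d : ℕ} (Q : Matrix (Fin d) (Fin d) ℝ) : ℝ :=
  ‖Matrix.toEuclideanCLM (n := Fin d) (𝕜 := ℝ) Q‖

/-- The effective rank `tr(Q) / ‖Q‖`, with the convention that it is `1` for `Q = 0`. -/
def effRank {d : ℕ} (Q : Matrix (Fin d) (Fin d) ℝ) : ℝ :=
  open scoped Classical in
  if Q = 0 then 1 else Q.trace / opNorm Q

/-- The positive semi-definite square root of a positive semi-definite matrix. -/
def psdSqrt {d : ℕ} (Q : Matrix (Fin d) (Fin d) ℝ) : Matrix (Fin d) (Fin d) ℝ :=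
  open scoped MatrixOrder in
  CFC.sqrt Q

/-- The squared seminorm `‖v‖²_Q = vᵀ Q v`. -/
def quadForm {d : ℕ} (Q : Matrix (Fin d) (Fin d) ℝ) (v : EuclideanSpace ℝ (Fin d)) : ℝ :=
  inner ℝ v (Matrix.toEuclideanLin Q v)

/-! ### The minimum-norm least-squares estimator -/

/-- `α` minimizes `‖𝐗 u - 𝐲‖` over all `u`, and has the least norm among all such minimizers. -/
def IsMinNormLeastSquares {n p : ℕ} (X : Matrix (Fin n) (Fin p) ℝ)
    (y : EuclideanSpace ℝ (Fin n)) (α : EuclideanSpace ℝ (Fin p)) : Prop :=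
  (∀ u, ‖Matrix.toEuclideanLin X α - y‖ ≤ ‖Matrix.toEuclideanLin X u - y‖) ∧
  ∀ α', (∀ u, ‖Matrix.toEuclideanLin X α' - y‖ ≤ ‖Matrix.toEuclideanLin X u - y‖) → ‖α‖ ≤ ‖α'‖

theorem exists_isMinNormLeastSquares {n p : ℕ} (X : Matrix (Fin n) (Fin p) ℝ)
    (y : EuclideanSpace ℝ (Fin n)) : ∃ α, IsMinNormLeastSquares X y α := by
  let T := Matrix.toEuclideanLin X
  let S : Set (EuclideanSpace ℝ (Fin p)) := {α | ∀ u, ‖T α - y‖ ≤ ‖T u - y‖}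
  have hTc : Continuous T := T.continuous_of_finiteDimensional
  have hne : S.Nonempty := by
    obtain ⟨w, hw⟩ : ∃ w ∈ T.range, ‖y - w‖ = ⨅ v : T.range, ‖y - v‖ :=
      Submodule.exists_norm_eq_iInf_of_complete_subspace T.range
        (Submodule.complete_of_finiteDimensional T.range) y
    obtain ⟨⟨α, rfl⟩, h2⟩ := hw
    refine ⟨α, fun u => ?_⟩
    rw [norm_sub_rev, h2, norm_sub_rev (T u)]
    exact ciInf_le ⟨0, by rintro _ ⟨v, rfl⟩; exact norm_nonneg _⟩
      (⟨T u, LinearMap.mem_range_self T u⟩ : T.range)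
  have hcl : IsClosed S := by
    have : S = ⋂ u, {α | ‖T α - y‖ ≤ ‖T u - y‖} := by
      ext α
      simp [S]
    rw [this]
    exact isClosed_iInter fun u =>
      isClosed_le ((hTc.sub continuous_const).norm) continuous_const
  obtain ⟨α, hα, h0⟩ := hcl.exists_infDist_eq_dist hne 0
  refine ⟨α, hα, fun α' h' => ?_⟩
  have h1 := Metric.infDist_le_dist_of_mem (x := (0 : EuclideanSpace ℝ (Fin p))) (s := S) h'
  rw [h0] at h1
  simpa using h1

/-- The minimum-norm estimator (generalized least squares, `𝐗⁺ 𝐲`). -/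
def minNormEstimator {n p : ℕ} (X : Matrix (Fin n) (Fin p) ℝ)
    (y : EuclideanSpace ℝ (Fin n)) : EuclideanSpace ℝ (Fin p) :=
  (exists_isMinNormLeastSquares X y).choose

/-! ### Random vectors -/

section Random

variable {Ω : Type*} [MeasurableSpace Ω]

/-- The covariance matrix of a random vector. -/
def covMatrix {d : ℕ} (V : Ω → EuclideanSpace ℝ (Fin d)) (P : Measure Ω) :
    Matrix (Fin d) (Fin d) ℝ :=
  Matrix.of fun i j => cov[fun ω => V ω i, fun ω => V ω j; P]

/-- The sub-Gaussian norm `‖U‖_{ψ₂} = inf {t > 0 : 𝔼 exp(U² / t²) ≤ 2}`, in `[0, ∞]`. -/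
def psi2Norm (U : Ω → ℝ) (P : Measure Ω) : ENNReal :=
  ⨅ (t : ℝ) (_ : 0 < t ∧ ∫⁻ ω, ENNReal.ofReal (Real.exp (U ω ^ 2 / t ^ 2)) ∂P ≤ 2),
    ENNReal.ofReal t

/-- The sub-Gaussian norm of a random vector, `sup {‖⟨V, u⟩‖_{ψ₂} : ‖u‖ = 1}`. -/
def psi2NormVec {d : ℕ} (V : Ω → EuclideanSpace ℝ (Fin d)) (P : Measure Ω) : ENNReal :=
  ⨆ (u : EuclideanSpace ℝ (Fin d)) (_ : ‖u‖ = 1), psi2Norm (fun ω => inner ℝ (V ω) u) P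

/-! ### The factor regression model -/

/-- The feature vector `X = A Z + E`. -/
def feature {p K : ℕ} (A : Matrix (Fin p) (Fin K) ℝ) (Z : Ω → EuclideanSpace ℝ (Fin K))
    (E : Ω → EuclideanSpace ℝ (Fin p)) : Ω → EuclideanSpace ℝ (Fin p) :=
  fun ω => Matrix.toEuclideanLin A (Z ω) + E ω

/-- The response `y = Zᵀ β + ε`. -/
def response {K : ℕ} (β : EuclideanSpace ℝ (Fin K)) (Z : Ω → EuclideanSpace ℝ (Fin K))
    (ε : Ω → ℝ) : Ω → ℝ :=
  fun ω => inner ℝ (Z ω) β + ε ω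

/-- The prediction risk `R(α) = 𝔼[(Xᵀ α - y)²]` under the law of `(X, y)`. -/
def risk {p : ℕ} (P : Measure Ω) (X : Ω → EuclideanSpace ℝ (Fin p)) (y : Ω → ℝ)
    (α : EuclideanSpace ℝ (Fin p)) : ℝ :=
  ∫ ω, (inner ℝ (X ω) α - y ω) ^ 2 ∂P

/-- The latent factor `Z` and the noise terms `E`, `ε` are mean-zero random elements, mutually
independent. -/
structure IsFactorModel {p K : ℕ} (P : Measure Ω) (Z : Ω → EuclideanSpace ℝ (Fin K))
    (E : Ω → EuclideanSpace ℝ (Fin p)) (ε : Ω → ℝ) : Prop where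
  measurable_Z : Measurable Z
  measurable_E : Measurable E
  measurable_ε : Measurable ε
  mean_Z : ∀ k, ∫ ω, Z ω k ∂P = 0
  mean_E : ∀ j, ∫ ω, E ω j ∂P = 0
  mean_ε : ∫ ω, ε ω ∂P = 0
  indep_Z : IndepFun Z (fun ω => (E ω, ε ω)) P
  indep_E_ε : IndepFun E ε P

/-- The sub-Gaussian assumption with constant `M`: `E = Σ_E^{1/2} Ẽ` where `Ẽ` has independent
entries with zero mean, unit variance and sub-Gaussian norm at most `M`; `Z = Σ_Z^{1/2} Z̃` and
`ε = σ_ε ε̃` where `Z̃`, `ε̃` have zero mean and sub-Gaussian norm at most `M`. -/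
structure IsSubGaussianModel {p K : ℕ} (M : ℝ) (P : Measure Ω)
    (Z : Ω → EuclideanSpace ℝ (Fin K)) (E : Ω → EuclideanSpace ℝ (Fin p)) (ε : Ω → ℝ) :
    Prop where
  noise_E : ∃ E' : Ω → EuclideanSpace ℝ (Fin p), Measurable E' ∧
    (∀ᵐ ω ∂P, E ω = Matrix.toEuclideanLin (psdSqrt (covMatrix E P)) (E' ω)) ∧
    iIndepFun (fun (j : Fin p) ω => E' ω j) P ∧
    ∀ j, ∫ ω, E' ω j ∂P = 0 ∧ Var[fun ω => E' ω j; P] = 1 ∧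
      psi2Norm (fun ω => E' ω j) P ≤ ENNReal.ofReal M
  factor_Z : ∃ Z' : Ω → EuclideanSpace ℝ (Fin K), Measurable Z' ∧
    (∀ᵐ ω ∂P, Z ω = Matrix.toEuclideanLin (psdSqrt (covMatrix Z P)) (Z' ω)) ∧
    (∀ k, ∫ ω, Z' ω k ∂P = 0) ∧ psi2NormVec Z' P ≤ ENNReal.ofReal M
  noise_ε : ∃ ε' : Ω → ℝ, Measurable ε' ∧
    (∀ᵐ ω ∂P, ε ω = √(Var[ε; P]) * ε' ω) ∧
    ∫ ω, ε' ω ∂P = 0 ∧ psi2Norm ε' P ≤ ENNReal.ofReal M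

/-- `(Zs i, Es i, εs i)`, `i = 1, ..., n`, are i.i.d. copies of `(Z, E, ε)`. -/
structure IsIIDSample {Ω' : Type*} [MeasurableSpace Ω'] {n p K : ℕ} (P : Measure Ω)
    (Z : Ω → EuclideanSpace ℝ (Fin K)) (E : Ω → EuclideanSpace ℝ (Fin p)) (ε : Ω → ℝ)
    (P' : Measure Ω') (Zs : Fin n → Ω' → EuclideanSpace ℝ (Fin K))
    (Es : Fin n → Ω' → EuclideanSpace ℝ (Fin p)) (εs : Fin n → Ω' → ℝ) : Prop where
  indep : iIndepFun (fun i ω => (Zs i ω, Es i ω, εs i ω)) P'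
  identDistrib : ∀ i, IdentDistrib (fun ω => (Zs i ω, Es i ω, εs i ω))
    (fun ω => (Z ω, E ω, ε ω)) P' P

/-- The `n × p` data matrix whose rows are the observed features. -/
def dataMatrix {n p : ℕ} (Xs : Fin n → Ω → EuclideanSpace ℝ (Fin p)) (ω : Ω) :
    Matrix (Fin n) (Fin p) ℝ :=
  Matrix.of fun i j => Xs i ω j

/-- The minimum-norm estimator computed from `n` observations of the factor regression model. -/
def glsEstimator {n p K : ℕ} (A : Matrix (Fin p) (Fin K) ℝ) (β : EuclideanSpace ℝ (Fin K))
    (Zs : Fin n → Ω → EuclideanSpace ℝ (Fin K)) (Es : Fin n → Ω → EuclideanSpace ℝ (Fin p))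
    (εs : Fin n → Ω → ℝ) (ω : Ω) : EuclideanSpace ℝ (Fin p) :=
  minNormEstimator (dataMatrix (fun i => feature A (Zs i) (Es i)) ω)
    (WithLp.toLp 2 fun i => response β (Zs i) (εs i) ω)

end Random

end FactorRegression

end

/-!
Write `α₀` for the preimage of `β` under `Aᵀ` that lies in the range of `A`, so that
`‖α₀‖² ≤ bK / (z₁ λ_K(AᵀA))` and `y = Zᵀβ + ε = Xᵀα₀ + (ε - Eᵀα₀)`. The excess risk of `α` is
`‖Σ_Z^{1/2}(Aᵀα - β)‖² + ‖Σ_E^{1/2}α‖²`.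

When `𝐗 = 𝐙Aᵀ + 𝐄` has rank `n`, the estimator interpolates: `𝐗α̂ = 𝐲`, that is,
`𝐙(Aᵀα̂ - β) = 𝛆 - 𝐄α̂`, and `α̂` is short because it is the shortest interpolating vector. The
excess risk is then controlled by three bounds on the sample, `𝐙ᵀ𝐙 ≳ n Σ_Z`, `‖𝐄‖² ≲ tr Σ_E` and
`𝐗𝐗ᵀ ≳ tr Σ_E`. The last one follows from the same bound for the restriction of `𝐄` to `ker Aᵀ`,
which does not see `𝐙Aᵀ`; this restriction loses only `K` dimensions of noise, at most
`K ‖Σ_E‖ ≤ tr Σ_E / 2` of the trace.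

Each bound holds for a fixed unit vector with high probability, as it concerns a quadratic form in
independent sub-Gaussian variables, whose exponential moments are compared with Gaussian ones one
coordinate at a time. A net of the unit sphere of `ℝ^K` or `ℝ^n` makes it uniform, and `n > CK` and
`r_e(Σ_E) > Cn` pay for the size of the net. Finally `𝛆` is independent of `𝐗`, and its
quadratic forms exceed a multiple of `log n` times their mean only with probability `1 / n`.
-/

noncomputable section

namespace FactorRegression

open Metric
open Matrix (toEuclideanLin)
open Real (exp)
open ENNReal (ofReal)
open scoped NNReal Matrix.Norms.L2Operator

section Net

section Packing

variable {E : Type*} [NormedAddCommGroup E] [NormedSpace ℝ E] [FiniteDimensional ℝ E]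

theorem card_le_of_isSeparated_of_subset_closedBall {γ : ℝ≥0} (hγ : 0 < γ) {s : Finset E}
    (hs : (s : Set E) ⊆ closedBall 0 1) (hsep : IsSeparated γ (s : Set E)) :
    (s.card : ℝ) ≤ (1 + 2 / γ) ^ Module.finrank ℝ E := by
  borelize E
  let μ : Measure E := Measure.addHaar
  have hγ' : 0 < (γ : ℝ) / 2 := by positivity
  have hdisj : (s : Set E).PairwiseDisjoint fun c => ball c (γ / 2 : ℝ) := by
    intro c hc d hd hcd
    have hlt : (γ : ENNReal) < edist c d := hsep hc hd hcd
    rw [edist_nndist, ENNReal.coe_lt_coe, ← NNReal.coe_lt_coe, coe_nndist] at hlt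
    exact ball_disjoint_ball (by linarith)
  have hsub : (⋃ c ∈ s, ball (c : E) (γ / 2)) ⊆ ball (0 : E) (1 + γ / 2) := by
    refine Set.iUnion₂_subset fun c hc => ball_subset_ball' ?_
    linarith [mem_closedBall.1 (hs hc)]
  have hvol : (s.card : ENNReal) * ofReal ((γ / 2 : ℝ) ^ Module.finrank ℝ E) * μ (ball 0 1) ≤
      ofReal ((1 + γ / 2 : ℝ) ^ Module.finrank ℝ E) * μ (ball 0 1) :=
    calc
      _ = μ (⋃ c ∈ s, ball (c : E) (γ / 2)) := by
        rw [measure_biUnion_finset hdisj fun c _ => measurableSet_ball]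
        simp only [μ.addHaar_ball_of_pos _ hγ', Finset.sum_const, nsmul_eq_mul, mul_assoc]
      _ ≤ μ (ball (0 : E) (1 + γ / 2)) := measure_mono hsub
      _ = _ := μ.addHaar_ball_of_pos _ (by positivity)
  have hcard := ENNReal.toReal_le_of_le_ofReal (by positivity) ((ENNReal.mul_le_mul_iff_left
    (measure_ball_pos _ _ zero_lt_one).ne' measure_ball_lt_top.ne).1 hvol)
  rw [ENNReal.toReal_mul, ENNReal.toReal_natCast, ENNReal.toReal_ofReal (by positivity),
    ← le_div_iff₀ (by positivity), ← div_pow] at hcard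
  rwa [show (1 : ℝ) + 2 / γ = (1 + γ / 2) / (γ / 2) by field_simp; ring]

theorem packingNumber_le_of_subset_closedBall {γ : ℝ≥0} (hγ : 0 < γ) {A : Set E}
    (hA : A ⊆ closedBall 0 1) :
    packingNumber γ A ≤ (⌊(1 + 2 / γ : ℝ) ^ Module.finrank ℝ E⌋₊ : ℕ∞) := by
  refine iSup_le fun s => iSup₂_le fun hs hsep => ?_
  by_contra! hlt
  obtain ⟨t, hts, ht⟩ := Set.exists_subset_encard_eq (Order.add_one_le_of_lt hlt)
  have htfin : t.Finite := Set.finite_of_encard_eq_coe ht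
  lift t to Finset E using htfin
  have hcard := Nat.le_floor (card_le_of_isSeparated_of_subset_closedBall hγ
    (hts.trans (hs.trans hA)) (hsep.subset hts))
  rw [Set.encard_coe_eq_coe_finsetCard] at ht
  exact absurd (Nat.cast_injective ht) (Nat.lt_succ_of_le hcard).ne

theorem exists_finset_isCover_sphere (E : Type*) [NormedAddCommGroup E] [NormedSpace ℝ E]
    [FiniteDimensional ℝ E] {γ : ℝ≥0} (hγ : 0 < γ) :
    ∃ N : Finset E, (N : Set E) ⊆ sphere 0 1 ∧ IsCover γ (sphere 0 1) (N : Set E) ∧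
      (N.card : ℝ) ≤ (1 + 2 / γ) ^ Module.finrank ℝ E := by
  have hle : packingNumber γ (sphere (0 : E) 1) ≤
      (⌊(1 + 2 / γ : ℝ) ^ Module.finrank ℝ E⌋₊ : ℕ∞) :=
    packingNumber_le_of_subset_closedBall hγ sphere_subset_closedBall
  have htop : packingNumber γ (sphere (0 : E) 1) ≠ ⊤ := ne_top_of_le_ne_top (by simp) hle
  have hcard := encard_maximalSeparatedSet htop
  obtain ⟨N, hN⟩ := (Set.finite_of_encard_le_coe (hcard.trans_le hle)).exists_finset_coe
  rw [← hN, Set.encard_coe_eq_coe_finsetCard] at hcard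
  refine ⟨N, hN ▸ maximalSeparatedSet_subset, hN ▸ isCover_maximalSeparatedSet htop, ?_⟩
  exact (Nat.le_floor_iff (by positivity)).1 (by exact_mod_cast hcard.trans_le hle)

end Packing

variable {E F : Type*} [NormedAddCommGroup E] [NormedSpace ℝ E] [NormedAddCommGroup F]
  [NormedSpace ℝ F] {γ : ℝ≥0} {N : Set E}

theorem exists_norm_sub_apply_le_of_isCover (hN : IsCover γ (sphere 0 1) N) (T : E →L[ℝ] F)
    {u : E} (hu : ‖u‖ = 1) : ∃ v ∈ N, ‖T (u - v)‖ ≤ γ * ‖T‖ := by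
  obtain ⟨v, hv, (huv : edist u v ≤ γ)⟩ := hN (mem_sphere_zero_iff_norm.2 hu)
  refine ⟨v, hv, (T.le_opNorm _).trans ?_⟩
  rw [mul_comm]
  gcongr
  rwa [edist_nndist, ENNReal.coe_le_coe, nndist_eq_nnnorm] at huv

theorem one_sub_mul_norm_le_of_isCover (hN : IsCover γ (sphere 0 1) N) (T : E →L[ℝ] F) {U : ℝ}
    (hU : 0 ≤ U) (hTN : ∀ v ∈ N, ‖T v‖ ≤ U) : (1 - γ) * ‖T‖ ≤ U := by
  have hT : ‖T‖ ≤ U + γ * ‖T‖ := by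
    refine T.opNorm_le_of_unit_norm (by positivity) fun u hu => ?_
    obtain ⟨v, hv, huv⟩ := exists_norm_sub_apply_le_of_isCover hN T hu
    calc ‖T u‖ = ‖T v + T (u - v)‖ := by rw [← map_add, add_sub_cancel]
      _ ≤ ‖T v‖ + ‖T (u - v)‖ := norm_add_le _ _
      _ ≤ U + γ * ‖T‖ := add_le_add (hTN v hv) huv
  linarith

theorem sub_mul_norm_le_of_isCover (hN : IsCover γ (sphere 0 1) N) (T : E →L[ℝ] F) {l : ℝ}
    (hTN : ∀ v ∈ N, l ≤ ‖T v‖) (x : E) : (l - γ * ‖T‖) * ‖x‖ ≤ ‖T x‖ := by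
  rcases eq_or_ne x 0 with rfl | hx
  · simp
  have hunit : l - γ * ‖T‖ ≤ ‖T (‖x‖⁻¹ • x)‖ := by
    have hu : ‖‖x‖⁻¹ • x‖ = 1 := norm_smul_inv_norm (𝕜 := ℝ) hx
    obtain ⟨v, hv, huv⟩ := exists_norm_sub_apply_le_of_isCover hN T hu
    have htri := norm_sub_le (T (‖x‖⁻¹ • x)) (T (‖x‖⁻¹ • x - v))
    rw [← map_sub, sub_sub_cancel] at htri
    linarith [hTN v hv]
  rwa [map_smul, norm_smul, norm_inv, norm_norm, ← div_eq_inv_mul,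
    le_div_iff₀ (norm_pos_iff.2 hx)] at hunit

theorem norm_sq_le_four_mul_of_isCover (hN : IsCover γ (sphere 0 1) N) (hγ : (γ : ℝ) ≤ 1 / 2)
    (T : E →L[ℝ] F) {U : ℝ} (hU : 0 ≤ U) (hTN : ∀ v ∈ N, ‖T v‖ ^ 2 ≤ U) : ‖T‖ ^ 2 ≤ 4 * U := by
  have h := one_sub_mul_norm_le_of_isCover hN T (Real.sqrt_nonneg U) fun v hv =>
    Real.le_sqrt_of_sq_le (hTN v hv)
  have hT : ‖T‖ ≤ 2 * √U := by nlinarith [norm_nonneg T]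
  calc ‖T‖ ^ 2 ≤ (2 * √U) ^ 2 := by gcongr
    _ = 4 * U := by rw [mul_pow, Real.sq_sqrt hU]; norm_num

theorem div_four_mul_norm_sq_le_of_isCover (hN : IsCover γ (sphere 0 1) N) (T : E →L[ℝ] F)
    {l : ℝ} (hl : 4 * (γ : ℝ) ^ 2 * ‖T‖ ^ 2 ≤ l) (hTN : ∀ v ∈ N, l ≤ ‖T v‖ ^ 2) (x : E) :
    l / 4 * ‖x‖ ^ 2 ≤ ‖T x‖ ^ 2 := by
  have h := sub_mul_norm_le_of_isCover hN T (l := √l)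
    (fun v hv => (Real.sqrt_le_left (norm_nonneg _)).2 (hTN v hv)) x
  have hT : 2 * (γ * ‖T‖) ≤ √l := Real.le_sqrt_of_sq_le (by linarith)
  calc l / 4 * ‖x‖ ^ 2 = (√l / 2 * ‖x‖) ^ 2 := by
        rw [mul_pow, div_pow, Real.sq_sqrt (hl.trans' (by positivity))]; norm_num
    _ ≤ ‖T x‖ ^ 2 := by
        gcongr
        exact h.trans' (by gcongr; linarith)

end Net

section Operators

variable {m n ι : Type*} [Fintype n]

section Frobenius

variable [Fintype m]

/-- The squared Frobenius norm. It is kept as a plain function because the norm instance on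
matrices used here is the operator norm. -/
def frobeniusSq (R : Matrix m n ℝ) : ℝ :=
  ∑ i, ∑ j, R i j ^ 2

theorem frobeniusSq_nonneg (R : Matrix m n ℝ) : 0 ≤ frobeniusSq R := by
  unfold frobeniusSq
  positivity

theorem frobeniusSq_smul (a : ℝ) (R : Matrix m n ℝ) :
    frobeniusSq (a • R) = a ^ 2 * frobeniusSq R := by
  simp only [frobeniusSq, Matrix.smul_apply, smul_eq_mul, mul_pow, Finset.mul_sum]

theorem frobeniusSq_transpose (R : Matrix m n ℝ) : frobeniusSq R.transpose = frobeniusSq R :=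
  Finset.sum_comm

theorem trace_transpose_mul_self (R : Matrix m n ℝ) :
    (R.transpose * R).trace = frobeniusSq R := by
  simp only [Matrix.trace, Matrix.diag, Matrix.mul_apply, Matrix.transpose_apply, ← sq]
  exact Finset.sum_comm

end Frobenius

variable [DecidableEq n]

theorem toEuclideanLin_mul_apply [Fintype ι] [DecidableEq ι] (R : Matrix m n ℝ)
    (Q : Matrix n ι ℝ) (x : EuclideanSpace ℝ ι) :
    toEuclideanLin (R * Q) x = toEuclideanLin R (toEuclideanLin Q x) := by
  ext i
  simp [toEuclideanLin]

theorem toEuclideanLin_single_apply (R : Matrix m n ℝ) (j : n) (i : m) :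
    toEuclideanLin R (EuclideanSpace.single j 1) i = R i j := by
  simp [toEuclideanLin]

theorem toEuclideanLin_apply_eq_inner_row (R : Matrix m n ℝ) (x : EuclideanSpace ℝ n) (i : m) :
    toEuclideanLin R x i = inner ℝ x (WithLp.toLp 2 (R i)) := by
  simp [PiLp.inner_apply, toEuclideanLin, Matrix.mulVec, dotProduct]

variable [Fintype m]

theorem frobeniusSq_eq_sum_norm_sq [Fintype ι] (R : Matrix m n ℝ)
    (b : OrthonormalBasis ι ℝ (EuclideanSpace ℝ n)) :
    frobeniusSq R = ∑ k, ‖toEuclideanLin R (b k)‖ ^ 2 := by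
  simp only [EuclideanSpace.real_norm_sq_eq, toEuclideanLin_apply_eq_inner_row]
  rw [Finset.sum_comm]
  refine Finset.sum_congr rfl fun i _ => ?_
  rw [b.sum_sq_inner_right, EuclideanSpace.real_norm_sq_eq]

theorem toEuclideanLin_eigenvectorBasis {S : Matrix n n ℝ} (hS : S.IsHermitian) (k : n) :
    toEuclideanLin S (hS.eigenvectorBasis k) = hS.eigenvalues k • hS.eigenvectorBasis k := by
  ext i
  simpa [toEuclideanLin] using congrFun (hS.mulVec_eigenvectorBasis k) i

theorem frobeniusSq_eq_sum_eigenvalues_sq {S : Matrix n n ℝ} (hS : S.IsHermitian) :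
    frobeniusSq S = ∑ k, hS.eigenvalues k ^ 2 := by
  simp only [frobeniusSq_eq_sum_norm_sq S hS.eigenvectorBasis, toEuclideanLin_eigenvectorBasis,
    norm_smul, OrthonormalBasis.norm_eq_one, mul_one, Real.norm_eq_abs, sq_abs]

theorem norm_toEuclideanLin_le (R : Matrix m n ℝ) (x : EuclideanSpace ℝ n) :
    ‖toEuclideanLin R x‖ ≤ ‖R‖ * ‖x‖ :=
  Matrix.l2_opNorm_mulVec R x

theorem frobeniusSq_mul_le [Fintype ι] (Q : Matrix m n ℝ) (R : Matrix n ι ℝ) :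
    frobeniusSq (Q * R) ≤ ‖Q‖ ^ 2 * frobeniusSq R := by
  classical
  simp only [frobeniusSq_eq_sum_norm_sq _ (EuclideanSpace.basisFun ι ℝ), toEuclideanLin_mul_apply,
    Finset.mul_sum, ← mul_pow]
  gcongr
  exact norm_toEuclideanLin_le _ _

theorem norm_sq_le_of_forall_apply_le {R : Matrix m n ℝ} {c : ℝ} (hc : 0 ≤ c)
    (h : ∀ x, ‖toEuclideanLin R x‖ ^ 2 ≤ c * ‖x‖ ^ 2) : ‖R‖ ^ 2 ≤ c := by
  have hle : ‖R‖ ≤ √c := by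
    rw [Matrix.l2_opNorm_def]
    refine ContinuousLinearMap.opNorm_le_bound _ (Real.sqrt_nonneg c) fun x => ?_
    rw [← sq_le_sq₀ (norm_nonneg _) (by positivity), mul_pow, Real.sq_sqrt hc]
    exact h x
  exact (Real.le_sqrt (norm_nonneg R) hc).1 hle

theorem inner_toEuclideanLin_transpose [DecidableEq m] (R : Matrix m n ℝ) (x : EuclideanSpace ℝ n)
    (y : EuclideanSpace ℝ m) :
    inner ℝ x (toEuclideanLin R.transpose y) = inner ℝ (toEuclideanLin R x) y := by
  rw [← Matrix.conjTranspose_eq_transpose_of_trivial,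
    Matrix.toEuclideanLin_conjTranspose_eq_adjoint, LinearMap.adjoint_inner_right]

theorem norm_transpose [DecidableEq m] (R : Matrix m n ℝ) : ‖R.transpose‖ = ‖R‖ := by
  rw [← Matrix.conjTranspose_eq_transpose_of_trivial, Matrix.l2_opNorm_conjTranspose]

theorem frobeniusSq_le_card_mul_norm_sq (R : Matrix m n ℝ) :
    frobeniusSq R ≤ Fintype.card m * ‖R‖ ^ 2 := by
  classical
  calc frobeniusSq R = frobeniusSq (R.transpose * (1 : Matrix m m ℝ)) := by
        rw [Matrix.mul_one, frobeniusSq_transpose]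
    _ ≤ ‖R.transpose‖ ^ 2 * frobeniusSq (1 : Matrix m m ℝ) := frobeniusSq_mul_le _ _
    _ = Fintype.card m * ‖R‖ ^ 2 := by
        rw [norm_transpose, frobeniusSq, mul_comm]
        simp [Matrix.one_apply]

end Operators

section Scalar

theorem exp_neg_le_quadratic {x : ℝ} (hx : 0 ≤ x) : exp (-x) ≤ 1 - x + x ^ 2 / 2 := by
  have hexp := Real.quadratic_le_exp_of_nonneg hx
  have hprod : 1 ≤ (1 - x + x ^ 2 / 2) * (1 + x + x ^ 2 / 2) := by nlinarith [sq_nonneg (x ^ 2)]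
  rw [Real.exp_neg, inv_le_iff_one_le_mul₀ (Real.exp_pos x)]
  exact hprod.trans (mul_le_mul_of_nonneg_left hexp (by nlinarith [sq_nonneg (x - 1)]))

theorem exp_le_add_exp_sq (x : ℝ) : exp x ≤ x + exp (x ^ 2) := by
  have hsq := Real.add_one_le_exp (x ^ 2)
  rcases le_or_gt |x| 1 with h | h
  · linarith [(abs_le.1 (Real.abs_exp_sub_one_sub_id_le h)).2]
  · rcases lt_abs.1 h with h | h
    · linarith [Real.exp_le_exp.2 (by nlinarith : x ≤ x ^ 2)]
    · nlinarith [Real.exp_le_one_iff.2 (by linarith : x ≤ 0)]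

theorem inv_sqrt_one_sub_two_mul_le_exp {x : ℝ} (hx : x ≤ 1 / 4) :
    (√(1 - 2 * x))⁻¹ ≤ exp (x + 4 * x ^ 2) := by
  have hpos : 0 < 1 - 2 * x := by linarith
  have hinv : (1 - 2 * x)⁻¹ ≤ 1 + (2 * x + 8 * x ^ 2) := by
    rw [inv_le_iff_one_le_mul₀ hpos]
    nlinarith [mul_nonneg (sq_nonneg x) (by linarith : 0 ≤ 1 - 4 * x)]
  rw [← Real.sqrt_inv, Real.sqrt_le_left (Real.exp_pos _).le, ← Real.exp_nat_mul]
  calc (1 - 2 * x)⁻¹ ≤ 2 * x + 8 * x ^ 2 + 1 := by linarith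
    _ ≤ exp (2 * x + 8 * x ^ 2) := Real.add_one_le_exp _
    _ = exp ((2 : ℕ) * (x + 4 * x ^ 2)) := by push_cast; ring_nf

end Scalar

section Exponential

variable {α ι : Type*} [MeasurableSpace α]

theorem ofReal_exp_add (a b : ℝ) : ofReal (exp (a + b)) = ofReal (exp a) * ofReal (exp b) := by
  rw [Real.exp_add, ENNReal.ofReal_mul (Real.exp_pos _).le]

theorem ofReal_exp_sum (s : Finset ι) (a : ι → ℝ) :
    ofReal (exp (∑ i ∈ s, a i)) = ∏ i ∈ s, ofReal (exp (a i)) := by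
  rw [Real.exp_sum, ENNReal.ofReal_prod_of_nonneg fun i _ => (Real.exp_pos _).le]

theorem lintegral_exp_add_le {μ : Measure α} {φ ψ : α → ℝ} (hφ : AEMeasurable φ μ)
    (hψ : AEMeasurable ψ μ) {a b : ℝ}
    (ha : ∫⁻ x, ofReal (exp (2 * φ x)) ∂μ ≤ ofReal (exp (2 * a)))
    (hb : ∫⁻ x, ofReal (exp (2 * ψ x)) ∂μ ≤ ofReal (exp (2 * b))) :
    ∫⁻ x, ofReal (exp (φ x + ψ x)) ∂μ ≤ ofReal (exp (a + b)) := by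
  have hsq (t : ℝ) : ofReal (exp t) ^ (2 : ℝ) = ofReal (exp (2 * t)) := by
    rw [ENNReal.ofReal_rpow_of_pos (Real.exp_pos _), ← Real.exp_mul, mul_comm]
  have hroot (t : ℝ) : ofReal (exp (2 * t)) ^ (1 / 2 : ℝ) = ofReal (exp t) := by
    rw [ENNReal.ofReal_rpow_of_pos (Real.exp_pos _), ← Real.exp_mul, mul_comm, ← mul_assoc]
    norm_num
  have hHölder := ENNReal.lintegral_mul_le_Lp_mul_Lq μ Real.HolderConjugate.two_two
    (f := fun x => ofReal (exp (φ x))) (g := fun x => ofReal (exp (ψ x)))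
    (by fun_prop) (by fun_prop)
  simp only [Pi.mul_apply, hsq, ← ofReal_exp_add] at hHölder
  refine hHölder.trans ?_
  rw [ofReal_exp_add, ← hroot a, ← hroot b]
  gcongr

variable [Fintype ι]

theorem lintegral_prod_pi {X : ι → Type*} [∀ i, MeasurableSpace (X i)]
    (μ : ∀ i, Measure (X i)) [∀ i, IsProbabilityMeasure (μ i)] {f : ∀ i, X i → ENNReal}
    (hf : ∀ i, Measurable (f i)) :
    ∫⁻ x, ∏ i, f i (x i) ∂Measure.pi μ = ∏ i, ∫⁻ t, f i t ∂μ i := by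
  rw [lintegral_prod_eq_prod_lintegral_of_indepFun Finset.univ
    (fun i (x : ∀ i, X i) => f i (x i)) (iIndepFun_pi fun i => (hf i).aemeasurable)
    (fun i => (hf i).comp (measurable_pi_apply i))]
  exact Finset.prod_congr rfl fun i _ => (measurePreserving_eval μ i).lintegral_comp (hf i)

end Exponential

section Gaussian

theorem lintegral_exp_mul_gaussianReal (t : ℝ) :
    ∫⁻ x, ofReal (exp (t * x)) ∂gaussianReal 0 1 = ofReal (exp (t ^ 2 / 2)) := by
  have hmgf := congrFun (mgf_fun_id_gaussianReal (μ := 0) (v := 1)) t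
  rw [zero_mul, zero_add, NNReal.coe_one, one_mul] at hmgf
  rw [← hmgf, mgf, ofReal_integral_eq_lintegral_ofReal (integrable_exp_mul_gaussianReal t)
    (.of_forall fun _ => (Real.exp_pos _).le)]

theorem lintegral_exp_mul_sq_gaussianReal {x : ℝ} (hx : x < 1 / 2) :
    ∫⁻ t, ofReal (exp (x * t ^ 2)) ∂gaussianReal 0 1 = ofReal (√(1 - 2 * x))⁻¹ := by
  have hpos : 0 < 1 / 2 - x := by linarith
  have hdensity (t : ℝ) : (gaussianPDF 0 1 * fun t => ofReal (exp (x * t ^ 2))) t =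
      ofReal ((√(2 * Real.pi))⁻¹ * exp (-(1 / 2 - x) * t ^ 2)) := by
    simp only [Pi.mul_apply, gaussianPDF, gaussianPDFReal, NNReal.coe_one, mul_one, sub_zero]
    rw [← ENNReal.ofReal_mul (by positivity), mul_assoc, ← Real.exp_add]
    ring_nf
  rw [gaussianReal_of_var_ne_zero 0 one_ne_zero,
    lintegral_withDensity_eq_lintegral_mul _ (measurable_gaussianPDF 0 1) (by fun_prop)]
  simp only [hdensity]
  rw [← ofReal_integral_eq_lintegral_ofReal ((integrable_exp_neg_mul_sq hpos).const_mul _)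
    (.of_forall fun _ => by positivity), integral_const_mul, integral_gaussian,
    ← Real.sqrt_inv, ← Real.sqrt_mul (by positivity), ← Real.sqrt_inv]
  congr 2
  field_simp

variable {ι : Type*} [Fintype ι]

theorem lintegral_exp_inner_stdGaussian (w : EuclideanSpace ℝ ι) :
    ∫⁻ h, ofReal (exp (inner ℝ w h)) ∂stdGaussian (EuclideanSpace ℝ ι) =
      ofReal (exp (‖w‖ ^ 2 / 2)) := by
  rw [← map_pi_eq_stdGaussian, lintegral_map (by fun_prop) (by fun_prop)]
  simp only [PiLp.inner_apply, RCLike.inner_apply, conj_trivial, ofReal_exp_sum, mul_comm _ (w _)]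
  rw [lintegral_prod_pi (fun _ => gaussianReal 0 1)
    (f := fun i t => ofReal (exp (w i * t))) (fun i => by fun_prop)]
  simp only [lintegral_exp_mul_gaussianReal]
  rw [← ofReal_exp_sum, EuclideanSpace.real_norm_sq_eq, Finset.sum_div]

variable [DecidableEq ι]

theorem inner_toEuclideanLin_sum_eigenvectorBasis {S : Matrix ι ι ℝ} (hS : S.IsHermitian)
    (x : ι → ℝ) :
    inner ℝ (∑ i, x i • hS.eigenvectorBasis i)
      (toEuclideanLin S (∑ i, x i • hS.eigenvectorBasis i)) =
      ∑ k, hS.eigenvalues k * x k ^ 2 := by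
  simp only [map_sum, map_smul, toEuclideanLin_eigenvectorBasis, smul_smul]
  rw [hS.eigenvectorBasis.orthonormal.inner_sum]
  refine Finset.sum_congr rfl fun k _ => ?_
  rw [conj_trivial]
  ring

theorem eigenvalues_le_of_forall_inner_le {S : Matrix ι ι ℝ} (hS : S.IsHermitian) {a : ℝ}
    (ha : ∀ x : EuclideanSpace ℝ ι, inner ℝ x (toEuclideanLin S x) ≤ a * ‖x‖ ^ 2) (k : ι) :
    hS.eigenvalues k ≤ a := by
  simpa [toEuclideanLin_eigenvectorBasis, inner_smul_right] using ha (hS.eigenvectorBasis k)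

theorem lintegral_exp_quadratic_stdGaussian_le {S : Matrix ι ι ℝ} (hS : S.IsHermitian)
    (hS4 : ∀ x : EuclideanSpace ℝ ι, inner ℝ x (toEuclideanLin S x) ≤ 1 / 4 * ‖x‖ ^ 2) :
    ∫⁻ h, ofReal (exp (inner ℝ h (toEuclideanLin S h))) ∂stdGaussian (EuclideanSpace ℝ ι) ≤
      ofReal (exp (S.trace + 4 * frobeniusSq S)) := by
  have htrace : S.trace = ∑ k, hS.eigenvalues k := hS.trace_eq_sum_eigenvalues
  rw [stdGaussian_eq_map_pi_orthonormalBasis hS.eigenvectorBasis,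
    lintegral_map (by fun_prop) (by fun_prop)]
  simp only [inner_toEuclideanLin_sum_eigenvectorBasis, ofReal_exp_sum]
  rw [lintegral_prod_pi (fun _ => gaussianReal 0 1)
    (f := fun i t => ofReal (exp (hS.eigenvalues i * t ^ 2))) (fun i => by fun_prop), htrace,
    frobeniusSq_eq_sum_eigenvalues_sq hS, Finset.mul_sum, ← Finset.sum_add_distrib,
    ofReal_exp_sum]
  refine Finset.prod_le_prod' fun k _ => ?_
  have hk := eigenvalues_le_of_forall_inner_le hS hS4 k
  rw [lintegral_exp_mul_sq_gaussianReal (by linarith)]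
  exact ENNReal.ofReal_le_ofReal (inv_sqrt_one_sub_two_mul_le_exp hk)

theorem lintegral_exp_norm_sq_stdGaussian_le {m : Type*} [Fintype m] (R : Matrix m ι ℝ) {a : ℝ}
    (ha : 0 ≤ a) (haR : 4 * a * ‖R‖ ^ 2 ≤ 1) :
    ∫⁻ h, ofReal (exp (a * ‖toEuclideanLin R h‖ ^ 2)) ∂stdGaussian (EuclideanSpace ℝ ι) ≤
      ofReal (exp (2 * a * frobeniusSq R)) := by
  classical
  let S : Matrix ι ι ℝ := a • (R.transpose * R)
  have hS : S.IsHermitian := by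
    have h := Matrix.isHermitian_conjTranspose_mul_self R
    rw [Matrix.conjTranspose_eq_transpose_of_trivial] at h
    exact h.smul (IsSelfAdjoint.all a)
  have hform (x : EuclideanSpace ℝ ι) : inner ℝ x (toEuclideanLin S x) =
      a * ‖toEuclideanLin R x‖ ^ 2 := by
    simp only [S, map_smul, LinearMap.smul_apply, inner_smul_right, toEuclideanLin_mul_apply,
      inner_toEuclideanLin_transpose, real_inner_self_eq_norm_sq]
  have hS4 (x : EuclideanSpace ℝ ι) : inner ℝ x (toEuclideanLin S x) ≤ 1 / 4 * ‖x‖ ^ 2 := by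
    rw [hform]
    calc a * ‖toEuclideanLin R x‖ ^ 2 ≤ a * (‖R‖ * ‖x‖) ^ 2 := by
          gcongr; exact norm_toEuclideanLin_le R x
      _ = 4 * a * ‖R‖ ^ 2 / 4 * ‖x‖ ^ 2 := by ring
      _ ≤ 1 / 4 * ‖x‖ ^ 2 := by gcongr
  have hfrob : frobeniusSq S ≤ a ^ 2 * (‖R‖ ^ 2 * frobeniusSq R) := by
    rw [frobeniusSq_smul]
    have h := frobeniusSq_mul_le R.transpose R
    rw [norm_transpose] at h
    gcongr
  have hexponent : S.trace + 4 * frobeniusSq S ≤ 2 * a * frobeniusSq R := by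
    rw [Matrix.trace_smul, smul_eq_mul, trace_transpose_mul_self]
    have h := mul_le_mul_of_nonneg_right haR (mul_nonneg ha (frobeniusSq_nonneg R))
    nlinarith
  simp only [← hform]
  exact (lintegral_exp_quadratic_stdGaussian_le hS hS4).trans
    (ENNReal.ofReal_le_ofReal (Real.exp_le_exp.2 hexponent))

end Gaussian

section UpperTail

variable {Ω : Type*} [MeasurableSpace Ω] {P : Measure Ω}

theorem lintegral_exp_mul_le_of_hasSubgaussianMGF {X : Ω → ℝ} {c : ℝ≥0}
    (hX : HasSubgaussianMGF X c P) (t : ℝ) :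
    ∫⁻ ω, ofReal (exp (t * X ω)) ∂P ≤ ofReal (exp (c * t ^ 2 / 2)) := by
  rw [← ofReal_integral_eq_lintegral_ofReal (hX.integrable_exp_mul t)
    (.of_forall fun _ => (Real.exp_pos _).le)]
  exact ENNReal.ofReal_le_ofReal (hX.mgf_le t)

variable {ι : Type*} [Fintype ι]

theorem lintegral_exp_norm_sq_eq_lintegral_stdGaussian [SFinite P] {V : Ω → EuclideanSpace ℝ ι}
    (hV : AEMeasurable V P) {l : ℝ} (hl : 0 ≤ l) :
    ∫⁻ ω, ofReal (exp (l * ‖V ω‖ ^ 2)) ∂P =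
      ∫⁻ h, ∫⁻ ω, ofReal (exp (√(2 * l) * inner ℝ h (V ω))) ∂P
        ∂stdGaussian (EuclideanSpace ℝ ι) := by
  have hgauss (v : EuclideanSpace ℝ ι) : ofReal (exp (l * ‖v‖ ^ 2)) =
      ∫⁻ h, ofReal (exp (√(2 * l) * inner ℝ h v)) ∂stdGaussian (EuclideanSpace ℝ ι) := by
    have h := lintegral_exp_inner_stdGaussian (√(2 * l) • v)
    rw [norm_smul, mul_pow, Real.norm_eq_abs, sq_abs, Real.sq_sqrt (by positivity)] at h
    simp only [real_inner_smul_left, real_inner_comm _ v] at h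
    rw [h]
    ring_nf
  simp only [hgauss]
  refine lintegral_lintegral_swap ?_
  have hfst : AEMeasurable (fun q : Ω × EuclideanSpace ℝ ι => V q.1)
      (P.prod (stdGaussian (EuclideanSpace ℝ ι))) :=
    hV.comp_quasiMeasurePreserving Measure.quasiMeasurePreserving_fst
  exact ((AEMeasurable.inner (𝕜 := ℝ) measurable_snd.aemeasurable hfst).const_mul
    _).exp.ennreal_ofReal

variable [DecidableEq ι] {m : Type*} [Fintype m]

theorem lintegral_exp_norm_sq_le_of_hasSubgaussianMGF [SFinite P] {V : Ω → EuclideanSpace ℝ ι}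
    (hV : AEMeasurable V P) {R : Matrix m ι ℝ} {s : ℝ≥0}
    (hsub : ∀ w, HasSubgaussianMGF (fun ω => inner ℝ w (V ω)) (s * ‖toEuclideanLin R w‖₊ ^ 2) P)
    {l : ℝ} (hl : 0 ≤ l) (hlR : 4 * l * s * ‖R‖ ^ 2 ≤ 1) :
    ∫⁻ ω, ofReal (exp (l * ‖V ω‖ ^ 2)) ∂P ≤ ofReal (exp (2 * l * s * frobeniusSq R)) := by
  rw [lintegral_exp_norm_sq_eq_lintegral_stdGaussian hV hl]
  calc
    _ ≤ ∫⁻ h, ofReal (exp (l * s * ‖toEuclideanLin R h‖ ^ 2))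
        ∂stdGaussian (EuclideanSpace ℝ ι) := by
      refine lintegral_mono fun h => ?_
      refine (lintegral_exp_mul_le_of_hasSubgaussianMGF (hsub h) _).trans_eq ?_
      rw [Real.sq_sqrt (by positivity)]
      push_cast
      ring_nf
    _ ≤ ofReal (exp (2 * (l * s) * frobeniusSq R)) :=
      lintegral_exp_norm_sq_stdGaussian_le R (by positivity) (by rwa [← mul_assoc])
    _ = _ := by ring_nf

end UpperTail

section Decoupling

variable {ι : Type*} [Fintype ι]

theorem map_pi_gaussianReal_eq_map_smul_stdGaussian (s : ℝ≥0) :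
    (Measure.pi fun _ : ι => gaussianReal 0 s).map (WithLp.toLp 2) =
      (stdGaussian (EuclideanSpace ℝ ι)).map fun h => √s • h := by
  have hscale : gaussianReal 0 s = (gaussianReal 0 1).map (√s * ·) := by
    rw [gaussianReal_map_const_mul]
    congr 1
    · simp
    · ext
      simp [Real.sq_sqrt s.coe_nonneg]
  have hpi := Measure.pi_map_pi (μ := fun _ : ι => gaussianReal 0 1)
    (f := fun _ x => √s * x) fun _ => by fun_prop
  rw [hscale, ← hpi, ← map_pi_eq_stdGaussian, Measure.map_map (by fun_prop) (by fun_prop),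
    Measure.map_map (by fun_prop) (by fun_prop)]
  congr 1

variable [DecidableEq ι]

theorem lintegral_pi_le_of_update_le {X : ι → Type*} [∀ i, MeasurableSpace (X i)]
    {μ ν : ∀ i, Measure (X i)} [∀ i, IsProbabilityMeasure (μ i)]
    [∀ i, IsProbabilityMeasure (ν i)] {f : (∀ i, X i) → ENNReal} (hf : Measurable f)
    (h : ∀ i x, ∫⁻ t, f (Function.update x i t) ∂μ i ≤ ∫⁻ t, f (Function.update x i t) ∂ν i) :
    ∫⁻ x, f x ∂Measure.pi μ ≤ ∫⁻ x, f x ∂Measure.pi ν := by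
  have hmarginal (s : Finset ι) : lmarginal μ s f ≤ lmarginal ν s f := by
    induction s using Finset.induction_on with
    | empty => simp
    | insert i s hi ih =>
      -- `κ` integrates the coordinate `i` against `μ i` and the coordinates in `s` against `ν`.
      let κ : ∀ i, Measure (X i) := Function.update ν i (μ i)
      have hκi : κ i = μ i := Function.update_self ..
      have hκne {j : ι} (hj : j ≠ i) : κ j = ν j := Function.update_of_ne hj ..
      have hκ (j : ι) : IsProbabilityMeasure (κ j) := by
        rcases eq_or_ne j i with rfl | hj
        · rw [hκi]; infer_instance
        · rw [hκne hj]; infer_instance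
      have hκs (g : (∀ i, X i) → ENNReal) : lmarginal κ s g = lmarginal ν s g := by
        have hκν : (fun j : s => κ j) = fun j : s => ν j :=
          funext fun j => hκne fun hj => hi (hj ▸ j.2)
        funext x
        simp only [lmarginal, hκν]
      calc lmarginal μ (insert i s) f
          ≤ fun x => ∫⁻ t, lmarginal ν s f (Function.update x i t) ∂μ i := fun x => by
            rw [lmarginal_insert f hf hi]
            exact lintegral_mono fun t => ih _
        _ = lmarginal κ (insert i s) f := by
            funext x
            rw [lmarginal_insert f hf hi, hκi, hκs]
        _ ≤ lmarginal ν (insert i s) f := by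
            rw [lmarginal_insert' f hf hi, lmarginal_insert' f hf hi, hκs, hκi]
            exact lmarginal_mono fun x => h i x
  have x₀ : ∀ i, X i := fun i => (μ i).nonempty_of_neZero.some
  simpa only [lmarginal_univ] using hmarginal Finset.univ x₀

theorem exists_inner_toEuclideanLin_update_eq_affine {S : Matrix ι ι ℝ} {i : ι} (hSi : S i i = 0)
    (x : ι → ℝ) :
    ∃ a b : ℝ, ∀ t, inner ℝ (WithLp.toLp 2 (Function.update x i t))
      (toEuclideanLin S (WithLp.toLp 2 (Function.update x i t))) = a * t + b := by
  let e : EuclideanSpace ℝ ι := EuclideanSpace.single i 1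
  let z : EuclideanSpace ℝ ι := WithLp.toLp 2 (Function.update x i 0)
  have hupdate (t : ℝ) : WithLp.toLp 2 (Function.update x i t) = z + t • e := by
    ext j
    rcases eq_or_ne j i with rfl | hj <;> simp [*, e, z]
  have hdiag : inner ℝ e (toEuclideanLin S e) = 0 := by
    simp [e, EuclideanSpace.inner_single_left, toEuclideanLin_single_apply, hSi]
  refine ⟨inner ℝ z (toEuclideanLin S e) + inner ℝ e (toEuclideanLin S z),
    inner ℝ z (toEuclideanLin S z), fun t => ?_⟩
  rw [hupdate]
  simp only [map_add, map_smul, inner_add_left, inner_add_right, inner_smul_left,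
    inner_smul_right, hdiag, conj_trivial]
  ring

theorem measurable_ofReal_exp_inner_toEuclideanLin (S : Matrix ι ι ℝ) :
    Measurable fun x : EuclideanSpace ℝ ι => ofReal (exp (inner ℝ x (toEuclideanLin S x))) := by
  have hS : Continuous (toEuclideanLin S) := (toEuclideanLin S).continuous_of_finiteDimensional
  fun_prop

/-- Since `S` has zero diagonal, the exponent is affine in each coordinate, so the coordinates can
be replaced by Gaussian ones, one at a time. -/
theorem lintegral_exp_quadratic_pi_le_stdGaussian {μ : ι → Measure ℝ}
    [∀ i, IsProbabilityMeasure (μ i)] {s : ℝ≥0} (hμ : ∀ i, HasSubgaussianMGF id s (μ i))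
    {S : Matrix ι ι ℝ} (hS : ∀ i, S i i = 0) :
    ∫⁻ x, ofReal (exp (inner ℝ (WithLp.toLp 2 x) (toEuclideanLin S (WithLp.toLp 2 x))))
        ∂Measure.pi μ ≤
      ∫⁻ h, ofReal (exp (inner ℝ h (toEuclideanLin ((s : ℝ) • S) h)))
        ∂stdGaussian (EuclideanSpace ℝ ι) := by
  have hf := measurable_ofReal_exp_inner_toEuclideanLin S
  calc
    _ ≤ ∫⁻ x, ofReal (exp (inner ℝ (WithLp.toLp 2 x) (toEuclideanLin S (WithLp.toLp 2 x))))
        ∂Measure.pi fun _ => gaussianReal 0 s := by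
      refine lintegral_pi_le_of_update_le (hf.comp (by fun_prop)) fun i x => ?_
      obtain ⟨a, b, hab⟩ := exists_inner_toEuclideanLin_update_eq_affine (hS i) x
      simp only [hab, ofReal_exp_add]
      rw [lintegral_mul_const _ (by fun_prop), lintegral_mul_const _ (by fun_prop)]
      refine mul_le_mul' ?_ le_rfl
      refine (lintegral_exp_mul_le_of_hasSubgaussianMGF (hμ i) _).trans_eq ?_
      rw [← ofReal_integral_eq_lintegral_ofReal (integrable_exp_mul_gaussianReal _)
        (.of_forall fun _ => (Real.exp_pos _).le)]
      have hmgf := congrFun (mgf_fun_id_gaussianReal (μ := 0) (v := s))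
      simp only [mgf, zero_mul, zero_add] at hmgf
      rw [hmgf]
    _ = ∫⁻ h, ofReal (exp (inner ℝ (√s • h) (toEuclideanLin S (√s • h))))
        ∂stdGaussian (EuclideanSpace ℝ ι) := by
      rw [← lintegral_map hf (by fun_prop), map_pi_gaussianReal_eq_map_smul_stdGaussian,
        lintegral_map hf (by fun_prop)]
    _ = _ := by
      simp only [map_smul, LinearMap.smul_apply, inner_smul_left, inner_smul_right, conj_trivial,
        ← mul_assoc, Real.mul_self_sqrt s.coe_nonneg]

theorem lintegral_exp_quadratic_pi_le {μ : ι → Measure ℝ} [∀ i, IsProbabilityMeasure (μ i)]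
    {s : ℝ≥0} (hμ : ∀ i, HasSubgaussianMGF id s (μ i)) {S : Matrix ι ι ℝ} (hS : S.IsHermitian)
    (hS0 : ∀ i, S i i = 0)
    (hS4 : ∀ x : EuclideanSpace ℝ ι, s * inner ℝ x (toEuclideanLin S x) ≤ 1 / 4 * ‖x‖ ^ 2) :
    ∫⁻ x, ofReal (exp (inner ℝ (WithLp.toLp 2 x) (toEuclideanLin S (WithLp.toLp 2 x))))
        ∂Measure.pi μ ≤
      ofReal (exp (4 * s ^ 2 * frobeniusSq S)) := by
  have htrace : ((s : ℝ) • S).trace = 0 := by simp [Matrix.trace, hS0]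
  refine (lintegral_exp_quadratic_pi_le_stdGaussian hμ hS0).trans
    ((lintegral_exp_quadratic_stdGaussian_le (hS.smul (IsSelfAdjoint.all _)) fun x => ?_).trans_eq
      ?_)
  · simpa only [map_smul, LinearMap.smul_apply, inner_smul_right] using hS4 x
  · rw [htrace, frobeniusSq_smul, zero_add, mul_assoc]

end Decoupling

section SecondMoment

variable {Ω : Type*} [MeasurableSpace Ω] {P : Measure Ω} {X : Ω → ℝ} {c : ℝ≥0}

theorem integral_pow_four_le_of_hasSubgaussianMGF (hX : HasSubgaussianMGF X c P) :
    ∫ ω, X ω ^ 4 ∂P ≤ 36 * c ^ 2 := by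
  rcases eq_or_ne c 0 with rfl | hc
  · have hzero : ∀ᵐ ω ∂P, X ω ^ 4 = 0 := by
      filter_upwards [hX.ae_eq_zero_of_hasSubgaussianMGF_zero] with ω hω
      simp [hω]
    simp [integral_congr_ae hzero]
  have hc0 : (0 : ℝ) < c := by positivity
  -- `t = √(2 / c)` makes both Gaussian bounds `exp (c t² / 2)` equal to `e`.
  let t : ℝ := √(2 / c)
  have ht2 : t ^ 2 = 2 / c := Real.sq_sqrt (by positivity)
  have ht4 : (t ^ 4)⁻¹ = c ^ 2 / 4 := by
    rw [show t ^ 4 = (t ^ 2) ^ 2 by ring, ht2]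
    field_simp
    norm_num
  have hpoint (x : ℝ) : x ^ 4 ≤ 24 * (c ^ 2 / 4) * (exp (t * x) + exp (-t * x)) := by
    have hpow : t ^ 4 * x ^ 4 / 24 ≤ exp |t * x| := by
      have h := Real.pow_div_factorial_le_exp |t * x| (abs_nonneg _) 4
      rwa [Even.pow_abs (by decide), mul_pow, show ((Nat.factorial 4 : ℕ) : ℝ) = 24 by norm_num
        [Nat.factorial]] at h
    have hexp := Real.exp_abs_le (t * x)
    rw [← ht4, mul_assoc, mul_left_comm, ← div_eq_inv_mul, le_div_iff₀ (by positivity), neg_mul]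
    linarith
  have hmgf (u : ℝ) (hu : u ^ 2 = 2 / c) : ∫ ω, exp (u * X ω) ∂P ≤ 3 := by
    refine (hX.mgf_le u).trans ?_
    rw [hu, mul_div_cancel₀ _ hc0.ne', div_self two_ne_zero]
    exact (Real.exp_one_lt_d9.trans (by norm_num)).le
  calc ∫ ω, X ω ^ 4 ∂P
      ≤ ∫ ω, 24 * (c ^ 2 / 4) * (exp (t * X ω) + exp (-t * X ω)) ∂P :=
        integral_mono_of_nonneg (.of_forall fun ω => by positivity)
          (((hX.integrable_exp_mul t).add (hX.integrable_exp_mul (-t))).const_mul _)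
          (.of_forall fun ω => hpoint (X ω))
    _ = 24 * (c ^ 2 / 4) * (∫ ω, exp (t * X ω) ∂P + ∫ ω, exp (-t * X ω) ∂P) := by
        rw [integral_const_mul, integral_add (hX.integrable_exp_mul t) (hX.integrable_exp_mul _)]
    _ ≤ 24 * (c ^ 2 / 4) * (3 + 3) := by
        gcongr
        exacts [hmgf t ht2, hmgf (-t) (by rw [neg_sq, ht2])]
    _ = 36 * c ^ 2 := by ring

theorem lintegral_exp_neg_mul_sq_le_of_hasSubgaussianMGF [IsProbabilityMeasure P]
    (hX : HasSubgaussianMGF X c P) (hX2 : ∫ ω, X ω ^ 2 ∂P = 1) {a : ℝ} (ha : 0 ≤ a) :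
    ∫⁻ ω, ofReal (exp (-(a * X ω ^ 2))) ∂P ≤ ofReal (exp (-a + 18 * c ^ 2 * a ^ 2)) := by
  have hInt (k : ℕ) : Integrable (fun ω => X ω ^ k) P :=
    integrable_pow_of_integrable_exp_mul one_ne_zero (hX.integrable_exp_mul 1)
      (hX.integrable_exp_mul (-1)) k
  have hlin : Integrable (fun ω => 1 - a * X ω ^ 2) P :=
    (integrable_const _).sub ((hInt 2).const_mul a)
  have hquad : Integrable (fun ω => a ^ 2 / 2 * X ω ^ 4) P := (hInt 4).const_mul _
  have hpoint (x : ℝ) : exp (-(a * x ^ 2)) ≤ 1 - a * x ^ 2 + a ^ 2 / 2 * x ^ 4 :=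
    (exp_neg_le_quadratic (by positivity)).trans_eq (by ring)
  calc
    _ ≤ ∫⁻ ω, ofReal (1 - a * X ω ^ 2 + a ^ 2 / 2 * X ω ^ 4) ∂P :=
      lintegral_mono fun ω => ENNReal.ofReal_le_ofReal (hpoint (X ω))
    _ = ofReal (1 - a + a ^ 2 / 2 * ∫ ω, X ω ^ 4 ∂P) := by
      rw [← ofReal_integral_eq_lintegral_ofReal
          (f := fun ω => 1 - a * X ω ^ 2 + a ^ 2 / 2 * X ω ^ 4) (hlin.add hquad)
        (.of_forall fun ω => (Real.exp_pos _).le.trans (hpoint (X ω))), integral_add hlin hquad,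
        integral_sub (integrable_const _) ((hInt 2).const_mul a), integral_const_mul,
        integral_const_mul, hX2, integral_const, probReal_univ, one_smul, mul_one]
    _ ≤ ofReal (exp (-a + 18 * c ^ 2 * a ^ 2)) := by
      refine ENNReal.ofReal_le_ofReal (le_trans ?_ (Real.add_one_le_exp _))
      have h4 := mul_le_mul_of_nonneg_left (integral_pow_four_le_of_hasSubgaussianMGF hX)
        (by positivity : 0 ≤ a ^ 2 / 2)
      linarith

end SecondMoment

section LowerTail

variable {m ι : Type*} [Fintype m]

theorem transpose_mul_self_apply_self_nonneg (R : Matrix m ι ℝ) (i : ι) :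
    0 ≤ (R.transpose * R) i i := by
  simp only [Matrix.mul_apply, Matrix.transpose_apply, ← sq]
  positivity

variable [Fintype ι]

variable {μ : ι → Measure ℝ} [∀ i, IsProbabilityMeasure (μ i)] {s : ℝ≥0}

theorem lintegral_exp_neg_diagonal_pi_le (hμ : ∀ i, HasSubgaussianMGF id s (μ i))
    (hμ2 : ∀ i, ∫ x, x ^ 2 ∂μ i = 1) {d : ι → ℝ} {L : ℝ} (hd : ∀ i, 0 ≤ d i)
    (hdL : ∀ i, d i ≤ L) :
    ∫⁻ x, ofReal (exp (-∑ i, d i * x i ^ 2)) ∂Measure.pi μ ≤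
      ofReal (exp (-∑ i, d i + 18 * s ^ 2 * (L * ∑ i, d i))) := by
  simp only [← Finset.sum_neg_distrib, ofReal_exp_sum]
  rw [lintegral_prod_pi μ (f := fun i t => ofReal (exp (-(d i * t ^ 2))))
    (fun i => by fun_prop), Finset.mul_sum, Finset.mul_sum, ← Finset.sum_add_distrib,
    ofReal_exp_sum]
  refine Finset.prod_le_prod' fun i _ =>
    (lintegral_exp_neg_mul_sq_le_of_hasSubgaussianMGF (hμ i) (hμ2 i) (hd i)).trans ?_
  rw [sq (d i)]
  gcongr
  exacts [hd i, hdL i]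

variable [DecidableEq ι]

theorem frobeniusSq_sub_diagonal_le (W : Matrix ι ι ℝ) :
    frobeniusSq (W - Matrix.diagonal W.diag) ≤ frobeniusSq W := by
  refine Finset.sum_le_sum fun i _ => Finset.sum_le_sum fun j _ => ?_
  rcases eq_or_ne i j with rfl | hij
  · simpa using sq_nonneg (W i i)
  · simp [Matrix.diagonal_apply_ne _ hij]

theorem inner_toEuclideanLin_transpose_mul_self_sub_diagonal (R : Matrix m ι ℝ)
    (x : EuclideanSpace ℝ ι) :
    inner ℝ x (toEuclideanLin
      (R.transpose * R - Matrix.diagonal (R.transpose * R).diag) x) =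
      ‖toEuclideanLin R x‖ ^ 2 - ∑ i, (R.transpose * R) i i * x i ^ 2 := by
  classical
  rw [map_sub, LinearMap.sub_apply, inner_sub_right, toEuclideanLin_mul_apply,
    inner_toEuclideanLin_transpose, real_inner_self_eq_norm_sq]
  congr 1
  simp only [PiLp.inner_apply, RCLike.inner_apply, conj_trivial]
  refine Finset.sum_congr rfl fun i _ => ?_
  simp only [toEuclideanLin, Matrix.toLpLin_apply, Matrix.mulVec_diagonal, Matrix.diag_apply]
  ring

theorem transpose_mul_self_apply_self_le (R : Matrix m ι ℝ) (i : ι) :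
    (R.transpose * R) i i ≤ ‖R‖ ^ 2 := by
  have h := norm_toEuclideanLin_le R (EuclideanSpace.single i 1)
  rw [PiLp.norm_single, norm_one, mul_one] at h
  calc (R.transpose * R) i i = ‖toEuclideanLin R (EuclideanSpace.single i 1)‖ ^ 2 := by
        simp only [EuclideanSpace.real_norm_sq_eq, toEuclideanLin_single_apply, Matrix.mul_apply,
          Matrix.transpose_apply, ← sq]
    _ ≤ ‖R‖ ^ 2 := by gcongr

theorem lintegral_exp_neg_offDiagonal_pi_le (hμ : ∀ i, HasSubgaussianMGF id s (μ i))
    (R : Matrix m ι ℝ) {l : ℝ} (hl : 0 ≤ l) (hlR : 4 * l * s * ‖R‖ ^ 2 ≤ 1) :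
    ∫⁻ x, ofReal (exp (-(l * (‖toEuclideanLin R (WithLp.toLp 2 x)‖ ^ 2 -
        ∑ i, (R.transpose * R) i i * x i ^ 2)))) ∂Measure.pi μ ≤
      ofReal (exp (4 * s ^ 2 * (l ^ 2 * (‖R‖ ^ 2 * frobeniusSq R)))) := by
  classical
  let W : Matrix ι ι ℝ := R.transpose * R
  let S : Matrix ι ι ℝ := (-l) • (W - Matrix.diagonal W.diag)
  have hform (x : EuclideanSpace ℝ ι) : inner ℝ x (toEuclideanLin S x) =
      -(l * (‖toEuclideanLin R x‖ ^ 2 - ∑ i, W i i * x i ^ 2)) := by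
    rw [map_smul, LinearMap.smul_apply, inner_smul_right,
      inner_toEuclideanLin_transpose_mul_self_sub_diagonal, neg_mul]
  have hS : S.IsHermitian := by
    have hW := Matrix.isHermitian_conjTranspose_mul_self R
    rw [Matrix.conjTranspose_eq_transpose_of_trivial] at hW
    exact (hW.sub (Matrix.isHermitian_diagonal _)).smul (IsSelfAdjoint.all _)
  have hS0 (i : ι) : S i i = 0 := by simp [S]
  have hS4 (x : EuclideanSpace ℝ ι) :
      s * inner ℝ x (toEuclideanLin S x) ≤ 1 / 4 * ‖x‖ ^ 2 := by
    have hdiag : ∑ i, W i i * x i ^ 2 ≤ ‖R‖ ^ 2 * ‖x‖ ^ 2 := by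
      rw [EuclideanSpace.real_norm_sq_eq, Finset.mul_sum]
      gcongr with i
      exact transpose_mul_self_apply_self_le R i
    rw [hform]
    calc s * -(l * (‖toEuclideanLin R x‖ ^ 2 - ∑ i, W i i * x i ^ 2))
        ≤ s * (l * (‖R‖ ^ 2 * ‖x‖ ^ 2)) := by
          rw [← mul_neg]
          gcongr
          linarith [sq_nonneg ‖toEuclideanLin R x‖]
      _ = 4 * l * s * ‖R‖ ^ 2 / 4 * ‖x‖ ^ 2 := by ring
      _ ≤ 1 / 4 * ‖x‖ ^ 2 := by gcongr
  have hfrob : frobeniusSq S ≤ l ^ 2 * (‖R‖ ^ 2 * frobeniusSq R) := by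
    rw [frobeniusSq_smul, neg_sq]
    have h := frobeniusSq_mul_le R.transpose R
    rw [norm_transpose] at h
    gcongr
    exact (frobeniusSq_sub_diagonal_le W).trans h
  have hbound := lintegral_exp_quadratic_pi_le hμ hS hS0 hS4
  simp only [hform] at hbound
  exact hbound.trans (by gcongr)

theorem lintegral_exp_neg_norm_sq_pi_le (hμ : ∀ i, HasSubgaussianMGF id s (μ i))
    (hμ2 : ∀ i, ∫ x, x ^ 2 ∂μ i = 1) (R : Matrix m ι ℝ) {l : ℝ} (hl : 0 ≤ l)
    (hlR : 8 * l * s * ‖R‖ ^ 2 ≤ 1) :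
    ∫⁻ x, ofReal (exp (-(l * ‖toEuclideanLin R (WithLp.toLp 2 x)‖ ^ 2))) ∂Measure.pi μ ≤
      ofReal (exp (-(l * frobeniusSq R) + 44 * l ^ 2 * s ^ 2 * ‖R‖ ^ 2 * frobeniusSq R)) := by
  let W : Matrix ι ι ℝ := R.transpose * R
  let N : (ι → ℝ) → ℝ := fun x => ‖toEuclideanLin R (WithLp.toLp 2 x)‖ ^ 2
  let D : (ι → ℝ) → ℝ := fun x => ∑ i, W i i * x i ^ 2
  have hN : Measurable N := by
    have hR : Continuous (toEuclideanLin R) := (toEuclideanLin R).continuous_of_finiteDimensional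
    exact Continuous.measurable (by fun_prop)
  have hD : Measurable D := by fun_prop
  have hsum : ∑ i, W i i = frobeniusSq R := trace_transpose_mul_self R
  have hdiag : ∫⁻ x, ofReal (exp (2 * -(l * D x))) ∂Measure.pi μ ≤
      ofReal (exp (2 * (-(l * frobeniusSq R) +
        36 * l ^ 2 * s ^ 2 * ‖R‖ ^ 2 * frobeniusSq R))) := by
    have h := lintegral_exp_neg_diagonal_pi_le hμ hμ2 (d := fun i => 2 * l * W i i)
      (L := 2 * l * ‖R‖ ^ 2)
      (fun i => mul_nonneg (by positivity) (transpose_mul_self_apply_self_nonneg R i))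
      (fun i => mul_le_mul_of_nonneg_left (transpose_mul_self_apply_self_le R i) (by positivity))
    rw [← Finset.mul_sum, hsum] at h
    refine le_of_eq_of_le ?_ (h.trans_eq (by ring_nf))
    simp only [D, mul_neg, Finset.mul_sum, ← mul_assoc]
  have hoff : ∫⁻ x, ofReal (exp (2 * -(l * (N x - D x)))) ∂Measure.pi μ ≤
      ofReal (exp (2 * (8 * l ^ 2 * s ^ 2 * ‖R‖ ^ 2 * frobeniusSq R))) := by
    have h := lintegral_exp_neg_offDiagonal_pi_le hμ R (l := 2 * l) (by positivity) (by linarith)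
    refine le_of_eq_of_le ?_ (h.trans_eq (by ring_nf))
    simp only [N, D, W, mul_neg, ← mul_assoc]
  calc ∫⁻ x, ofReal (exp (-(l * N x))) ∂Measure.pi μ
      = ∫⁻ x, ofReal (exp (-(l * D x) + -(l * (N x - D x)))) ∂Measure.pi μ := by ring_nf
    _ ≤ _ := lintegral_exp_add_le (hD.const_mul l).neg.aemeasurable
        ((hN.sub hD).const_mul l).neg.aemeasurable hdiag hoff
    _ = _ := by ring_nf

end LowerTail

section Psi2Norm

variable {Ω : Type*} [MeasurableSpace Ω] {P : Measure Ω} {U : Ω → ℝ}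

theorem lintegral_exp_sq_div_le_two_of_psi2Norm_lt {M : ℝ≥0} (h : psi2Norm U P < M) :
    ∫⁻ ω, ofReal (exp (U ω ^ 2 / M ^ 2)) ∂P ≤ 2 := by
  simp only [psi2Norm, iInf_lt_iff] at h
  obtain ⟨t, ⟨ht, hexp⟩, htM⟩ := h
  have htM : t ≤ M := ((ENNReal.ofReal_lt_coe_iff ht.le).1 htM).le
  refine le_trans (lintegral_mono fun ω => ?_) hexp
  gcongr

theorem integrable_exp_and_integral_le_of_lintegral_le (hU : AEMeasurable U P) {b : ℝ}
    (hb : 0 ≤ b) (h : ∫⁻ ω, ofReal (exp (U ω)) ∂P ≤ ofReal b) :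
    Integrable (fun ω => exp (U ω)) P ∧ ∫ ω, exp (U ω) ∂P ≤ b := by
  have hpos : 0 ≤ᵐ[P] fun ω => exp (U ω) := .of_forall fun _ => (Real.exp_pos _).le
  have hInt : Integrable (fun ω => exp (U ω)) P :=
    (lintegral_ofReal_ne_top_iff_integrable (by fun_prop) hpos).1
      (h.trans_lt ENNReal.ofReal_lt_top).ne
  refine ⟨hInt, ?_⟩
  rwa [← ofReal_integral_eq_lintegral_ofReal hInt hpos, ENNReal.ofReal_le_ofReal_iff hb] at h

theorem exp_mul_le_exp_mul_exp {c : ℝ} (hc : 0 < c) (t u : ℝ) :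
    exp (t * u) ≤ exp (c * t ^ 2 / 2) * exp (1 / 2 * (u ^ 2 / c)) := by
  rw [← Real.exp_add, Real.exp_le_exp]
  have h : c * t ^ 2 / 2 + 1 / 2 * (u ^ 2 / c) - t * u = (c * t - u) ^ 2 / (2 * c) := by
    field_simp
    ring
  linarith [h ▸ (by positivity : 0 ≤ (c * t - u) ^ 2 / (2 * c))]

variable [IsProbabilityMeasure P]

theorem integrable_exp_mul_and_integral_le_rpow (hU : Integrable (fun ω => exp (U ω)) P) {θ : ℝ}
    (hθ0 : 0 ≤ θ) (hθ1 : θ ≤ 1) :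
    Integrable (fun ω => exp (θ * U ω)) P ∧ ∫ ω, exp (θ * U ω) ∂P ≤ (∫ ω, exp (U ω) ∂P) ^ θ := by
  have hInt : Integrable (fun ω => exp (θ * U ω)) P :=
    convex_integrableExpSet.ordConnected.out (x := 0) (y := 1)
      (by simp [integrableExpSet]) (by simpa [integrableExpSet] using hU) ⟨hθ0, hθ1⟩
  refine ⟨hInt, ?_⟩
  have hpow (ω : Ω) : exp (θ * U ω) = exp (U ω) ^ θ := by rw [← Real.exp_mul, mul_comm]
  simp only [hpow] at hInt ⊢
  exact (Real.concaveOn_rpow hθ0 hθ1).le_map_integral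
    (Real.continuous_rpow_const hθ0).continuousOn isClosed_Ici
    (.of_forall fun _ => (Real.exp_pos _).le) hU hInt

theorem hasSubgaussianMGF_of_integral_exp_sq_div_le_two {c : ℝ≥0} (hc : 0 < c)
    (hU : AEMeasurable U P) (hmean : ∫ ω, U ω ∂P = 0)
    (hInt : Integrable (fun ω => exp (U ω ^ 2 / c)) P) (hle : ∫ ω, exp (U ω ^ 2 / c) ∂P ≤ 2) :
    HasSubgaussianMGF U (2 * c) P := by
  have hc' : (0 : ℝ) < c := hc
  have hsq {θ : ℝ} (hθ0 : 0 ≤ θ) (hθ1 : θ ≤ 1) :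
      Integrable (fun ω => exp (θ * (U ω ^ 2 / c))) P ∧
        ∫ ω, exp (θ * (U ω ^ 2 / c)) ∂P ≤ exp θ := by
    have h := integrable_exp_mul_and_integral_le_rpow hInt hθ0 hθ1
    refine ⟨h.1, h.2.trans ?_⟩
    rw [← Real.exp_one_rpow θ]
    gcongr
    linarith [Real.exp_one_gt_d9]
  have hhalf := hsq (θ := 1 / 2) (by norm_num) (by norm_num)
  have hexp (t : ℝ) : Integrable (fun ω => exp (t * U ω)) P :=
    (hhalf.1.const_mul (exp (c * t ^ 2 / 2))).mono' (by fun_prop) <| .of_forall fun ω => by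
      rw [Real.norm_of_nonneg (Real.exp_pos _).le]
      exact exp_mul_le_exp_mul_exp hc' t (U ω)
  refine ⟨hexp, fun t => ?_⟩
  rw [mgf, NNReal.coe_mul, NNReal.coe_two, mul_assoc, mul_div_cancel_left₀ _ two_ne_zero]
  rcases le_total (c * t ^ 2) 1 with hsmall | hlarge
  · have hlin : Integrable (fun ω => t * U ω) P :=
      (integrable_of_mem_interior_integrableExpSet (by simp [integrableExpSet, hexp])).const_mul t
    have hθ := hsq (θ := c * t ^ 2) (by positivity) hsmall
    calc ∫ ω, exp (t * U ω) ∂P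
        ≤ ∫ ω, (t * U ω + exp (c * t ^ 2 * (U ω ^ 2 / c))) ∂P :=
          integral_mono (hexp t) (hlin.add hθ.1) fun ω =>
            (exp_le_add_exp_sq (t * U ω)).trans_eq (by congr 2; field_simp)
      _ ≤ exp (c * t ^ 2) := by
          rw [integral_add hlin hθ.1, integral_const_mul, hmean, mul_zero, zero_add]
          exact hθ.2
  · calc ∫ ω, exp (t * U ω) ∂P
        ≤ ∫ ω, exp (c * t ^ 2 / 2) * exp (1 / 2 * (U ω ^ 2 / c)) ∂P :=
          integral_mono (hexp t) (hhalf.1.const_mul _) fun ω =>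
            exp_mul_le_exp_mul_exp hc' t (U ω)
      _ ≤ exp (c * t ^ 2 / 2) * exp (1 / 2) := by
          rw [integral_const_mul]
          gcongr
          exact hhalf.2
      _ ≤ exp (c * t ^ 2) := by
          rw [← Real.exp_add, Real.exp_le_exp]
          linarith

theorem hasSubgaussianMGF_of_psi2Norm_le {M : ℝ≥0} (hM : 0 < M) (hU : AEMeasurable U P)
    (hmean : ∫ ω, U ω ∂P = 0) (h : psi2Norm U P ≤ M) : HasSubgaussianMGF U (8 * M ^ 2) P := by
  have hlt : psi2Norm U P < (2 * M : ℝ≥0) :=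
    h.trans_lt (ENNReal.coe_lt_coe.2 (lt_mul_of_one_lt_left hM one_lt_two))
  obtain ⟨hInt, hle⟩ := integrable_exp_and_integral_le_of_lintegral_le
    (by fun_prop : AEMeasurable (fun ω => U ω ^ 2 / (2 * M : ℝ≥0) ^ 2) P) zero_le_two
    (by simpa using lintegral_exp_sq_div_le_two_of_psi2Norm_lt hlt)
  have hsub := hasSubgaussianMGF_of_integral_exp_sq_div_le_two (c := (2 * M) ^ 2)
    (by positivity) hU hmean (by exact_mod_cast hInt) (by exact_mod_cast hle)
  rwa [show 2 * (2 * M) ^ 2 = 8 * M ^ 2 by ring] at hsub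

end Psi2Norm

section Chernoff

variable {Ω : Type*} [MeasurableSpace Ω] {P : Measure Ω}

theorem measure_le_of_lintegral_exp_le {φ : Ω → ℝ} (hφ : AEMeasurable φ P) {a : ℝ}
    (h : ∫⁻ ω, ofReal (exp (φ ω)) ∂P ≤ ofReal (exp a)) (b : ℝ) :
    P {ω | b ≤ φ ω} ≤ ofReal (exp (a - b)) := by
  rw [Real.exp_sub, ENNReal.ofReal_div_of_pos (Real.exp_pos _)]
  calc P {ω | b ≤ φ ω} ≤ P {ω | ofReal (exp b) ≤ ofReal (exp (φ ω))} :=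
        measure_mono fun ω hω => ENNReal.ofReal_le_ofReal (Real.exp_le_exp.2 hω)
    _ ≤ (∫⁻ ω, ofReal (exp (φ ω)) ∂P) / ofReal (exp b) :=
        meas_ge_le_lintegral_div (by fun_prop) (by simp [Real.exp_pos]) ENNReal.ofReal_ne_top
    _ ≤ _ := by gcongr

end Chernoff

section Eigenvalues

theorem mul_norm_sq_le_inner_of_le_eigenvalues {ι : Type*} [Fintype ι] [DecidableEq ι]
    {S : Matrix ι ι ℝ} (hS : S.IsHermitian) {a : ℝ} (ha : ∀ k, a ≤ hS.eigenvalues k)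
    (x : EuclideanSpace ℝ ι) : a * ‖x‖ ^ 2 ≤ inner ℝ x (toEuclideanLin S x) := by
  have hquad := inner_toEuclideanLin_sum_eigenvectorBasis hS (hS.eigenvectorBasis.repr x)
  rw [hS.eigenvectorBasis.sum_repr] at hquad
  rw [hquad, ← hS.eigenvectorBasis.repr.norm_map, EuclideanSpace.real_norm_sq_eq, Finset.mul_sum]
  gcongr with k
  exact ha k

variable {d : ℕ} {Q : Matrix (Fin d) (Fin d) ℝ}

theorem kthEigenvalue_le_eigenvalues (hQ : Q.IsHermitian) (i : Fin d) :
    kthEigenvalue d Q ≤ hQ.eigenvalues i := by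
  rw [kthEigenvalue, dif_pos ⟨hQ, i.pos, le_rfl⟩]
  refine hQ.eigenvalues₀_antitone (Fin.le_def.2 (Nat.le_sub_one_of_lt ?_))
  simpa using (((Fintype.equivOfCardEq (Fintype.card_fin _)).symm i :
    Fin (Fintype.card (Fin d)))).2

theorem kthEigenvalue_mul_norm_sq_le_quadForm (hQ : Q.IsHermitian) (x : EuclideanSpace ℝ (Fin d)) :
    kthEigenvalue d Q * ‖x‖ ^ 2 ≤ quadForm Q x :=
  mul_norm_sq_le_inner_of_le_eigenvalues hQ (kthEigenvalue_le_eigenvalues hQ) x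

theorem kthEigenvalue_pos_iff_posDef (hd : 1 ≤ d) (hQ : Q.IsHermitian) :
    0 < kthEigenvalue d Q ↔ Q.PosDef := by
  rw [hQ.posDef_iff_eigenvalues_pos]
  refine ⟨fun h i => h.trans_le (kthEigenvalue_le_eigenvalues hQ i), fun h => ?_⟩
  rw [kthEigenvalue, dif_pos ⟨hQ, hd, le_rfl⟩]
  simpa [Matrix.IsHermitian.eigenvalues] using
    h (Fintype.equivOfCardEq (Fintype.card_fin _) ⟨d - 1, by rw [Fintype.card_fin]; lia⟩)

end Eigenvalues

section SquareRoot

variable {d : ℕ} {Q : Matrix (Fin d) (Fin d) ℝ}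

theorem opNorm_eq_norm (Q : Matrix (Fin d) (Fin d) ℝ) : opNorm Q = ‖Q‖ :=
  rfl

theorem psdSqrt_transpose (Q : Matrix (Fin d) (Fin d) ℝ) :
    (psdSqrt Q).transpose = psdSqrt Q := by
  open scoped MatrixOrder in
  have h : (psdSqrt Q).IsHermitian := (Matrix.nonneg_iff_posSemidef.1 (CFC.sqrt_nonneg Q)).1
  rwa [← Matrix.conjTranspose_eq_transpose_of_trivial]

theorem psdSqrt_mul_self (hQ : Q.PosSemidef) : psdSqrt Q * psdSqrt Q = Q := by
  open scoped MatrixOrder in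
  exact CFC.sqrt_mul_sqrt_self Q hQ.nonneg

theorem quadForm_eq_norm_psdSqrt_sq (hQ : Q.PosSemidef) (x : EuclideanSpace ℝ (Fin d)) :
    quadForm Q x = ‖toEuclideanLin (psdSqrt Q) x‖ ^ 2 := by
  conv_lhs => rw [quadForm, ← psdSqrt_mul_self hQ, toEuclideanLin_mul_apply]
  rw [← real_inner_self_eq_norm_sq, ← inner_toEuclideanLin_transpose, psdSqrt_transpose]

theorem norm_psdSqrt_sq (hQ : Q.PosSemidef) : ‖psdSqrt Q‖ ^ 2 = ‖Q‖ := by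
  have h := Matrix.l2_opNorm_conjTranspose_mul_self (psdSqrt Q)
  rw [Matrix.conjTranspose_eq_transpose_of_trivial, psdSqrt_transpose, psdSqrt_mul_self hQ] at h
  rw [h, sq]

theorem frobeniusSq_psdSqrt (hQ : Q.PosSemidef) : frobeniusSq (psdSqrt Q) = Q.trace := by
  rw [← trace_transpose_mul_self, psdSqrt_transpose, psdSqrt_mul_self hQ]

theorem psdSqrt_surjective (hQ : Q.PosDef) :
    Function.Surjective (toEuclideanLin (psdSqrt Q)) := fun x => by
  refine ⟨toEuclideanLin (psdSqrt Q * Q⁻¹) x, ?_⟩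
  rw [← toEuclideanLin_mul_apply, ← Matrix.mul_assoc, psdSqrt_mul_self hQ.posSemidef,
    Matrix.mul_nonsing_inv _ ((Matrix.isUnit_iff_isUnit_det _).1 hQ.isUnit)]
  ext i
  simp [toEuclideanLin]

end SquareRoot

section Covariance

variable {Ω : Type*} [MeasurableSpace Ω] {P : Measure Ω} {d : ℕ}
  {V : Ω → EuclideanSpace ℝ (Fin d)}

theorem integral_inner_eq_zero (hV : Integrable V P) (hmean : ∀ i, ∫ ω, V ω i ∂P = 0)
    (x : EuclideanSpace ℝ (Fin d)) : ∫ ω, inner ℝ x (V ω) ∂P = 0 := by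
  have hzero : ∫ ω, V ω ∂P = 0 := by
    ext i
    rw [eval_integral_piLp fun i => hV.eval_piLp i, hmean i, PiLp.zero_apply]
  rw [integral_inner hV, hzero, inner_zero_right]

variable [IsProbabilityMeasure P]

theorem variance_inner_eq_quadForm (hV : MemLp V 2 P) (x : EuclideanSpace ℝ (Fin d)) :
    Var[fun ω => inner ℝ x (V ω); P] = quadForm (covMatrix V P) x := by
  have hcoord (i : Fin d) : MemLp (fun ω => x i * V ω i) 2 P := (hV.eval_piLp i).const_mul (x i)
  rw [← covariance_self (hV.const_inner x).aestronglyMeasurable.aemeasurable]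
  simp only [PiLp.inner_apply, RCLike.inner_apply, conj_trivial, mul_comm _ (x _)]
  rw [covariance_fun_sum_fun_sum hcoord hcoord]
  simp only [covariance_const_mul_left, covariance_const_mul_right, quadForm, PiLp.inner_apply,
    RCLike.inner_apply, conj_trivial, Matrix.toLpLin_apply, Matrix.mulVec, dotProduct, covMatrix,
    Matrix.of_apply, Finset.sum_mul]
  exact Finset.sum_congr rfl fun i _ => Finset.sum_congr rfl fun j _ => by ring

theorem covMatrix_posSemidef (hV : MemLp V 2 P) : (covMatrix V P).PosSemidef := by
  refine .of_dotProduct_mulVec_nonneg (by ext; simp [covMatrix, covariance_comm]) fun x => ?_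
  have h := variance_nonneg (fun ω => inner ℝ (WithLp.toLp 2 x) (V ω)) P
  rw [variance_inner_eq_quadForm hV] at h
  simpa [quadForm, PiLp.inner_apply, toEuclideanLin, dotProduct, mul_comm] using h

theorem integral_inner_sq_eq_norm_psdSqrt_sq (hV : MemLp V 2 P)
    (hmean : ∀ i, ∫ ω, V ω i ∂P = 0) (x : EuclideanSpace ℝ (Fin d)) :
    ∫ ω, inner ℝ x (V ω) ^ 2 ∂P = ‖toEuclideanLin (psdSqrt (covMatrix V P)) x‖ ^ 2 := by
  rw [← quadForm_eq_norm_psdSqrt_sq (covMatrix_posSemidef hV), ← variance_inner_eq_quadForm hV,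
    variance_of_integral_eq_zero (hV.const_inner x).aestronglyMeasurable.aemeasurable
      (integral_inner_eq_zero (hV.integrable (by norm_num)) hmean x)]

end Covariance

section SubgaussianVector

variable {Ω : Type*} [MeasurableSpace Ω] {P : Measure Ω} {d : ℕ} {s : ℝ≥0}
  {V : Ω → EuclideanSpace ℝ (Fin d)}

theorem memLp_of_hasSubgaussianMGF_inner {c : EuclideanSpace ℝ (Fin d) → ℝ≥0}
    (hV : ∀ w, HasSubgaussianMGF (fun ω => inner ℝ w (V ω)) (c w) P) : MemLp V 2 P := by
  refine .of_eval_piLp fun i => ?_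
  simpa [EuclideanSpace.inner_single_left] using (hV (EuclideanSpace.single i 1)).memLp 2

theorem hasSubgaussianMGF_const_mul {X : Ω → ℝ} (hX : HasSubgaussianMGF X s P) (r : ℝ) :
    HasSubgaussianMGF (fun ω => r * X ω) (s * ‖r‖₊ ^ 2) P := by
  convert hX.const_mul r using 1
  refine NNReal.eq ?_
  push_cast
  rw [Real.norm_eq_abs, sq_abs]
  exact mul_comm _ _

theorem hasSubgaussianMGF_inner_of_iIndepFun {ι : Type*} [Fintype ι] {V : Ω → EuclideanSpace ℝ ι}
    (hind : iIndepFun (fun i ω => V ω i) P) (hV : ∀ i, HasSubgaussianMGF (fun ω => V ω i) s P)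
    (w : EuclideanSpace ℝ ι) :
    HasSubgaussianMGF (fun ω => inner ℝ w (V ω)) (s * ‖w‖₊ ^ 2) P := by
  have h := HasSubgaussianMGF.sum_of_iIndepFun (s := Finset.univ)
    (hind.comp (fun i x => w i * x) fun i => by fun_prop)
    fun i _ => hasSubgaussianMGF_const_mul (hV i) (w i)
  have hnorm : ∑ i, s * ‖w i‖₊ ^ 2 = s * ‖w‖₊ ^ 2 := by
    rw [← Finset.mul_sum]
    ext
    simp [EuclideanSpace.norm_sq_eq]
  rw [hnorm] at h
  simpa [PiLp.inner_apply, mul_comm] using h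

theorem hasSubgaussianMGF_inner_of_psi2NormVec_le [IsProbabilityMeasure P] {M : ℝ≥0} (hM : 0 < M)
    (hV : Measurable V) (hmean : ∀ i, ∫ ω, V ω i ∂P = 0) (h : psi2NormVec V P ≤ M)
    (w : EuclideanSpace ℝ (Fin d)) :
    HasSubgaussianMGF (fun ω => inner ℝ w (V ω)) (8 * M ^ 2 * ‖w‖₊ ^ 2) P := by
  have hunit {u : EuclideanSpace ℝ (Fin d)} (hu : ‖u‖ = 1) :
      psi2Norm (fun ω => inner ℝ u (V ω)) P ≤ M := by
    simp_rw [real_inner_comm (V _) u]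
    exact (le_iSup₂ (f := fun (u : EuclideanSpace ℝ (Fin d)) (_ : ‖u‖ = 1) =>
      psi2Norm (fun ω => inner ℝ (V ω) u) P) u hu).trans h
  have hInt : Integrable V P := .of_eval_piLp fun i => by
    have hi := hunit (u := EuclideanSpace.single i 1) (by simp)
    simp only [EuclideanSpace.inner_single_left, map_one, one_mul] at hi
    exact (hasSubgaussianMGF_of_psi2Norm_le hM (by fun_prop) (hmean i) hi).integrable
  rcases eq_or_ne w 0 with rfl | hw
  · simp
  · have hu := hasSubgaussianMGF_const_mul (hasSubgaussianMGF_of_psi2Norm_le hM (by fun_prop)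
      (integral_inner_eq_zero hInt hmean (‖w‖⁻¹ • w)) (hunit (norm_smul_inv_norm hw))) ‖w‖
    simpa [real_inner_smul_left, mul_inv_cancel_left₀ (norm_ne_zero_iff.2 hw)] using hu

theorem hasSubgaussianMGF_inner_of_ae_eq {ι ι' : Type*} [Fintype ι] [DecidableEq ι] [Fintype ι']
    [DecidableEq ι'] {V : Ω → EuclideanSpace ℝ ι} {W : Ω → EuclideanSpace ℝ ι'}
    {B : Matrix ι' ι ℝ} (hWV : ∀ᵐ ω ∂P, W ω = toEuclideanLin B (V ω))
    (hV : ∀ w, HasSubgaussianMGF (fun ω => inner ℝ w (V ω)) (s * ‖w‖₊ ^ 2) P)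
    (w : EuclideanSpace ℝ ι') :
    HasSubgaussianMGF (fun ω => inner ℝ w (W ω)) (s * ‖toEuclideanLin B.transpose w‖₊ ^ 2) P := by
  refine (hV _).congr ?_
  filter_upwards [hWV] with ω hω
  rw [hω, real_inner_comm, inner_toEuclideanLin_transpose, real_inner_comm]

end SubgaussianVector

section Model

variable {Ω : Type*} [MeasurableSpace Ω] {P : Measure Ω} {p K : ℕ}
  {Z : Ω → EuclideanSpace ℝ (Fin K)} {E : Ω → EuclideanSpace ℝ (Fin p)} {ε : Ω → ℝ} {M : ℝ≥0}

namespace IsSubGaussianModel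

variable [IsProbabilityMeasure P]

theorem hasSubgaussianMGF_inner_factor (h : IsSubGaussianModel M P Z E ε) (hM : 0 < M)
    (w : EuclideanSpace ℝ (Fin K)) : HasSubgaussianMGF (fun ω => inner ℝ w (Z ω))
      (8 * M ^ 2 * ‖toEuclideanLin (psdSqrt (covMatrix Z P)) w‖₊ ^ 2) P := by
  obtain ⟨Z', hZ', hZ, hmean, hpsi⟩ := h.factor_Z
  rw [ENNReal.ofReal_coe_nnreal] at hpsi
  simpa only [psdSqrt_transpose] using hasSubgaussianMGF_inner_of_ae_eq hZ
    (hasSubgaussianMGF_inner_of_psi2NormVec_le hM hZ' hmean hpsi) w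

theorem exists_standardized_noise (h : IsSubGaussianModel M P Z E ε) (hM : 0 < M) :
    ∃ E' : Ω → EuclideanSpace ℝ (Fin p), Measurable E' ∧
      (∀ᵐ ω ∂P, E ω = toEuclideanLin (psdSqrt (covMatrix E P)) (E' ω)) ∧
      iIndepFun (fun j ω => E' ω j) P ∧
      ∀ j, HasSubgaussianMGF (fun ω => E' ω j) (8 * M ^ 2) P ∧ ∫ ω, E' ω j ^ 2 ∂P = 1 := by
  obtain ⟨E', hE', hE, hind, hcoord⟩ := h.noise_E
  refine ⟨E', hE', hE, hind, fun j => ?_⟩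
  obtain ⟨hmean, hvar, hpsi⟩ := hcoord j
  rw [ENNReal.ofReal_coe_nnreal] at hpsi
  refine ⟨hasSubgaussianMGF_of_psi2Norm_le hM (by fun_prop) hmean hpsi, ?_⟩
  rw [← hvar, variance_of_integral_eq_zero (by fun_prop) hmean]

theorem hasSubgaussianMGF_inner_noise (h : IsSubGaussianModel M P Z E ε) (hM : 0 < M)
    (w : EuclideanSpace ℝ (Fin p)) : HasSubgaussianMGF (fun ω => inner ℝ w (E ω))
      (8 * M ^ 2 * ‖toEuclideanLin (psdSqrt (covMatrix E P)) w‖₊ ^ 2) P := by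
  obtain ⟨E', -, hE, hind, hE'⟩ := h.exists_standardized_noise hM
  simpa only [psdSqrt_transpose] using hasSubgaussianMGF_inner_of_ae_eq hE
    (hasSubgaussianMGF_inner_of_iIndepFun hind fun j => (hE' j).1) w

theorem hasSubgaussianMGF_response_noise (h : IsSubGaussianModel M P Z E ε) (hM : 0 < M) :
    HasSubgaussianMGF ε (8 * M ^ 2 * ‖√(Var[ε; P])‖₊ ^ 2) P := by
  obtain ⟨ε', hε', hε, hmean, hpsi⟩ := h.noise_ε
  rw [ENNReal.ofReal_coe_nnreal] at hpsi
  refine (hasSubgaussianMGF_const_mul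
    (hasSubgaussianMGF_of_psi2Norm_le hM hε'.aemeasurable hmean hpsi) _).congr ?_
  filter_upwards [hε] with ω hω
  rw [hω]

theorem memLp_factor (h : IsSubGaussianModel M P Z E ε) (hM : 0 < M) : MemLp Z 2 P :=
  memLp_of_hasSubgaussianMGF_inner (h.hasSubgaussianMGF_inner_factor hM)

theorem memLp_noise (h : IsSubGaussianModel M P Z E ε) (hM : 0 < M) : MemLp E 2 P :=
  memLp_of_hasSubgaussianMGF_inner (h.hasSubgaussianMGF_inner_noise hM)

theorem memLp_response_noise (h : IsSubGaussianModel M P Z E ε) (hM : 0 < M) : MemLp ε 2 P :=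
  (h.hasSubgaussianMGF_response_noise hM).memLp 2

end IsSubGaussianModel

end Model

section Risk

variable {Ω : Type*} {p K : ℕ} {Z : Ω → EuclideanSpace ℝ (Fin K)}
  {E : Ω → EuclideanSpace ℝ (Fin p)} {ε : Ω → ℝ}

theorem inner_feature_sub_response (A : Matrix (Fin p) (Fin K) ℝ)
    (β : EuclideanSpace ℝ (Fin K)) (α : EuclideanSpace ℝ (Fin p)) (ω : Ω) :
    inner ℝ (feature A Z E ω) α - response β Z ε ω =
      inner ℝ (toEuclideanLin A.transpose α - β) (Z ω) + (inner ℝ α (E ω) - ε ω) := by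
  rw [feature, response, inner_add_left, inner_sub_left, ← inner_toEuclideanLin_transpose,
    real_inner_comm α (E ω), real_inner_comm β,
    real_inner_comm (toEuclideanLin A.transpose α)]
  ring

variable [MeasurableSpace Ω] {P : Measure Ω}

theorem integral_add_sq_of_indepFun {f g : Ω → ℝ} (hf : MemLp f 2 P) (hg : MemLp g 2 P)
    (hfg : IndepFun f g P) (hmean : ∫ ω, f ω ∂P = 0) :
    ∫ ω, (f ω + g ω) ^ 2 ∂P = ∫ ω, f ω ^ 2 ∂P + ∫ ω, g ω ^ 2 ∂P := by
  have hmul : Integrable (fun ω => 2 * (f ω * g ω)) P := (hf.integrable_mul hg).const_mul 2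
  have hcross : ∫ ω, f ω * g ω ∂P = 0 := by
    rw [hfg.integral_fun_mul_eq_mul_integral hf.1 hg.1, hmean, zero_mul]
  simp only [add_sq, mul_assoc]
  rw [integral_add (f := fun ω => f ω ^ 2 + 2 * (f ω * g ω)) (hf.integrable_sq.add hmul)
    hg.integrable_sq, integral_add hf.integrable_sq hmul, integral_const_mul, hcross, mul_zero,
    add_zero]

variable [IsProbabilityMeasure P]

theorem risk_eq (hF : IsFactorModel P Z E ε) (hZ : MemLp Z 2 P) (hE : MemLp E 2 P)
    (hε : MemLp ε 2 P) (A : Matrix (Fin p) (Fin K) ℝ) (β : EuclideanSpace ℝ (Fin K))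
    (α : EuclideanSpace ℝ (Fin p)) :
    risk P (feature A Z E) (response β Z ε) α =
      ‖toEuclideanLin (psdSqrt (covMatrix Z P)) (toEuclideanLin A.transpose α - β)‖ ^ 2 +
        (‖toEuclideanLin (psdSqrt (covMatrix E P)) α‖ ^ 2 + Var[ε; P]) := by
  simp only [risk, inner_feature_sub_response]
  generalize toEuclideanLin A.transpose α - β = w
  have hwZ : MemLp (fun ω => inner ℝ w (Z ω)) 2 P := hZ.const_inner w
  have hαE : MemLp (fun ω => inner ℝ α (E ω)) 2 P := hE.const_inner α
  have hε' : MemLp (fun ω => -ε ω) 2 P := hε.neg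
  have hαEε : MemLp (fun ω => inner ℝ α (E ω) + -ε ω) 2 P := hαE.add hε'
  have hindZ : IndepFun (fun ω => inner ℝ w (Z ω)) (fun ω => inner ℝ α (E ω) + -ε ω) P :=
    hF.indep_Z.comp (φ := fun z => inner ℝ w z)
      (ψ := fun q : EuclideanSpace ℝ (Fin p) × ℝ => inner ℝ α q.1 + -q.2)
      (by fun_prop) (by fun_prop)
  have hindE : IndepFun (fun ω => inner ℝ α (E ω)) (fun ω => -ε ω) P :=
    hF.indep_E_ε.comp (φ := fun e => inner ℝ α e) (ψ := fun t => -t) (by fun_prop) (by fun_prop)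
  simp only [sub_eq_add_neg]
  rw [integral_add_sq_of_indepFun hwZ hαEε hindZ
      (integral_inner_eq_zero (hZ.integrable one_le_two) hF.mean_Z w),
    integral_add_sq_of_indepFun hαE hε' hindE
      (integral_inner_eq_zero (hE.integrable one_le_two) hF.mean_E α),
    integral_inner_sq_eq_norm_psdSqrt_sq hZ hF.mean_Z,
    integral_inner_sq_eq_norm_psdSqrt_sq hE hF.mean_E,
    variance_of_integral_eq_zero hF.measurable_ε.aemeasurable hF.mean_ε]
  simp only [neg_sq]

theorem variance_le_risk (hF : IsFactorModel P Z E ε) (hZ : MemLp Z 2 P) (hE : MemLp E 2 P)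
    (hε : MemLp ε 2 P) (A : Matrix (Fin p) (Fin K) ℝ) (β : EuclideanSpace ℝ (Fin K))
    (α : EuclideanSpace ℝ (Fin p)) :
    Var[ε; P] ≤ risk P (feature A Z E) (response β Z ε) α := by
  rw [risk_eq hF hZ hE hε, ← add_assoc, le_add_iff_nonneg_left]
  positivity

theorem exists_isMinOn_norm_sq_add {d d' : ℕ} (T : Matrix (Fin d) (Fin p) ℝ)
    (R : Matrix (Fin d') (Fin p) ℝ) (b : EuclideanSpace ℝ (Fin d)) :
    ∃ α, IsMinOn (fun α => ‖toEuclideanLin T α - b‖ ^ 2 + ‖toEuclideanLin R α‖ ^ 2)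
      Set.univ α := by
  let X : Matrix (Fin (d + d')) (Fin p) ℝ :=
    Matrix.of fun i j => Fin.append (fun k => T k j) (fun k => R k j) i
  let y : EuclideanSpace ℝ (Fin (d + d')) := WithLp.toLp 2 (Fin.append b.ofLp 0)
  have hX (u : EuclideanSpace ℝ (Fin p)) : ‖toEuclideanLin X u - y‖ ^ 2 =
      ‖toEuclideanLin T u - b‖ ^ 2 + ‖toEuclideanLin R u‖ ^ 2 := by
    simp only [EuclideanSpace.real_norm_sq_eq, Fin.sum_univ_add]
    simp [X, y, toEuclideanLin, Matrix.mulVec, dotProduct]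
  obtain ⟨α, hα, -⟩ := exists_isMinNormLeastSquares X y
  refine ⟨α, fun u _ => ?_⟩
  simp only [Set.mem_ofPred_eq, ← hX]
  gcongr
  exact hα u

theorem exists_isMinOn_risk (hF : IsFactorModel P Z E ε) (hZ : MemLp Z 2 P) (hE : MemLp E 2 P)
    (hε : MemLp ε 2 P) (A : Matrix (Fin p) (Fin K) ℝ) (β : EuclideanSpace ℝ (Fin K)) :
    ∃ α, IsMinOn (risk P (feature A Z E) (response β Z ε)) Set.univ α := by
  set B := psdSqrt (covMatrix Z P)
  obtain ⟨α, hα⟩ := exists_isMinOn_norm_sq_add (B * A.transpose) (psdSqrt (covMatrix E P))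
    (toEuclideanLin B β)
  refine ⟨α, fun u hu => ?_⟩
  have hαu := hα hu
  simp only [Set.mem_ofPred_eq, toEuclideanLin_mul_apply, ← map_sub] at hαu
  simp only [Set.mem_ofPred_eq, risk_eq hF hZ hE hε, ← add_assoc]
  gcongr ?_ + _

end Risk

section RightInverse

variable {n p : ℕ} {X : Matrix (Fin n) (Fin p) ℝ} {l : ℝ}

/-- The right inverse `Xᵀ (X Xᵀ)⁻¹` of a matrix `X` with linearly independent rows, for which it
is the Moore–Penrose inverse `X⁺`. -/
def rightInv (X : Matrix (Fin n) (Fin p) ℝ) : Matrix (Fin p) (Fin n) ℝ :=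
  X.transpose * (X * X.transpose)⁻¹

theorem toEuclideanLin_rightInv_apply (hX : IsUnit (X * X.transpose))
    (v : EuclideanSpace ℝ (Fin n)) : toEuclideanLin X (toEuclideanLin (rightInv X) v) = v := by
  have hdet := (Matrix.isUnit_iff_isUnit_det _).1 hX
  rw [← toEuclideanLin_mul_apply, rightInv, ← Matrix.mul_assoc, Matrix.mul_nonsing_inv _ hdet]
  simp

theorem exists_rightInv_apply_eq_transpose_apply (hX : IsUnit (X * X.transpose))
    (v : EuclideanSpace ℝ (Fin n)) : ∃ w, toEuclideanLin (rightInv X) v =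
      toEuclideanLin X.transpose w ∧ inner ℝ v w = ‖toEuclideanLin (rightInv X) v‖ ^ 2 := by
  set w := toEuclideanLin (X * X.transpose)⁻¹ v
  have hw : toEuclideanLin (rightInv X) v = toEuclideanLin X.transpose w :=
    toEuclideanLin_mul_apply _ _ _
  refine ⟨w, hw, ?_⟩
  have hself : inner ℝ (toEuclideanLin (rightInv X) v) (toEuclideanLin X.transpose w) =
      inner ℝ v w := by
    rw [inner_toEuclideanLin_transpose, toEuclideanLin_rightInv_apply hX]
  rw [← hself, ← hw, real_inner_self_eq_norm_sq]

theorem norm_sub_rightInv_apply_sq (hX : IsUnit (X * X.transpose))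
    (α : EuclideanSpace ℝ (Fin p)) :
    ‖α - toEuclideanLin (rightInv X) (toEuclideanLin X α)‖ ^ 2 =
      ‖α‖ ^ 2 - ‖toEuclideanLin (rightInv X) (toEuclideanLin X α)‖ ^ 2 := by
  obtain ⟨w, hw, hinner⟩ := exists_rightInv_apply_eq_transpose_apply hX (toEuclideanLin X α)
  rw [← inner_toEuclideanLin_transpose, ← hw] at hinner
  rw [norm_sub_sq_real, hinner]
  ring

theorem norm_rightInv_apply_le (hX : IsUnit (X * X.transpose)) (α : EuclideanSpace ℝ (Fin p)) :
    ‖toEuclideanLin (rightInv X) (toEuclideanLin X α)‖ ≤ ‖α‖ := by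
  rw [← sq_le_sq₀ (norm_nonneg _) (norm_nonneg _), ← sub_nonneg, ← norm_sub_rightInv_apply_sq hX]
  positivity

theorem minNormEstimator_eq_rightInv_apply (hX : IsUnit (X * X.transpose))
    (y : EuclideanSpace ℝ (Fin n)) : minNormEstimator X y = toEuclideanLin (rightInv X) y := by
  obtain ⟨hmin, hleast⟩ : IsMinNormLeastSquares X y (minNormEstimator X y) :=
    (exists_isMinNormLeastSquares X y).choose_spec
  set α := minNormEstimator X y
  have hinterp : toEuclideanLin X α = y := by
    simpa [toEuclideanLin_rightInv_apply hX, sub_eq_zero] using hmin (toEuclideanLin (rightInv X) y)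
  have hle : ‖α‖ ≤ ‖toEuclideanLin (rightInv X) y‖ :=
    hleast _ (by simp [toEuclideanLin_rightInv_apply hX])
  have hpyth := norm_sub_rightInv_apply_sq hX α
  rw [hinterp] at hpyth
  have hzero : ‖α - toEuclideanLin (rightInv X) y‖ ^ 2 ≤ 0 := by
    rw [hpyth, sub_nonpos]
    gcongr
  rwa [sq_nonpos_iff, norm_eq_zero, sub_eq_zero] at hzero

theorem isUnit_mul_transpose_of_le (hl : 0 < l)
    (h : ∀ v, l * ‖v‖ ^ 2 ≤ ‖toEuclideanLin X.transpose v‖ ^ 2) : IsUnit (X * X.transpose) := by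
  have hinj : Function.Injective X.transpose.mulVec := by
    rw [← Matrix.coe_mulVecLin, ← LinearMap.ker_eq_bot, LinearMap.ker_eq_bot']
    intro x hx
    have hzero : toEuclideanLin X.transpose (WithLp.toLp 2 x) = 0 := by
      ext i
      exact congrFun hx i
    have hle := h (WithLp.toLp 2 x)
    rw [hzero, norm_zero, zero_pow two_ne_zero, mul_nonpos_iff_pos_imp_nonpos] at hle
    simpa using hle.1 hl
  simpa using (Matrix.PosDef.conjTranspose_mul_self X.transpose hinj).isUnit

theorem norm_rightInv_apply_sq_le (hl : 0 < l)
    (h : ∀ v, l * ‖v‖ ^ 2 ≤ ‖toEuclideanLin X.transpose v‖ ^ 2) (v : EuclideanSpace ℝ (Fin n)) :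
    ‖toEuclideanLin (rightInv X) v‖ ^ 2 ≤ ‖v‖ ^ 2 / l := by
  obtain ⟨w, hw, hinner⟩ :=
    exists_rightInv_apply_eq_transpose_apply (isUnit_mul_transpose_of_le hl h) v
  have hwle := h w
  rw [← hw] at hwle
  have hsq := norm_sub_sq_real v (l • w)
  rw [real_inner_smul_right, hinner, norm_smul, Real.norm_of_nonneg hl.le, mul_pow] at hsq
  rw [le_div_iff₀' hl]
  nlinarith [sq_nonneg ‖v - l • w‖, mul_le_mul_of_nonneg_left hwle hl.le]

end RightInverse

section GoodSample

theorem norm_add_sq_le_two_mul {F : Type*} [SeminormedAddCommGroup F] (x y : F) :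
    ‖x + y‖ ^ 2 ≤ 2 * ‖x‖ ^ 2 + 2 * ‖y‖ ^ 2 := by
  calc ‖x + y‖ ^ 2 ≤ (‖x‖ + ‖y‖) ^ 2 := by gcongr; exact norm_add_le x y
    _ ≤ 2 * (‖x‖ ^ 2 + ‖y‖ ^ 2) := add_sq_le
    _ = 2 * ‖x‖ ^ 2 + 2 * ‖y‖ ^ 2 := mul_add _ _ _

variable {n p K d : ℕ}

/-- The event on which the prediction error is controlled deterministically. The rows of `Zm` and
`Em` are the factors and the feature noise of the sample, so that `Zm Aᵀ + Em` is its design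
matrix; `B` stands for `Σ_Z^{1/2}`. -/
structure IsGoodSample (A : Matrix (Fin p) (Fin K) ℝ) (B : Matrix (Fin d) (Fin K) ℝ)
    (Zm : Matrix (Fin n) (Fin K) ℝ) (Em : Matrix (Fin n) (Fin p) ℝ) (a u l : ℝ) : Prop where
  factor_lower : ∀ x, a * ‖toEuclideanLin B x‖ ^ 2 ≤ ‖toEuclideanLin Zm x‖ ^ 2
  noise_upper : ∀ α, ‖toEuclideanLin Em α‖ ^ 2 ≤ u * ‖α‖ ^ 2
  design_lower : ∀ v, l * ‖v‖ ^ 2 ≤ ‖toEuclideanLin (Zm * A.transpose + Em).transpose v‖ ^ 2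

namespace IsGoodSample

variable {A : Matrix (Fin p) (Fin K) ℝ} {B : Matrix (Fin d) (Fin K) ℝ}
  {Zm : Matrix (Fin n) (Fin K) ℝ} {Em : Matrix (Fin n) (Fin p) ℝ} {a u l : ℝ}

theorem norm_rightInv_factor_sq_le (h : IsGoodSample A B Zm Em a u l) (hl : 0 < l)
    (α₀ : EuclideanSpace ℝ (Fin p)) :
    ‖toEuclideanLin (rightInv (Zm * A.transpose + Em))
        (toEuclideanLin Zm (toEuclideanLin A.transpose α₀))‖ ^ 2 ≤
      2 * (1 + u / l) * ‖α₀‖ ^ 2 := by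
  set X := Zm * A.transpose + Em with hX
  have hsplit : toEuclideanLin Zm (toEuclideanLin A.transpose α₀) =
      toEuclideanLin X α₀ + toEuclideanLin Em (-α₀) := by
    simp [hX]
  have hXα : ‖toEuclideanLin (rightInv X) (toEuclideanLin X α₀)‖ ^ 2 ≤ ‖α₀‖ ^ 2 := by
    gcongr
    exact norm_rightInv_apply_le (isUnit_mul_transpose_of_le hl h.design_lower) α₀
  have hEα : ‖toEuclideanLin (rightInv X) (toEuclideanLin Em (-α₀))‖ ^ 2 ≤ u * ‖α₀‖ ^ 2 / l := by
    refine (norm_rightInv_apply_sq_le hl h.design_lower _).trans ?_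
    gcongr
    simpa using h.noise_upper (-α₀)
  rw [hsplit, map_add]
  refine (norm_add_sq_le_two_mul _ _).trans ?_
  rw [mul_assoc, ← mul_add, add_mul, one_mul, div_mul_eq_mul_div]
  gcongr

theorem norm_factor_error_sq_le (h : IsGoodSample A B Zm Em a u l) (ha : 0 < a)
    {α : EuclideanSpace ℝ (Fin p)} {β : EuclideanSpace ℝ (Fin K)}
    (hα : toEuclideanLin (Zm * A.transpose + Em) α = toEuclideanLin Zm β) :
    ‖toEuclideanLin B (toEuclideanLin A.transpose α - β)‖ ^ 2 ≤ u / a * ‖α‖ ^ 2 := by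
  have hnoise : toEuclideanLin Zm (toEuclideanLin A.transpose α - β) = -toEuclideanLin Em α := by
    rw [map_sub, ← hα, map_add, LinearMap.add_apply, toEuclideanLin_mul_apply, sub_add_cancel_left]
  rw [div_mul_eq_mul_div, le_div_iff₀' ha]
  refine (h.factor_lower _).trans ?_
  rw [hnoise, norm_neg]
  exact h.noise_upper α

theorem norm_apply_rightInv_sq_le (h : IsGoodSample A B Zm Em a u l) (ha : 0 < a) (hu : 0 ≤ u)
    (hl : 0 < l) (v : EuclideanSpace ℝ (Fin n)) :
    ‖toEuclideanLin (B * A.transpose * rightInv (Zm * A.transpose + Em)) v‖ ^ 2 ≤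
      2 * (1 + u / l) / a * ‖v‖ ^ 2 := by
  set X := Zm * A.transpose + Em with hX
  set α := toEuclideanLin (rightInv X) v
  have hfactor : toEuclideanLin Zm (toEuclideanLin A.transpose α) = v + -toEuclideanLin Em α := by
    have hXα : toEuclideanLin X α = v :=
      toEuclideanLin_rightInv_apply (isUnit_mul_transpose_of_le hl h.design_lower) v
    rw [← hXα, hX, map_add, LinearMap.add_apply, toEuclideanLin_mul_apply, add_neg_cancel_right]
  have hEα : ‖toEuclideanLin Em α‖ ^ 2 ≤ u * (‖v‖ ^ 2 / l) := by
    refine (h.noise_upper α).trans ?_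
    gcongr
    exact norm_rightInv_apply_sq_le hl h.design_lower v
  rw [div_mul_eq_mul_div, le_div_iff₀' ha, toEuclideanLin_mul_apply, toEuclideanLin_mul_apply]
  calc a * ‖toEuclideanLin B (toEuclideanLin A.transpose α)‖ ^ 2
      ≤ ‖toEuclideanLin Zm (toEuclideanLin A.transpose α)‖ ^ 2 := h.factor_lower _
    _ ≤ 2 * ‖v‖ ^ 2 + 2 * ‖toEuclideanLin Em α‖ ^ 2 := by
        rw [hfactor, ← norm_neg (toEuclideanLin Em α)]
        exact norm_add_sq_le_two_mul _ _
    _ ≤ 2 * ‖v‖ ^ 2 + 2 * (u * (‖v‖ ^ 2 / l)) := by gcongr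
    _ = 2 * (1 + u / l) * ‖v‖ ^ 2 := by ring

theorem frobeniusSq_mul_rightInv_le (h : IsGoodSample A B Zm Em a u l) (ha : 0 < a) (hu : 0 ≤ u)
    (hl : 0 < l) :
    frobeniusSq (B * A.transpose * rightInv (Zm * A.transpose + Em)) ≤
      d * (2 * (1 + u / l) / a) := by
  refine (frobeniusSq_le_card_mul_norm_sq _).trans ?_
  rw [Fintype.card_fin]
  gcongr
  exact norm_sq_le_of_forall_apply_le (by positivity) (h.norm_apply_rightInv_sq_le ha hu hl)

theorem prediction_error_le (h : IsGoodSample A B Zm Em a u l) (ha : 0 < a) (hu : 0 ≤ u)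
    (hl : 0 < l) (α₀ : EuclideanSpace ℝ (Fin p)) {ε : EuclideanSpace ℝ (Fin n)} {t e : ℝ}
    (ht : 0 ≤ t) (he : 0 ≤ e)
    (hε : ‖toEuclideanLin (B * A.transpose * rightInv (Zm * A.transpose + Em)) ε‖ ^ 2 ≤
      t * frobeniusSq (B * A.transpose * rightInv (Zm * A.transpose + Em))) :
    let α := minNormEstimator (Zm * A.transpose + Em)
      (toEuclideanLin Zm (toEuclideanLin A.transpose α₀) + ε)
    ‖toEuclideanLin B (toEuclideanLin A.transpose α - toEuclideanLin A.transpose α₀)‖ ^ 2 +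
        e * ‖α‖ ^ 2 ≤
      4 * (1 + u / l) * (u / a + e) * ‖α₀‖ ^ 2 + 4 * t * d * (1 + u / l) / a +
        2 * e * (‖ε‖ ^ 2 / l) := by
  intro α
  set X := Zm * A.transpose + Em
  set β := toEuclideanLin A.transpose α₀
  set αs := toEuclideanLin (rightInv X) (toEuclideanLin Zm β) with hαs
  set αn := toEuclideanLin (rightInv X) ε with hαn
  have hunit := isUnit_mul_transpose_of_le hl h.design_lower
  have hα : α = αs + αn := by
    rw [hαs, hαn, ← map_add]
    exact minNormEstimator_eq_rightInv_apply hunit _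
  have hαs_le : ‖αs‖ ^ 2 ≤ 2 * (1 + u / l) * ‖α₀‖ ^ 2 := h.norm_rightInv_factor_sq_le hl α₀
  have hαn_le : ‖αn‖ ^ 2 ≤ ‖ε‖ ^ 2 / l := norm_rightInv_apply_sq_le hl h.design_lower ε
  have hsignal : ‖toEuclideanLin B (toEuclideanLin A.transpose αs - β)‖ ^ 2 ≤ u / a * ‖αs‖ ^ 2 :=
    h.norm_factor_error_sq_le ha (toEuclideanLin_rightInv_apply hunit _)
  have hnoise : ‖toEuclideanLin B (toEuclideanLin A.transpose αn)‖ ^ 2 ≤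
      t * (d * (2 * (1 + u / l) / a)) := by
    rw [hαn, ← toEuclideanLin_mul_apply, ← toEuclideanLin_mul_apply]
    refine hε.trans ?_
    gcongr
    exact h.frobeniusSq_mul_rightInv_le ha hu hl
  have herror : ‖toEuclideanLin B (toEuclideanLin A.transpose α - β)‖ ^ 2 ≤
      2 * ‖toEuclideanLin B (toEuclideanLin A.transpose αs - β)‖ ^ 2 +
        2 * ‖toEuclideanLin B (toEuclideanLin A.transpose αn)‖ ^ 2 := by
    rw [hα, map_add, add_sub_right_comm, map_add]
    exact norm_add_sq_le_two_mul _ _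
  calc _ ≤ (2 * (u / a * ‖αs‖ ^ 2) + 2 * (t * (d * (2 * (1 + u / l) / a)))) +
        e * (2 * ‖αs‖ ^ 2 + 2 * (‖ε‖ ^ 2 / l)) := by
        gcongr
        · exact herror.trans (by gcongr)
        · rw [hα]
          exact (norm_add_sq_le_two_mul _ _).trans (by gcongr)
    _ = 2 * (u / a + e) * ‖αs‖ ^ 2 + 4 * t * d * (1 + u / l) / a + 2 * e * (‖ε‖ ^ 2 / l) := by
        ring
    _ ≤ 2 * (u / a + e) * (2 * (1 + u / l) * ‖α₀‖ ^ 2) + 4 * t * d * (1 + u / l) / a +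
        2 * e * (‖ε‖ ^ 2 / l) := by gcongr
    _ = _ := by ring

end IsGoodSample

end GoodSample

section RowMatrix

variable {n d : ℕ}

/-- The matrix with rows `x i`. -/
def rowMatrix (x : Fin n → EuclideanSpace ℝ (Fin d)) : Matrix (Fin n) (Fin d) ℝ :=
  Matrix.of fun i j => x i j

theorem rowMatrix_apply (x : Fin n → EuclideanSpace ℝ (Fin d)) (v : EuclideanSpace ℝ (Fin d))
    (i : Fin n) : toEuclideanLin (rowMatrix x) v i = inner ℝ v (x i) := by
  simp [toEuclideanLin, rowMatrix, Matrix.mulVec, dotProduct, PiLp.inner_apply]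

theorem norm_sq_rowMatrix_apply (x : Fin n → EuclideanSpace ℝ (Fin d))
    (v : EuclideanSpace ℝ (Fin d)) :
    ‖toEuclideanLin (rowMatrix x) v‖ ^ 2 = ∑ i, inner ℝ v (x i) ^ 2 := by
  simp only [EuclideanSpace.real_norm_sq_eq, rowMatrix_apply]

theorem rowMatrix_transpose_apply (x : Fin n → EuclideanSpace ℝ (Fin d))
    (v : EuclideanSpace ℝ (Fin n)) :
    toEuclideanLin (rowMatrix x).transpose v = ∑ i, v i • x i := by
  ext j
  simp [toEuclideanLin, rowMatrix, Matrix.mulVec, dotProduct, mul_comm]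

theorem glsEstimator_eq_minNormEstimator {Ω : Type*} {p K : ℕ} (A : Matrix (Fin p) (Fin K) ℝ)
    (β : EuclideanSpace ℝ (Fin K)) (Zs : Fin n → Ω → EuclideanSpace ℝ (Fin K))
    (Es : Fin n → Ω → EuclideanSpace ℝ (Fin p)) (εs : Fin n → Ω → ℝ) (ω : Ω) :
    glsEstimator A β Zs Es εs ω =
      minNormEstimator (rowMatrix (Zs · ω) * A.transpose + rowMatrix (Es · ω))
        (toEuclideanLin (rowMatrix (Zs · ω)) β + WithLp.toLp 2 (εs · ω)) := by
  unfold glsEstimator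
  congr 1
  · ext i j
    simp [dataMatrix, feature, rowMatrix, toEuclideanLin, Matrix.mulVec, dotProduct,
      Matrix.mul_apply, mul_comm]
  · ext i
    simp [response, rowMatrix_apply, real_inner_comm]

end RowMatrix

section Sample

variable {Ω Ω' : Type*} [MeasurableSpace Ω] [MeasurableSpace Ω'] {P : Measure Ω}
  {P' : Measure Ω'} {n p K : ℕ}
  {Z : Ω → EuclideanSpace ℝ (Fin K)} {E : Ω → EuclideanSpace ℝ (Fin p)} {ε : Ω → ℝ}
  {Zs : Fin n → Ω' → EuclideanSpace ℝ (Fin K)} {Es : Fin n → Ω' → EuclideanSpace ℝ (Fin p)}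
  {εs : Fin n → Ω' → ℝ}

theorem IsFactorModel.map_eq_prod [IsProbabilityMeasure P] (hF : IsFactorModel P Z E ε) :
    P.map (fun ω => ((Z ω, E ω), ε ω)) = (P.map fun ω => (Z ω, E ω)).prod (P.map ε) := by
  have hZ := hF.measurable_Z
  have hE := hF.measurable_E
  have hε := hF.measurable_ε
  have hZE : IndepFun Z E P :=
    hF.indep_Z.comp (φ := id) (ψ := Prod.fst) measurable_id measurable_fst
  have := Measure.isProbabilityMeasure_map (μ := P) hZ.aemeasurable
  have := Measure.isProbabilityMeasure_map (μ := P) hE.aemeasurable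
  have := Measure.isProbabilityMeasure_map (μ := P) hε.aemeasurable
  have hassoc : P.map (fun ω => (Z ω, (E ω, ε ω))) = (P.map Z).prod ((P.map E).prod (P.map ε)) := by
    rw [(indepFun_iff_map_prod_eq_prod_map_map hZ.aemeasurable
      (hE.prodMk hε).aemeasurable).1 hF.indep_Z,
      (indepFun_iff_map_prod_eq_prod_map_map hE.aemeasurable hε.aemeasurable).1 hF.indep_E_ε]
  rw [(indepFun_iff_map_prod_eq_prod_map_map hZ.aemeasurable hE.aemeasurable).1 hZE,
    ← MeasurableEquiv.prodAssoc.map_measurableEquiv_injective.eq_iff, Measure.prodAssoc_prod,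
    ← hassoc, Measure.map_map MeasurableEquiv.prodAssoc.measurable ((hZ.prodMk hE).prodMk hε)]
  rfl

theorem IsIIDSample.aemeasurable (hS : IsIIDSample P Z E ε P' Zs Es εs) (i : Fin n) :
    AEMeasurable (fun ω => ((Zs i ω, Es i ω), εs i ω)) P' := by
  have h := (hS.identDistrib i).aemeasurable_fst
  exact (h.fst.prodMk h.snd.fst).prodMk h.snd.snd

theorem IsIIDSample.aemeasurable_sample (hS : IsIIDSample P Z E ε P' Zs Es εs) :
    AEMeasurable (fun ω => (fun i => (Zs i ω, Es i ω), fun i => εs i ω)) P' :=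
  (aemeasurable_pi_lambda _ fun i => (hS.aemeasurable i).fst).prodMk
    (aemeasurable_pi_lambda _ fun i => (hS.aemeasurable i).snd)

theorem IsIIDSample.map_eq_prod [IsProbabilityMeasure P] [IsProbabilityMeasure P']
    (hF : IsFactorModel P Z E ε) (hS : IsIIDSample P Z E ε P' Zs Es εs) :
    P'.map (fun ω => (fun i => (Zs i ω, Es i ω), fun i => εs i ω)) =
      (Measure.pi fun _ : Fin n => P.map fun ω => (Z ω, E ω)).prod
        (Measure.pi fun _ : Fin n => P.map ε) := by
  have hZE : Measurable fun ω => (Z ω, E ω) := hF.measurable_Z.prodMk hF.measurable_E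
  have := Measure.isProbabilityMeasure_map (μ := P) hZE.aemeasurable
  have := Measure.isProbabilityMeasure_map (μ := P) hF.measurable_ε.aemeasurable
  have hind : iIndepFun (fun i ω => ((Zs i ω, Es i ω), εs i ω)) P' :=
    hS.indep.comp (fun _ q => ((q.1, q.2.1), q.2.2)) fun _ => by fun_prop
  have hpi : P'.map (fun ω i => ((Zs i ω, Es i ω), εs i ω)) =
      Measure.pi fun _ : Fin n => (P.map fun ω => (Z ω, E ω)).prod (P.map ε) := by
    rw [(iIndepFun_iff_map_fun_eq_pi_map hS.aemeasurable).1 hind]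
    congr 1
    funext i
    rw [← hF.map_eq_prod]
    exact ((hS.identDistrib i).comp
      (u := fun q : EuclideanSpace ℝ (Fin K) × EuclideanSpace ℝ (Fin p) × ℝ =>
        ((q.1, q.2.1), q.2.2)) (by fun_prop)).map_eq
  rw [← (measurePreserving_arrowProdEquivProdArrow _ _ (Fin n)
    (fun _ => P.map fun ω => (Z ω, E ω)) (fun _ => P.map ε)).map_eq, ← hpi,
    AEMeasurable.map_map_of_aemeasurable (MeasurableEquiv.measurable _).aemeasurable
      (aemeasurable_pi_lambda _ fun i => hS.aemeasurable i)]
  rfl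

end Sample

theorem measure_exists_mem_le {α ι : Type*} [MeasurableSpace α] {μ : Measure α} (N : Finset ι)
    {S : ι → Set α} {C q : ℝ} (hC : (N.card : ℝ) ≤ C) (hq : 0 ≤ q)
    (h : ∀ v ∈ N, μ (S v) ≤ ofReal q) : μ {x | ∃ v ∈ N, x ∈ S v} ≤ ofReal (C * q) := by
  have hunion : {x | ∃ v ∈ N, x ∈ S v} = ⋃ v ∈ N, S v := by
    ext
    simp
  calc μ {x | ∃ v ∈ N, x ∈ S v} ≤ ∑ v ∈ N, μ (S v) := hunion ▸ measure_biUnion_finset_le _ _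
    _ ≤ ∑ _v ∈ N, ofReal q := Finset.sum_le_sum h
    _ = ofReal (N.card * q) := by
      rw [Finset.sum_const, nsmul_eq_mul, ENNReal.ofReal_mul (by positivity),
        ENNReal.ofReal_natCast]
    _ ≤ _ := ENNReal.ofReal_le_ofReal (by gcongr)

section Concentration

variable {Ω : Type*} [MeasurableSpace Ω] {P : Measure Ω} {ι m : Type*} [Fintype ι]
  {V : Ω → EuclideanSpace ℝ ι}

theorem ae_eq_zero_of_hasSubgaussianMGF_inner_zero
    (hV : ∀ w, HasSubgaussianMGF (fun ω => inner ℝ w (V ω)) 0 P) : ∀ᵐ ω ∂P, V ω = 0 := by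
  classical
  have h : ∀ᵐ ω ∂P, ∀ i, inner ℝ (EuclideanSpace.single i 1) (V ω) = 0 :=
    ae_all_iff.2 fun i => (hV (EuclideanSpace.single i 1)).ae_eq_zero_of_hasSubgaussianMGF_zero
  filter_upwards [h] with ω hω
  ext i
  simpa [EuclideanSpace.inner_single_left] using hω i

variable [IsProbabilityMeasure P] [DecidableEq ι] [Fintype m] {s : ℝ≥0} {R : Matrix m ι ℝ}

theorem measure_lt_norm_sq_le_of_hasSubgaussianMGF (hV : AEMeasurable V P)
    (hsub : ∀ w, HasSubgaussianMGF (fun ω => inner ℝ w (V ω)) (s * ‖toEuclideanLin R w‖₊ ^ 2) P)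
    {O : ℝ} (hO : 0 < O) (hR : ‖R‖ ^ 2 ≤ O) (ρ : ℝ) :
    P {ω | (4 * ρ + 2) * s * frobeniusSq R < ‖V ω‖ ^ 2} ≤
      ofReal (exp (-(ρ * (frobeniusSq R / O)))) := by
  rcases eq_or_ne s 0 with rfl | hs
  · have h0 := ae_eq_zero_of_hasSubgaussianMGF_inner_zero (V := V) (P := P) (by simpa using hsub)
    refine (measure_mono_null (fun ω hω h => ?_) (ae_iff.1 h0)).trans_le zero_le
    simp [h] at hω
  · have : (0 : ℝ) < s := by positivity
    have hmgf := lintegral_exp_norm_sq_le_of_hasSubgaussianMGF hV hsub (l := 1 / (4 * s * O))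
      (by positivity) (by field_simp; linarith)
    refine (measure_mono fun ω hω => ?_).trans <| (measure_le_of_lintegral_exp_le
      (by fun_prop) hmgf (1 / (4 * s * O) * ((4 * ρ + 2) * s * frobeniusSq R))).trans_eq ?_
    · rw [Set.mem_ofPred_eq] at hω ⊢
      gcongr
    · congr 2
      field_simp
      ring

theorem norm_sq_le_frobeniusSq (R : Matrix m ι ℝ) : ‖R‖ ^ 2 ≤ frobeniusSq R := by
  refine norm_sq_le_of_forall_apply_le (frobeniusSq_nonneg R) fun x => ?_
  simp only [EuclideanSpace.real_norm_sq_eq (toEuclideanLin R x), frobeniusSq,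
    toEuclideanLin_apply_eq_inner_row]
  rw [Finset.sum_mul]
  gcongr with i
  calc inner ℝ x (WithLp.toLp 2 (R i)) ^ 2 ≤ (‖x‖ * ‖WithLp.toLp 2 (R i)‖) ^ 2 :=
        sq_le_sq' (neg_le_of_abs_le (abs_real_inner_le_norm _ _)) (real_inner_le_norm _ _)
    _ = (∑ j, R i j ^ 2) * ‖x‖ ^ 2 := by
        rw [mul_pow, mul_comm, EuclideanSpace.real_norm_sq_eq (WithLp.toLp 2 (R i))]

theorem measure_lt_norm_sq_le_exp_neg (hV : AEMeasurable V P)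
    (hsub : ∀ w, HasSubgaussianMGF (fun ω => inner ℝ w (V ω)) (s * ‖toEuclideanLin R w‖₊ ^ 2) P)
    (ρ : ℝ) :
    P {ω | (4 * ρ + 2) * s * frobeniusSq R < ‖V ω‖ ^ 2} ≤ ofReal (exp (-ρ)) := by
  rcases eq_or_ne R 0 with rfl | hR
  · have h0 := ae_eq_zero_of_hasSubgaussianMGF_inner_zero (V := V) (P := P) (by simpa using hsub)
    refine (measure_mono_null (fun ω hω h => ?_) (ae_iff.1 h0)).trans_le zero_le
    simp [h, frobeniusSq] at hω
  · have hF : 0 < frobeniusSq R := (norm_sq_le_frobeniusSq R).trans_lt' (by positivity)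
    simpa [hF.ne'] using
      measure_lt_norm_sq_le_of_hasSubgaussianMGF hV hsub hF (norm_sq_le_frobeniusSq R) ρ

end Concentration

section ProductMeasure

variable {T : Type*} [MeasurableSpace T] {κ : Measure T} [IsProbabilityMeasure κ] {n : ℕ}
  {X : T → ℝ} {s : ℝ≥0}

theorem hasSubgaussianMGF_inner_toLp_pi (hX : Measurable X) (hsub : HasSubgaussianMGF X s κ)
    (w : EuclideanSpace ℝ (Fin n)) :
    HasSubgaussianMGF (fun t => inner ℝ w (WithLp.toLp 2 fun i => X (t i))) (s * ‖w‖₊ ^ 2)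
      (Measure.pi fun _ : Fin n => κ) := by
  refine hasSubgaussianMGF_inner_of_iIndepFun
    (iIndepFun_pi (X := fun _ => X) fun _ => hX.aemeasurable) (fun i => ?_) w
  refine HasSubgaussianMGF.of_map (Ω := T) (X := X) (Y := fun t : Fin n → T => t i)
    (measurable_pi_apply i).aemeasurable ?_
  rwa [(measurePreserving_eval (fun _ : Fin n => κ) i).map_eq]

theorem measure_pi_lt_sum_sq_le (hX : Measurable X) (hsub : HasSubgaussianMGF X s κ) :
    Measure.pi (fun _ : Fin n => κ) {t | 6 * s * n < ∑ i, X (t i) ^ 2} ≤ ofReal (exp (-n)) := by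
  have happly (w : EuclideanSpace ℝ (Fin n)) : toEuclideanLin (1 : Matrix _ _ ℝ) w = w := by
    simp [toEuclideanLin]
  have hfrob : frobeniusSq (1 : Matrix (Fin n) (Fin n) ℝ) = n := by
    simp [frobeniusSq, Matrix.one_apply]
  have hV : Measurable fun t : Fin n → T => WithLp.toLp 2 fun i => X (t i) :=
    (WithLp.measurable_toLp 2 _).comp (by fun_prop)
  have h := measure_lt_norm_sq_le_of_hasSubgaussianMGF (R := (1 : Matrix (Fin n) (Fin n) ℝ))
    hV.aemeasurable (by simpa only [happly] using hasSubgaussianMGF_inner_toLp_pi hX hsub) one_pos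
    (norm_sq_le_of_forall_apply_le zero_le_one fun x => by rw [happly, one_mul]) 1
  simp only [hfrob, EuclideanSpace.real_norm_sq_eq, div_one, one_mul, mul_one] at h
  norm_num at h
  exact h

theorem measure_pi_sum_sq_le_le (hX : Measurable X) (hsub : HasSubgaussianMGF X s κ)
    (hX2 : ∫ t, X t ^ 2 ∂κ = 1) :
    Measure.pi (fun _ : Fin n => κ) {t | ∑ i, X (t i) ^ 2 ≤ n / 4} ≤
      ofReal (exp (-(n / (144 * s ^ 2)))) := by
  rcases eq_or_ne s 0 with rfl | hs
  · simpa using prob_le_one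
  have : (0 : ℝ) < s := by positivity
  set a : ℝ := 1 / (36 * s ^ 2) with ha
  have hmgf : ∫⁻ t, ofReal (exp (∑ i, -(a * X (t i) ^ 2))) ∂Measure.pi (fun _ : Fin n => κ) ≤
      ofReal (exp (∑ _i : Fin n, (-a + 18 * s ^ 2 * a ^ 2))) := by
    simp only [ofReal_exp_sum]
    rw [lintegral_prod_pi (fun _ => κ) (f := fun _ t => ofReal (exp (-(a * X t ^ 2))))
      (fun _ => by fun_prop)]
    exact Finset.prod_le_prod' fun i _ =>
      lintegral_exp_neg_mul_sq_le_of_hasSubgaussianMGF hsub hX2 (by positivity)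
  refine (measure_mono fun t ht => ?_).trans <|
    (measure_le_of_lintegral_exp_le (Measurable.aemeasurable (by fun_prop)) hmgf
      (-(a * (n / 4)))).trans_eq ?_
  · rw [Set.mem_ofPred_eq] at ht ⊢
    rw [Finset.sum_neg_distrib, ← Finset.mul_sum]
    gcongr
  · rw [Finset.sum_const, Finset.card_univ, Fintype.card_fin, nsmul_eq_mul, ha]
    congr 2
    field_simp
    ring

end ProductMeasure

section FactorMatrix

variable {T : Type*} [MeasurableSpace T] {κ : Measure T} [IsProbabilityMeasure κ] {n d : ℕ}
  {f : T → EuclideanSpace ℝ (Fin d)} {s γ : ℝ≥0} {B : Matrix (Fin d) (Fin d) ℝ}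

theorem div_sixteen_mul_norm_sq_le_of_isCover {N : Set (EuclideanSpace ℝ (Fin d))}
    (hN : IsCover γ (sphere 0 1) N) (hγ : (γ : ℝ) ≤ 1 / 2) (hγs : 512 * s * (γ : ℝ) ^ 2 ≤ 1)
    {F : Type*} [NormedAddCommGroup F] [NormedSpace ℝ F] (S : EuclideanSpace ℝ (Fin d) →L[ℝ] F)
    {c : ℝ} (hc : 0 ≤ c) (hS : ∀ v ∈ N, ‖S v‖ ^ 2 ≤ 6 * s * c)
    (hS' : ∀ v ∈ N, c / 4 ≤ ‖S v‖ ^ 2) (x : EuclideanSpace ℝ (Fin d)) :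
    c / 16 * ‖x‖ ^ 2 ≤ ‖S x‖ ^ 2 := by
  have hnorm := norm_sq_le_four_mul_of_isCover hN hγ S (by positivity) hS
  have h := div_four_mul_norm_sq_le_of_isCover hN S (l := c / 4) ?_ hS' x
  · linarith
  · have hsc : 512 * s * (γ : ℝ) ^ 2 * c ≤ 1 * c := by gcongr
    nlinarith [sq_nonneg (γ : ℝ)]

theorem measure_pi_sum_inner_sq_notMem_Ioc_le (hf : Measurable f)
    (hsub : ∀ w, HasSubgaussianMGF (fun t => inner ℝ w (f t)) (s * ‖toEuclideanLin B w‖₊ ^ 2) κ)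
    (hsq : ∀ w, ∫ t, inner ℝ w (f t) ^ 2 ∂κ = ‖toEuclideanLin B w‖ ^ 2)
    {w : EuclideanSpace ℝ (Fin d)} (hw : ‖toEuclideanLin B w‖ = 1) :
    Measure.pi (fun _ : Fin n => κ)
      {t | ‖toEuclideanLin (rowMatrix fun i => f (t i)) w‖ ^ 2 ∉
        Set.Ioc (n / 4 : ℝ) (6 * s * n)} ≤
      ofReal (exp (-(n / (144 * s ^ 2))) + exp (-n)) := by
  have hX : Measurable fun t => inner ℝ w (f t) := by fun_prop
  have hX_sub : HasSubgaussianMGF (fun t => inner ℝ w (f t)) s κ := by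
    simpa [(NNReal.eq hw : ‖toEuclideanLin B w‖₊ = 1)] using hsub w
  have hX2 : ∫ t, inner ℝ w (f t) ^ 2 ∂κ = 1 := by rw [hsq, hw, one_pow]
  rw [ENNReal.ofReal_add (Real.exp_pos _).le (Real.exp_pos _).le]
  refine (measure_mono fun t ht => ?_).trans <| (measure_union_le _ _).trans <|
    add_le_add (measure_pi_sum_sq_le_le hX hX_sub hX2) (measure_pi_lt_sum_sq_le hX hX_sub)
  simpa only [Set.mem_ofPred_eq, Set.mem_Ioc, not_and_or, not_lt, not_le, Set.mem_union,
    norm_sq_rowMatrix_apply] using ht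

theorem measure_not_factor_lower_le (hf : Measurable f)
    (hB : Function.Surjective (toEuclideanLin B))
    (hsub : ∀ w, HasSubgaussianMGF (fun t => inner ℝ w (f t)) (s * ‖toEuclideanLin B w‖₊ ^ 2) κ)
    (hsq : ∀ w, ∫ t, inner ℝ w (f t) ^ 2 ∂κ = ‖toEuclideanLin B w‖ ^ 2)
    (hγ0 : 0 < γ) (hγ : (γ : ℝ) ≤ 1 / 2) (hγs : 512 * s * (γ : ℝ) ^ 2 ≤ 1) :
    Measure.pi (fun _ : Fin n => κ) {t | ¬ ∀ w, (n : ℝ) / 16 * ‖toEuclideanLin B w‖ ^ 2 ≤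
      ‖toEuclideanLin (rowMatrix fun i => f (t i)) w‖ ^ 2} ≤
      ofReal ((1 + 2 / γ) ^ d * (exp (-(n / (144 * s ^ 2))) + exp (-n))) := by
  obtain ⟨N, hN1, hN, hcard⟩ := exists_finset_isCover_sphere (EuclideanSpace ℝ (Fin d)) hγ0
  rw [finrank_euclideanSpace_fin] at hcard
  let e := LinearEquiv.ofBijective (toEuclideanLin B) ⟨LinearMap.injective_iff_surjective.2 hB, hB⟩
  have hBe (v) : toEuclideanLin B (e.symm v) = v := e.apply_symm_apply v
  refine (measure_mono fun t ht => ?_).trans (measure_exists_mem_le N hcard (by positivity)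
    fun v hv => measure_pi_sum_inner_sq_notMem_Ioc_le hf hsub hsq (w := e.symm v)
      (by simpa [hBe] using hN1 hv))
  by_contra hcon
  simp only [Set.mem_ofPred_eq, not_exists, not_and, not_not] at hcon
  refine ht fun w => ?_
  have h := div_sixteen_mul_norm_sq_le_of_isCover hN hγ hγs
    ((toEuclideanLin (rowMatrix fun i => f (t i))).comp e.symm.toLinearMap).toContinuousLinearMap
    (c := n) (by positivity) (fun v hv => (hcon v hv).2) (fun v hv => (hcon v hv).1.le)
    (toEuclideanLin B w)
  have hew : e.symm (toEuclideanLin B w) = w := e.symm_apply_apply w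
  simpa [hew] using h

end FactorMatrix

section KerProj

variable {n p q : ℕ} {X : Matrix (Fin n) (Fin p) ℝ}

/-- The orthogonal projection `1 - X⁺ X` onto the kernel of a matrix `X` with linearly independent
rows. -/
def kerProj (X : Matrix (Fin n) (Fin p) ℝ) : Matrix (Fin p) (Fin p) ℝ :=
  1 - rightInv X * X

theorem kerProj_apply (X : Matrix (Fin n) (Fin p) ℝ) (α : EuclideanSpace ℝ (Fin p)) :
    toEuclideanLin (kerProj X) α = α - toEuclideanLin (rightInv X) (toEuclideanLin X α) := by
  rw [← toEuclideanLin_mul_apply, kerProj, map_sub, LinearMap.sub_apply]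
  simp [toEuclideanLin]

theorem norm_kerProj_apply_le (hX : IsUnit (X * X.transpose)) (α : EuclideanSpace ℝ (Fin p)) :
    ‖toEuclideanLin (kerProj X) α‖ ≤ ‖α‖ := by
  rw [← sq_le_sq₀ (norm_nonneg _) (norm_nonneg _), kerProj_apply, norm_sub_rightInv_apply_sq hX]
  linarith [sq_nonneg ‖toEuclideanLin (rightInv X) (toEuclideanLin X α)‖]

theorem kerProj_transpose_apply (hX : IsUnit (X * X.transpose)) (w : EuclideanSpace ℝ (Fin n)) :
    toEuclideanLin (kerProj X) (toEuclideanLin X.transpose w) = 0 := by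
  have hdet := (Matrix.isUnit_iff_isUnit_det _).1 hX
  have hmul : kerProj X * X.transpose = 0 := by
    rw [kerProj, rightInv, Matrix.sub_mul, Matrix.one_mul, Matrix.mul_assoc, Matrix.mul_assoc,
      Matrix.nonsing_inv_mul _ hdet, Matrix.mul_one, sub_self]
  rw [← toEuclideanLin_mul_apply, hmul, map_zero, LinearMap.zero_apply]

theorem frobeniusSq_rightInv_mul_self (hX : IsUnit (X * X.transpose)) :
    frobeniusSq (rightInv X * X) = n := by
  have hdet := (Matrix.isUnit_iff_isUnit_det _).1 hX
  have hinv : X * rightInv X = 1 := by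
    rw [rightInv, ← Matrix.mul_assoc, Matrix.mul_nonsing_inv _ hdet]
  have hsymm : (rightInv X * X).transpose = rightInv X * X := by
    simp [rightInv, Matrix.transpose_nonsing_inv, Matrix.mul_assoc]
  have hidem : rightInv X * X * (rightInv X * X) = rightInv X * X := by
    rw [Matrix.mul_assoc, ← Matrix.mul_assoc X, hinv, Matrix.one_mul]
  rw [← trace_transpose_mul_self, hsymm, hidem, Matrix.trace_mul_comm, hinv, Matrix.trace_one,
    Fintype.card_fin]

theorem frobeniusSq_le_frobeniusSq_kerProj_mul_add (hX : IsUnit (X * X.transpose))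
    (R : Matrix (Fin p) (Fin q) ℝ) :
    frobeniusSq R ≤ frobeniusSq (kerProj X * R) + n * ‖R‖ ^ 2 := by
  have hpyth : frobeniusSq R = frobeniusSq (kerProj X * R) + frobeniusSq (rightInv X * X * R) := by
    simp only [frobeniusSq_eq_sum_norm_sq _ (EuclideanSpace.basisFun (Fin q) ℝ),
      toEuclideanLin_mul_apply, kerProj_apply, norm_sub_rightInv_apply_sq hX,
      ← Finset.sum_add_distrib, sub_add_cancel]
  have hrange : frobeniusSq (rightInv X * X * R) ≤ ‖R‖ ^ 2 * n := by
    rw [← frobeniusSq_transpose, Matrix.transpose_mul, ← norm_transpose R,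
      ← frobeniusSq_rightInv_mul_self hX, ← frobeniusSq_transpose (rightInv X * X)]
    exact frobeniusSq_mul_le _ _
  linarith

end KerProj

section RowKronecker

variable {n m q : ℕ}

/-- The Kronecker product `vᵀ ⊗ R` of a row vector and a matrix: it maps the concatenation of
vectors `x₁, …, xₙ` to `R (∑ i, v i • xᵢ)`. -/
def rowKronecker (v : EuclideanSpace ℝ (Fin n)) (R : Matrix (Fin q) (Fin m) ℝ) :
    Matrix (Fin q) (Fin n × Fin m) ℝ :=
  Matrix.of fun k a => v a.1 * R k a.2

theorem toEuclideanLin_rowKronecker_apply (v : EuclideanSpace ℝ (Fin n))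
    (R : Matrix (Fin q) (Fin m) ℝ) (x : EuclideanSpace ℝ (Fin n × Fin m)) :
    toEuclideanLin (rowKronecker v R) x =
      toEuclideanLin R (WithLp.toLp 2 fun j => ∑ i, v i * x (i, j)) := by
  ext k
  simp only [toEuclideanLin, Matrix.toLpLin_apply, Matrix.mulVec, dotProduct, rowKronecker,
    Matrix.of_apply, Finset.mul_sum, Fintype.sum_prod_type_right]
  exact Finset.sum_congr rfl fun j _ => Finset.sum_congr rfl fun i _ => by ring

theorem mul_rowKronecker {q' : ℕ} (Q : Matrix (Fin q') (Fin q) ℝ) (v : EuclideanSpace ℝ (Fin n))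
    (R : Matrix (Fin q) (Fin m) ℝ) : Q * rowKronecker v R = rowKronecker v (Q * R) := by
  ext k a
  simp only [rowKronecker, Matrix.mul_apply, Matrix.of_apply, Finset.mul_sum]
  exact Finset.sum_congr rfl fun j _ => mul_left_comm _ _ _

theorem norm_rowKronecker_sq_le (v : EuclideanSpace ℝ (Fin n)) (R : Matrix (Fin q) (Fin m) ℝ) :
    ‖rowKronecker v R‖ ^ 2 ≤ ‖R‖ ^ 2 * ‖v‖ ^ 2 := by
  refine norm_sq_le_of_forall_apply_le (by positivity) fun x => ?_
  have hsum : ‖(WithLp.toLp 2 fun j => ∑ i, v i * x (i, j) : EuclideanSpace ℝ (Fin m))‖ ^ 2 ≤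
      ‖v‖ ^ 2 * ‖x‖ ^ 2 := by
    simp only [EuclideanSpace.real_norm_sq_eq, Fintype.sum_prod_type_right,
      Finset.mul_sum (s := .univ (α := Fin m))]
    exact Finset.sum_le_sum fun j _ => Finset.sum_mul_sq_le_sq_mul_sq _ _ _
  rw [toEuclideanLin_rowKronecker_apply, mul_assoc]
  calc _ ≤ (‖R‖ * ‖_‖) ^ 2 := by gcongr; exact norm_toEuclideanLin_le R _
    _ ≤ _ := by rw [mul_pow]; gcongr

theorem frobeniusSq_rowKronecker (v : EuclideanSpace ℝ (Fin n)) (R : Matrix (Fin q) (Fin m) ℝ) :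
    frobeniusSq (rowKronecker v R) = ‖v‖ ^ 2 * frobeniusSq R := by
  rw [← frobeniusSq_transpose, ← frobeniusSq_transpose R, EuclideanSpace.real_norm_sq_eq]
  simp only [frobeniusSq, Matrix.transpose_apply, rowKronecker, Matrix.of_apply, mul_pow,
    Fintype.sum_prod_type, ← Finset.sum_mul, ← Finset.mul_sum]

end RowKronecker

section NoiseMatrix

section Tails

variable {ι m : Type*} [Fintype ι] [DecidableEq ι] [Fintype m] {μ : ι → Measure ℝ}
  [∀ i, IsProbabilityMeasure (μ i)] {s : ℝ≥0} {R : Matrix m ι ℝ} {O : ℝ}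

theorem measure_pi_lt_norm_sq_apply_le (hμ : ∀ i, HasSubgaussianMGF id s (μ i)) (hO : 0 < O)
    (hR : ‖R‖ ^ 2 ≤ O) :
    Measure.pi μ {x | 4 * s * frobeniusSq R < ‖toEuclideanLin R (WithLp.toLp 2 x)‖ ^ 2} ≤
      ofReal (exp (-(frobeniusSq R / (2 * O)))) := by
  classical
  have hcoord (w : EuclideanSpace ℝ ι) : HasSubgaussianMGF
      (fun x : ι → ℝ => inner ℝ w (WithLp.toLp 2 x)) (s * ‖w‖₊ ^ 2) (Measure.pi μ) := by
    refine hasSubgaussianMGF_inner_of_iIndepFun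
      (iIndepFun_pi (X := fun _ => id) fun _ => aemeasurable_id) (fun i => ?_) w
    refine HasSubgaussianMGF.of_map (X := id) (measurable_pi_apply i).aemeasurable ?_
    rw [(measurePreserving_eval μ i).map_eq]
    exact hμ i
  have h := measure_lt_norm_sq_le_of_hasSubgaussianMGF (Measurable.aemeasurable (by fun_prop))
    (hasSubgaussianMGF_inner_of_ae_eq (.of_forall fun x => rfl) hcoord) hO
    ((norm_transpose R).symm ▸ hR) (1 / 2)
  rw [frobeniusSq_transpose] at h
  norm_num at h
  rwa [one_div, inv_mul_eq_div, div_div, mul_comm O] at h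

theorem measure_pi_norm_sq_apply_le_le (hμ : ∀ i, HasSubgaussianMGF id s (μ i))
    (hμ2 : ∀ i, ∫ x, x ^ 2 ∂μ i = 1) (hO : 0 < O) (hR : ‖R‖ ^ 2 ≤ O) :
    Measure.pi μ {x | ‖toEuclideanLin R (WithLp.toLp 2 x)‖ ^ 2 ≤ frobeniusSq R / 4} ≤
      ofReal (exp (-(frobeniusSq R / (32 * (11 * s ^ 2 + s) * O)))) := by
  rcases eq_or_ne s 0 with rfl | hs
  · simpa using prob_le_one
  have : (0 : ℝ) < s := by positivity
  set l : ℝ := 1 / (8 * (11 * s ^ 2 + s) * O) with hl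
  have hlO : l * (8 * (11 * s ^ 2 + s)) * O = 1 := by rw [hl]; field_simp
  have hmgf := lintegral_exp_neg_norm_sq_pi_le hμ hμ2 R (l := l) (by positivity) <| by
    calc 8 * l * s * ‖R‖ ^ 2 ≤ l * (8 * (11 * s ^ 2 + s)) * O := by
          rw [mul_comm 8 l, mul_assoc l]
          gcongr
          linarith [sq_nonneg (s : ℝ)]
      _ = 1 := hlO
  refine (measure_mono fun x hx => ?_).trans <| (measure_le_of_lintegral_exp_le
    (Measurable.aemeasurable (by fun_prop)) hmgf (-(l * (frobeniusSq R / 4)))).trans <|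
    ENNReal.ofReal_le_ofReal <| Real.exp_le_exp.2 ?_
  · rw [Set.mem_ofPred_eq] at hx ⊢
    gcongr
  · have hF := frobeniusSq_nonneg R
    have hquad : 44 * l ^ 2 * s ^ 2 * ‖R‖ ^ 2 * frobeniusSq R ≤ l * frobeniusSq R / 2 := by
      calc _ ≤ 44 * l ^ 2 * (s ^ 2 + s / 11) * O * frobeniusSq R := by gcongr; linarith
        _ = l * (8 * (11 * s ^ 2 + s)) * O * (l * frobeniusSq R / 2) := by ring
        _ = _ := by rw [hlO, one_mul]
    have hexp : frobeniusSq R / (32 * (11 * s ^ 2 + s) * O) = l * frobeniusSq R / 4 := by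
      rw [hl]; field_simp; ring
    linarith

theorem measure_pi_not_lt_and_le_le {Q : Matrix m m ℝ} [DecidableEq m]
    (hμ : ∀ i, HasSubgaussianMGF id s (μ i)) (hμ2 : ∀ i, ∫ x, x ^ 2 ∂μ i = 1) (hO : 0 < O)
    (hR : ‖R‖ ^ 2 ≤ O) (hQ : ∀ y, ‖toEuclideanLin Q y‖ ≤ ‖y‖)
    (hQR : frobeniusSq R ≤ 2 * frobeniusSq (Q * R)) :
    Measure.pi μ {x | ¬(frobeniusSq R / 8 <
          ‖toEuclideanLin Q (toEuclideanLin R (WithLp.toLp 2 x))‖ ^ 2 ∧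
        ‖toEuclideanLin R (WithLp.toLp 2 x)‖ ^ 2 ≤ 4 * s * frobeniusSq R)} ≤
      ofReal (exp (-(frobeniusSq R / (2 * O))) +
        exp (-(frobeniusSq R / (64 * (11 * s ^ 2 + s) * O)))) := by
  have hQR' : ‖Q * R‖ ^ 2 ≤ O := norm_sq_le_of_forall_apply_le hO.le fun x => by
    rw [toEuclideanLin_mul_apply]
    calc _ ≤ (‖R‖ * ‖x‖) ^ 2 := by
          gcongr
          exact (hQ _).trans (norm_toEuclideanLin_le R x)
      _ ≤ _ := by rw [mul_pow]; gcongr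
  rw [ENNReal.ofReal_add (Real.exp_pos _).le (Real.exp_pos _).le]
  refine (measure_mono fun x hx => ?_).trans ((measure_union_le _ _).trans
    (add_le_add (measure_pi_lt_norm_sq_apply_le hμ hO hR)
      ((measure_pi_norm_sq_apply_le_le hμ hμ2 hO hQR').trans ?_)))
  · by_contra h
    simp only [Set.mem_union, Set.mem_ofPred_eq, not_or, not_lt, not_le,
      toEuclideanLin_mul_apply] at h
    exact hx ⟨h.2.trans_le' (by linarith), h.1⟩
  · rw [show 64 * (11 * (s : ℝ) ^ 2 + s) * O = 2 * (32 * (11 * s ^ 2 + s) * O) by ring,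
      ← div_div _ 2]
    refine ENNReal.ofReal_le_ofReal (Real.exp_le_exp.2 (neg_le_neg ?_))
    exact div_le_div_of_nonneg_right (by linarith) (by positivity)

end Tails

theorem pi_pi_eq_map_curry {ι ι' : Type*} [Fintype ι] [Fintype ι'] (μ : ι' → Measure ℝ)
    [∀ j, IsProbabilityMeasure (μ j)] :
    (Measure.pi fun _ : ι => Measure.pi μ) =
      (Measure.pi fun a : ι × ι' => μ a.2).map (MeasurableEquiv.curry ι ι' ℝ) := by
  simp_rw [← Measure.infinitePi_eq_pi]
  exact (Measure.infinitePi_map_curry (fun (_ : ι) (j : ι') => μ j)).symm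

variable {T : Type*} [MeasurableSpace T] {κ : Measure T} [IsProbabilityMeasure κ] {n m q : ℕ}
  {g : T → EuclideanSpace ℝ (Fin q)} {μ : Fin m → Measure ℝ} [∀ j, IsProbabilityMeasure (μ j)]
  {R : Matrix (Fin q) (Fin m) ℝ}

theorem pi_map_eq_map_of_map_eq (hg : Measurable g)
    (hlaw : κ.map g = (Measure.pi μ).map fun x => toEuclideanLin R (WithLp.toLp 2 x)) :
    (Measure.pi fun _ : Fin n => κ).map (fun t i => g (t i)) =
      (Measure.pi fun a : Fin n × Fin m => μ a.2).map
        fun x i => toEuclideanLin R (WithLp.toLp 2 fun j => x (i, j)) := by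
  have hR : Measurable fun x : Fin m → ℝ => toEuclideanLin R (WithLp.toLp 2 x) := by fun_prop
  have := Measure.isProbabilityMeasure_map (μ := κ) hg.aemeasurable
  have := Measure.isProbabilityMeasure_map (μ := Measure.pi μ) hR.aemeasurable
  rw [Measure.pi_map_pi (μ := fun _ : Fin n => κ) fun _ => hg.aemeasurable, hlaw,
    ← Measure.pi_map_pi (μ := fun _ : Fin n => Measure.pi μ) fun _ => hR.aemeasurable,
    pi_pi_eq_map_curry, Measure.map_map (by fun_prop) (MeasurableEquiv.measurable _)]
  rfl

theorem map_rowMatrix_transpose_apply_eq (hg : Measurable g)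
    (hlaw : κ.map g = (Measure.pi μ).map fun x => toEuclideanLin R (WithLp.toLp 2 x))
    (v : EuclideanSpace ℝ (Fin n)) :
    (Measure.pi fun _ : Fin n => κ).map
        (fun t => toEuclideanLin (rowMatrix fun i => g (t i)).transpose v) =
      (Measure.pi fun a : Fin n × Fin m => μ a.2).map
        fun x => toEuclideanLin (rowKronecker v R) (WithLp.toLp 2 x) := by
  have hrow (x : Fin n × Fin m → ℝ) : toEuclideanLin (rowKronecker v R) (WithLp.toLp 2 x) =
      ∑ i, v i • toEuclideanLin R (WithLp.toLp 2 fun j => x (i, j)) := by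
    rw [toEuclideanLin_rowKronecker_apply, ← Finset.sum_congr rfl fun i _ => map_smul _ _ _,
      ← map_sum]
    congr 1
    ext j
    simp
  have hsum : Measurable fun y : Fin n → EuclideanSpace ℝ (Fin q) => ∑ i, v i • y i := by fun_prop
  have h := congrArg (Measure.map fun y => ∑ i, v i • y i)
    (pi_map_eq_map_of_map_eq (n := n) hg hlaw)
  rw [Measure.map_map hsum (by fun_prop), Measure.map_map hsum (by fun_prop)] at h
  simpa only [rowMatrix_transpose_apply, hrow, Function.comp_def] using h

variable {Q : Matrix (Fin q) (Fin q) ℝ} {s γ : ℝ≥0} {O : ℝ}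

theorem measure_rowMatrix_transpose_not_lt_and_le_le (hg : Measurable g)
    (hμ : ∀ j, HasSubgaussianMGF id s (μ j)) (hμ2 : ∀ j, ∫ x, x ^ 2 ∂μ j = 1)
    (hlaw : κ.map g = (Measure.pi μ).map fun x => toEuclideanLin R (WithLp.toLp 2 x))
    (hO : 0 < O) (hR : ‖R‖ ^ 2 ≤ O) (hQ : ∀ y, ‖toEuclideanLin Q y‖ ≤ ‖y‖)
    (hQR : frobeniusSq R ≤ 2 * frobeniusSq (Q * R)) {v : EuclideanSpace ℝ (Fin n)}
    (hv : ‖v‖ = 1) :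
    Measure.pi (fun _ : Fin n => κ) {t | ¬(frobeniusSq R / 8 <
          ‖toEuclideanLin Q (toEuclideanLin (rowMatrix fun i => g (t i)).transpose v)‖ ^ 2 ∧
        ‖toEuclideanLin (rowMatrix fun i => g (t i)).transpose v‖ ^ 2 ≤
          4 * s * frobeniusSq R)} ≤
      ofReal (exp (-(frobeniusSq R / (2 * O))) +
        exp (-(frobeniusSq R / (64 * (11 * s ^ 2 + s) * O)))) := by
  have hlower : MeasurableSet {y | frobeniusSq R / 8 < ‖toEuclideanLin Q y‖ ^ 2} :=
    measurableSet_lt (by fun_prop) (by fun_prop)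
  have hupper : MeasurableSet {y : EuclideanSpace ℝ (Fin q) | ‖y‖ ^ 2 ≤ 4 * s * frobeniusSq R} :=
    measurableSet_le (by fun_prop) (by fun_prop)
  have hS : MeasurableSet {y | ¬(frobeniusSq R / 8 < ‖toEuclideanLin Q y‖ ^ 2 ∧
      ‖y‖ ^ 2 ≤ 4 * s * frobeniusSq R)} := (hlower.inter hupper).compl
  have hU : Measurable fun t : Fin n → T =>
      toEuclideanLin (rowMatrix fun i => g (t i)).transpose v := by
    simp_rw [rowMatrix_transpose_apply]
    fun_prop
  have hfrob (R' : Matrix (Fin q) (Fin m) ℝ) :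
      frobeniusSq (rowKronecker v R') = frobeniusSq R' := by
    simp [frobeniusSq_rowKronecker, hv]
  have hnorm : ‖rowKronecker v R‖ ^ 2 ≤ ‖R‖ ^ 2 := by
    simpa [hv] using norm_rowKronecker_sq_le v R
  have h := measure_pi_not_lt_and_le_le (R := rowKronecker v R) (fun a : Fin n × Fin m => hμ a.2)
    (fun a => hμ2 a.2) hO (hnorm.trans hR) hQ (by rwa [mul_rowKronecker, hfrob, hfrob])
  rw [hfrob] at h
  calc _ = ((Measure.pi fun _ : Fin n => κ).map fun t =>
          toEuclideanLin (rowMatrix fun i => g (t i)).transpose v) _ :=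
        (Measure.map_apply hU hS).symm
    _ ≤ _ := by
        rw [map_rowMatrix_transpose_apply_eq hg hlaw, Measure.map_apply (by fun_prop) hS]
        exact h

theorem norm_sq_le_and_mul_norm_sq_le_of_isCover {U : Matrix (Fin q) (Fin n) ℝ} {F : ℝ}
    {N : Set (EuclideanSpace ℝ (Fin n))} (hN : IsCover γ (sphere 0 1) N)
    (hγ : (γ : ℝ) ≤ 1 / 2) (hγs : 512 * s * (γ : ℝ) ^ 2 ≤ 1) (hF : 0 ≤ F)
    (hQ : ∀ y, ‖toEuclideanLin Q y‖ ≤ ‖y‖)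
    (hU : ∀ v ∈ N, F / 8 < ‖toEuclideanLin Q (toEuclideanLin U v)‖ ^ 2 ∧
      ‖toEuclideanLin U v‖ ^ 2 ≤ 4 * s * F) :
    ‖U‖ ^ 2 ≤ 16 * s * F ∧
      ∀ v, F / 32 * ‖v‖ ^ 2 ≤ ‖toEuclideanLin Q (toEuclideanLin U v)‖ ^ 2 := by
  have hUF : ‖U‖ ^ 2 ≤ 4 * (4 * s * F) :=
    norm_sq_le_four_mul_of_isCover hN hγ (toEuclideanLin U).toContinuousLinearMap
      (by positivity) fun v hv => (hU v hv).2
  have hQU : ‖Q * U‖ ^ 2 ≤ 4 * (4 * s * F) :=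
    norm_sq_le_of_forall_apply_le (by positivity) fun x => by
      rw [toEuclideanLin_mul_apply]
      calc _ ≤ (‖U‖ * ‖x‖) ^ 2 := by
            gcongr
            exact (hQ _).trans (norm_toEuclideanLin_le U x)
        _ ≤ _ := by rw [mul_pow]; gcongr
  have hsmall : 4 * (γ : ℝ) ^ 2 * ‖Q * U‖ ^ 2 ≤ F / 8 := by
    calc _ ≤ 4 * (γ : ℝ) ^ 2 * (4 * (4 * s * F)) := by gcongr
      _ = 512 * s * (γ : ℝ) ^ 2 * (F / 8) := by ring
      _ ≤ F / 8 := mul_le_of_le_one_left (by positivity) hγs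
  have hlower (v) := div_four_mul_norm_sq_le_of_isCover hN
    (toEuclideanLin (Q * U)).toContinuousLinearMap hsmall
    (fun v hv => by simpa [toEuclideanLin_mul_apply] using (hU v hv).1.le) v
  refine ⟨hUF.trans_eq (by ring), fun v => ?_⟩
  calc _ = F / 8 / 4 * ‖v‖ ^ 2 := by ring
    _ ≤ _ := by simpa [toEuclideanLin_mul_apply] using hlower v

theorem measure_not_noise_bounds_le (hg : Measurable g)
    (hμ : ∀ j, HasSubgaussianMGF id s (μ j)) (hμ2 : ∀ j, ∫ x, x ^ 2 ∂μ j = 1)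
    (hlaw : κ.map g = (Measure.pi μ).map fun x => toEuclideanLin R (WithLp.toLp 2 x))
    (hO : 0 < O) (hR : ‖R‖ ^ 2 ≤ O) (hQ : ∀ y, ‖toEuclideanLin Q y‖ ≤ ‖y‖)
    (hQR : frobeniusSq R ≤ 2 * frobeniusSq (Q * R))
    (hγ0 : 0 < γ) (hγ : (γ : ℝ) ≤ 1 / 2) (hγs : 512 * s * (γ : ℝ) ^ 2 ≤ 1) :
    Measure.pi (fun _ : Fin n => κ) {t |
        ¬(‖rowMatrix fun i => g (t i)‖ ^ 2 ≤ 16 * s * frobeniusSq R ∧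
          ∀ v, frobeniusSq R / 32 * ‖v‖ ^ 2 ≤ ‖toEuclideanLin Q
            (toEuclideanLin (rowMatrix fun i => g (t i)).transpose v)‖ ^ 2)} ≤
      ofReal ((1 + 2 / γ) ^ n * (exp (-(frobeniusSq R / (2 * O))) +
        exp (-(frobeniusSq R / (64 * (11 * s ^ 2 + s) * O))))) := by
  obtain ⟨N, hN1, hN, hcard⟩ := exists_finset_isCover_sphere (EuclideanSpace ℝ (Fin n)) hγ0
  rw [finrank_euclideanSpace_fin] at hcard
  refine (measure_mono fun t ht => ?_).trans (measure_exists_mem_le N hcard (by positivity)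
    fun v hv => measure_rowMatrix_transpose_not_lt_and_le_le hg hμ hμ2 hlaw hO hR hQ hQR
      (by simpa using hN1 hv))
  by_contra hcon
  refine ht ?_
  rw [← norm_transpose]
  exact norm_sq_le_and_mul_norm_sq_le_of_isCover hN hγ hγs (frobeniusSq_nonneg R) hQ
    fun v hv => not_not.1 fun hvt => hcon ⟨v, hv, hvt⟩

end NoiseMatrix

theorem IsSubGaussianModel.exists_law_noise {Ω : Type*} [MeasurableSpace Ω] {P : Measure Ω}
    [IsProbabilityMeasure P] {p K : ℕ} {Z : Ω → EuclideanSpace ℝ (Fin K)}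
    {E : Ω → EuclideanSpace ℝ (Fin p)} {ε : Ω → ℝ} {M : ℝ≥0} (h : IsSubGaussianModel M P Z E ε)
    (hM : 0 < M) :
    ∃ μ : Fin p → Measure ℝ, (∀ j, IsProbabilityMeasure (μ j)) ∧
      (∀ j, HasSubgaussianMGF id (8 * M ^ 2) (μ j)) ∧ (∀ j, ∫ x, x ^ 2 ∂μ j = 1) ∧
      P.map E = (Measure.pi μ).map
        fun x => toEuclideanLin (psdSqrt (covMatrix E P)) (WithLp.toLp 2 x) := by
  obtain ⟨E', hE', hE, hind, hcoord⟩ := h.exists_standardized_noise hM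
  have hj (j : Fin p) : AEMeasurable (fun ω => E' ω j) P := Measurable.aemeasurable (by fun_prop)
  refine ⟨fun j => P.map fun ω => E' ω j, fun j => Measure.isProbabilityMeasure_map (hj j),
    fun j => HasSubgaussianMGF.id_map_iff (hj j) |>.2 (hcoord j).1, fun j => ?_, ?_⟩
  · rw [integral_map (hj j) (by fun_prop)]
    exact (hcoord j).2
  · rw [← (iIndepFun_iff_map_fun_eq_pi_map hj).1 hind, Measure.map_map (by fun_prop) (by fun_prop)]
    exact Measure.map_congr hE

section MeasurableInverse

variable {T : Type*} [MeasurableSpace T] {n p q : ℕ}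

theorem measurable_mul_apply {X : T → Matrix (Fin n) (Fin p) ℝ} {Y : T → Matrix (Fin p) (Fin q) ℝ}
    (hX : ∀ i j, Measurable fun x => X x i j) (hY : ∀ i j, Measurable fun x => Y x i j)
    (i : Fin n) (j : Fin q) : Measurable fun x => (X x * Y x) i j := by
  simp only [Matrix.mul_apply]
  fun_prop

theorem measurable_det {X : T → Matrix (Fin n) (Fin n) ℝ}
    (hX : ∀ i j, Measurable fun x => X x i j) : Measurable fun x => (X x).det := by
  simp_rw [Matrix.det_apply]
  fun_prop

theorem measurable_inv_apply {X : T → Matrix (Fin n) (Fin n) ℝ}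
    (hX : ∀ i j, Measurable fun x => X x i j) (i j : Fin n) :
    Measurable fun x => (X x)⁻¹ i j := by
  simp only [Matrix.inv_def, Ring.inverse_eq_inv', Matrix.smul_apply, smul_eq_mul,
    Matrix.adjugate_apply]
  refine (measurable_det hX).inv.mul (measurable_det fun i' j' => ?_)
  rcases eq_or_ne i' j with rfl | h
  · simp
  · simpa only [Matrix.updateRow_ne h] using hX i' j'

theorem measurable_rightInv_apply {X : T → Matrix (Fin n) (Fin p) ℝ}
    (hX : ∀ i j, Measurable fun x => X x i j) (i : Fin p) (j : Fin n) :
    Measurable fun x => rightInv (X x) i j :=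
  measurable_mul_apply (fun i j => hX j i)
    (measurable_inv_apply (measurable_mul_apply hX fun i j => hX j i)) i j

end MeasurableInverse

section ResponseNoise

variable {T : Type*} [MeasurableSpace T] {n m : ℕ} {ν : Measure ℝ} [IsProbabilityMeasure ν]
  {s : ℝ≥0}

theorem measure_pi_lt_norm_sq_apply_toLp_le (hν : HasSubgaussianMGF id s ν)
    (W : Matrix (Fin m) (Fin n) ℝ) (ρ : ℝ) :
    Measure.pi (fun _ : Fin n => ν)
        {e | (4 * ρ + 2) * s * frobeniusSq W < ‖toEuclideanLin W (WithLp.toLp 2 e)‖ ^ 2} ≤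
      ofReal (exp (-ρ)) := by
  have h := measure_lt_norm_sq_le_exp_neg (Measurable.aemeasurable (by fun_prop))
    (hasSubgaussianMGF_inner_of_ae_eq (B := W) (.of_forall fun x => rfl)
      (hasSubgaussianMGF_inner_toLp_pi measurable_id hν)) ρ
  rwa [frobeniusSq_transpose] at h

theorem measure_prod_pi_lt_norm_sq_apply_toLp_le {μ : Measure T} [IsProbabilityMeasure μ]
    (hν : HasSubgaussianMGF id s ν) {W : T → Matrix (Fin m) (Fin n) ℝ}
    (hW : ∀ k i, Measurable fun x => W x k i) (ρ : ℝ) :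
    μ.prod (Measure.pi fun _ : Fin n => ν)
        {q | (4 * ρ + 2) * s * frobeniusSq (W q.1) <
          ‖toEuclideanLin (W q.1) (WithLp.toLp 2 q.2)‖ ^ 2} ≤
      ofReal (exp (-ρ)) := by
  have hmeas : MeasurableSet {q : T × (Fin n → ℝ) | (4 * ρ + 2) * s * frobeniusSq (W q.1) <
      ‖toEuclideanLin (W q.1) (WithLp.toLp 2 q.2)‖ ^ 2} := by
    have : ∀ k i, Measurable fun q : T × (Fin n → ℝ) => W q.1 k i := fun k i =>
      (hW k i).comp measurable_fst
    simp only [EuclideanSpace.real_norm_sq_eq, frobeniusSq, Matrix.toLpLin_apply, toEuclideanLin,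
      Matrix.mulVec, dotProduct]
    exact measurableSet_lt (by fun_prop) (by fun_prop)
  rw [Measure.prod_apply hmeas]
  calc _ ≤ ∫⁻ _x : T, ofReal (exp (-ρ)) ∂μ :=
        lintegral_mono fun x => measure_pi_lt_norm_sq_apply_toLp_le hν (W x) ρ
    _ = _ := by simp

theorem measure_prod_preimage_fst_le {S : Type*} [MeasurableSpace S] {μ : Measure S}
    {ν : Measure T} [IsProbabilityMeasure ν] (B : Set S) :
    μ.prod ν {q | q.1 ∈ B} ≤ μ B := by
  have h : {q : S × T | q.1 ∈ B} = B ×ˢ Set.univ := by ext; simp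
  rw [h, Measure.prod_prod, measure_univ, mul_one]

theorem measure_prod_preimage_snd_le {S : Type*} [MeasurableSpace S] {μ : Measure S}
    {ν : Measure T} [SFinite ν] [IsProbabilityMeasure μ] (B : Set T) :
    μ.prod ν {q | q.2 ∈ B} ≤ ν B := by
  have h : {q : S × T | q.2 ∈ B} = Set.univ ×ˢ B := by ext; simp
  rw [h, Measure.prod_prod, measure_univ, one_mul]

theorem measure_prod_pi_not_good_le {μ : Measure T} [IsProbabilityMeasure μ]
    (hν : HasSubgaussianMGF id s ν) {W : T → Matrix (Fin m) (Fin n) ℝ}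
    (hW : ∀ k i, Measurable fun x => W x k i) (ρ : ℝ) (B : Set T) :
    μ.prod (Measure.pi fun _ : Fin n => ν)
        {q | ¬(q.1 ∉ B ∧ ‖toEuclideanLin (W q.1) (WithLp.toLp 2 q.2)‖ ^ 2 ≤
            (4 * ρ + 2) * s * frobeniusSq (W q.1) ∧
          ‖WithLp.toLp 2 q.2‖ ^ 2 ≤ (4 * ρ + 2) * s * n)} ≤
      μ B + (ofReal (exp (-ρ)) + ofReal (exp (-ρ))) := by
  have hfrob : frobeniusSq (1 : Matrix (Fin n) (Fin n) ℝ) = n := by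
    simp [frobeniusSq, Matrix.one_apply]
  have hone := measure_pi_lt_norm_sq_apply_toLp_le hν (1 : Matrix (Fin n) (Fin n) ℝ) ρ
  simp only [hfrob, toEuclideanLin, Matrix.toLpLin_one, LinearMap.id_apply] at hone
  refine (measure_mono fun q hq => ?_).trans ((measure_union_le _ _).trans (add_le_add
    (measure_prod_preimage_fst_le B) ((measure_union_le _ _).trans (add_le_add
      (measure_prod_pi_lt_norm_sq_apply_toLp_le hν hW ρ)
      ((measure_prod_preimage_snd_le _).trans hone)))))
  by_contra hcon
  simp only [Set.mem_union, not_or, Set.mem_ofPred_eq, not_lt] at hcon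
  exact hq hcon

end ResponseNoise

section GoodSampleProbability

variable {n p d K : ℕ} {A : Matrix (Fin p) (Fin K) ℝ} {B : Matrix (Fin d) (Fin K) ℝ}
  {Zm : Matrix (Fin n) (Fin K) ℝ} {Em : Matrix (Fin n) (Fin p) ℝ}

theorem isGoodSample_of_kerProj {a u l : ℝ} (hA : IsUnit (A.transpose * A))
    (hZm : ∀ x, a * ‖toEuclideanLin B x‖ ^ 2 ≤ ‖toEuclideanLin Zm x‖ ^ 2) (hEm : ‖Em‖ ^ 2 ≤ u)
    (hker : ∀ v, l * ‖v‖ ^ 2 ≤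
      ‖toEuclideanLin (kerProj A.transpose) (toEuclideanLin Em.transpose v)‖ ^ 2) :
    IsGoodSample A B Zm Em a u l where
  factor_lower := hZm
  noise_upper α := by
    calc _ ≤ (‖Em‖ * ‖α‖) ^ 2 := by gcongr; exact norm_toEuclideanLin_le Em α
      _ ≤ _ := by rw [mul_pow]; gcongr
  design_lower v := by
    replace hA : IsUnit (A.transpose * A.transpose.transpose) := by rwa [Matrix.transpose_transpose]
    refine (hker v).trans ?_
    have hker' : toEuclideanLin (kerProj A.transpose) (toEuclideanLin Em.transpose v) =
        toEuclideanLin (kerProj A.transpose)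
          (toEuclideanLin (Zm * A.transpose + Em).transpose v) := by
      rw [Matrix.transpose_add, Matrix.transpose_mul, map_add, LinearMap.add_apply, map_add,
        toEuclideanLin_mul_apply, kerProj_transpose_apply hA, zero_add]
    rw [hker']
    gcongr
    exact norm_kerProj_apply_le hA _

theorem IsGoodSample.excess_le {s τ t O : ℝ}
    (h : IsGoodSample A B Zm Em (n / 16) (16 * s * τ) (τ / 32)) (hn : 0 < n) (hs : 0 ≤ s)
    (hτ : 0 < τ) (α₀ : EuclideanSpace ℝ (Fin p)) {ε : EuclideanSpace ℝ (Fin n)} (ht : 0 ≤ t)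
    (hO : 0 ≤ O) (hε : ‖ε‖ ^ 2 ≤ t * n)
    (hWε : ‖toEuclideanLin (B * A.transpose * rightInv (Zm * A.transpose + Em)) ε‖ ^ 2 ≤
      t * frobeniusSq (B * A.transpose * rightInv (Zm * A.transpose + Em))) :
    let α := minNormEstimator (Zm * A.transpose + Em)
      (toEuclideanLin Zm (toEuclideanLin A.transpose α₀) + ε)
    ‖toEuclideanLin B (toEuclideanLin A.transpose α - toEuclideanLin A.transpose α₀)‖ ^ 2 +
        O * ‖α‖ ^ 2 ≤
      4 * (1 + 512 * s) * (256 * s * (τ / n) + O) * ‖α₀‖ ^ 2 + 64 * (1 + 512 * s) * t * (d / n) +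
        64 * O * t * (n / τ) := by
  refine (h.prediction_error_le (by positivity) (by positivity) (by positivity) α₀ ht hO
    hWε).trans ?_
  have hul : 16 * s * τ / (τ / 32) = 512 * s := by field_simp; ring
  have hua : 16 * s * τ / (n / 16) = 256 * s * (τ / n) := by field_simp; ring
  have hestim : 4 * t * d * (1 + 512 * s) / (n / 16) = 64 * (1 + 512 * s) * t * (d / n) := by
    field_simp; ring
  have hnoise : 2 * O * (‖ε‖ ^ 2 / (τ / 32)) ≤ 64 * O * t * (n / τ) := by
    calc _ ≤ 2 * O * (t * n / (τ / 32)) := by gcongr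
      _ = _ := by field_simp; ring
  rw [hul, hua, hestim]
  gcongr

end GoodSampleProbability

section EffectiveRank

variable {d : ℕ} {Q : Matrix (Fin d) (Fin d) ℝ}

theorem norm_pos_of_one_lt_effRank (h : 1 < effRank Q) : 0 < ‖Q‖ := by
  rw [norm_pos_iff]
  rintro rfl
  simp [effRank] at h

theorem effRank_mul_norm (Q : Matrix (Fin d) (Fin d) ℝ) : effRank Q * ‖Q‖ = Q.trace := by
  rcases eq_or_ne Q 0 with rfl | hQ
  · simp
  · rw [effRank, if_neg hQ, opNorm_eq_norm, div_mul_cancel₀ _ (norm_ne_zero_iff.2 hQ)]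

theorem effRank_le_of_posSemidef (hQ : Q.PosSemidef)
    (h : 1 < effRank Q) : effRank Q ≤ d := by
  have hle := frobeniusSq_le_card_mul_norm_sq (psdSqrt Q)
  rw [frobeniusSq_psdSqrt hQ, norm_psdSqrt_sq hQ, ← effRank_mul_norm, Fintype.card_fin] at hle
  exact le_of_mul_le_mul_right hle (norm_pos_of_one_lt_effRank h)

end EffectiveRank

/-- The probability bound for `n` observations with `K` factors not to form a good sample, by a
covering of the unit spheres of `ℝ^K` and `ℝ^n` with mesh `γ`. Here `s` is the common sub-Gaussian
variance proxy and `r` the effective rank of the noise covariance. -/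
def failureBound (s γ : ℝ≥0) (r : ℝ) (n K : ℕ) : ℝ :=
  (1 + 2 / γ) ^ K * (exp (-(n / (144 * s ^ 2))) + exp (-n)) +
    (1 + 2 / γ) ^ n * (exp (-(r / 2)) + exp (-(r / (64 * (11 * s ^ 2 + s)))))

/-- The bound for the excess risk on a good sample of `n` observations with `K` factors. Here `s` is
the common sub-Gaussian variance proxy, `r` and `O` are the effective rank and the norm of the noise
covariance, `t` is the level of the response noise, and `a` is the squared norm of a coefficient
vector through which the features reproduce the signal. -/
def excessBound (s r O t a : ℝ) (n K : ℕ) : ℝ :=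
  4 * (1 + 512 * s) * ((256 * s * (r / n) + 1) * O) * a + 64 * (1 + 512 * s) * t * (K / n) +
    64 * t * (n / r)

section Coefficient

variable {p K : ℕ} {A : Matrix (Fin p) (Fin K) ℝ}

theorem posDef_transpose_mul_self_of_rank_eq (hA : A.rank = K) : (A.transpose * A).PosDef := by
  have hcol : LinearIndependent ℝ A.col := by
    rw [linearIndependent_iff_card_eq_finrank_span, Set.finrank, ← A.rank_eq_finrank_span_cols, hA,
      Fintype.card_fin]
  rw [← Matrix.conjTranspose_eq_transpose_of_trivial]
  exact .conjTranspose_mul_self A (Matrix.mulVec_injective_iff.2 hcol)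

theorem norm_rightInv_transpose_apply_sq_le {Q : Matrix (Fin K) (Fin K) ℝ}
    {β : EuclideanSpace ℝ (Fin K)} {z c : ℝ} (hK : 1 ≤ K) (hA : A.rank = K) (hQ : Q.IsHermitian)
    (hz : 0 < z) (hzQ : z ≤ kthEigenvalue K Q) (hβ : quadForm Q β ≤ c) :
    ‖toEuclideanLin (rightInv A.transpose) β‖ ^ 2 ≤
      c / z / kthEigenvalue K (A.transpose * A) := by
  have hAA := posDef_transpose_mul_self_of_rank_eq hA
  have hlam := (kthEigenvalue_pos_iff_posDef hK hAA.1).2 hAA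
  refine (norm_rightInv_apply_sq_le hlam (fun v => ?_) β).trans ?_
  · refine (kthEigenvalue_mul_norm_sq_le_quadForm hAA.1 v).trans_eq ?_
    rw [quadForm, toEuclideanLin_mul_apply, inner_toEuclideanLin_transpose,
      real_inner_self_eq_norm_sq, Matrix.transpose_transpose]
  · gcongr
    rw [le_div_iff₀' hz]
    exact (mul_le_mul_of_nonneg_right hzQ (sq_nonneg _)).trans
      ((kthEigenvalue_mul_norm_sq_le_quadForm hQ β).trans hβ)

end Coefficient

theorem pow_mul_exp_neg_le {N x y : ℝ} (hN : 0 < N) (m : ℕ) (hy : 0 < y)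
    (h : m * Real.log N + y ≤ x) : N ^ m * exp (-x) ≤ 1 / y := by
  calc N ^ m * exp (-x) = exp (m * Real.log N - x) := by
        rw [sub_eq_add_neg, Real.exp_add, Real.exp_nat_mul, Real.exp_log hN]
    _ ≤ exp (-y) := Real.exp_le_exp.2 (by linarith)
    _ = 1 / exp y := by rw [Real.exp_neg, one_div]
    _ ≤ 1 / y := one_div_le_one_div_of_le hy (by linarith [Real.add_one_le_exp y])

theorem one_sub_le_measureReal_of_compl_subset {Ω : Type*} [MeasurableSpace Ω] {P : Measure Ω}
    [IsProbabilityMeasure P] {S S' : Set Ω} {q : ℝ} (hq : 0 ≤ q) (hS : P S ≤ ofReal q)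
    (hSS' : Sᶜ ⊆ S') : 1 - q ≤ P.real S' := by
  have hcover : S ∪ S' = Set.univ := Set.compl_subset_iff_union.1 hSS'
  have hunion := measureReal_union_le (μ := P) S S'
  rw [hcover, probReal_univ] at hunion
  have hreal : P.real S ≤ q := ENNReal.toReal_le_of_le_ofReal hq hS
  linarith

theorem failureBound_le {s γ : ℝ≥0} {r : ℝ} {n K : ℕ} (hs : 0 < s) (hγ : 0 < γ) (hn : 0 < n)
    (hK : (2 + 64 * (11 * s ^ 2 + s)) * (Real.log (1 + 2 / γ) + 1) * K ≤ n)
    (hr : (2 + 64 * (11 * s ^ 2 + s)) * (Real.log (1 + 2 / γ) + 1) * n ≤ r) :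
    failureBound s γ r n K ≤ (288 * s ^ 2 + 4) / n := by
  have hn0 : (0 : ℝ) < n := by exact_mod_cast hn
  have hs0 : (0 : ℝ) < s := by exact_mod_cast hs
  have hN : (1 : ℝ) ≤ 1 + 2 / γ := le_add_of_nonneg_right (by positivity)
  have hℓ := Real.log_nonneg hN
  set ℓ := Real.log (1 + 2 / γ)
  have hℓK : 0 ≤ ℓ * K := by positivity
  have hℓn : 0 ≤ (ℓ + 1) * n := by positivity
  have hfactor : (1 + 2 / (γ : ℝ)) ^ K * exp (-(n / (144 * s ^ 2))) ≤ 288 * s ^ 2 / n := by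
    refine (pow_mul_exp_neg_le (by positivity) K (y := n / (288 * s ^ 2)) (by positivity)
      ?_).trans_eq (one_div_div _ _)
    rw [← le_sub_iff_add_le, show (n : ℝ) / (144 * s ^ 2) - n / (288 * s ^ 2) = n / (288 * s ^ 2) by
      field_simp; norm_num, le_div_iff₀ (by positivity)]
    nlinarith [mul_nonneg (sq_nonneg (s : ℝ)) hℓK, mul_nonneg (sq_nonneg (s : ℝ)) K.cast_nonneg]
  have hnet : (1 + 2 / (γ : ℝ)) ^ K * exp (-n) ≤ 2 / n := by
    refine (pow_mul_exp_neg_le (by positivity) K (y := n / 2) (by positivity) ?_).trans_eq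
      (one_div_div _ _)
    nlinarith [mul_nonneg (sq_nonneg (s : ℝ)) hℓK, mul_nonneg (sq_nonneg (s : ℝ)) K.cast_nonneg]
  have hnorm : (1 + 2 / (γ : ℝ)) ^ n * exp (-(r / 2)) ≤ 1 / n := by
    refine pow_mul_exp_neg_le (by positivity) n hn0 ?_
    nlinarith [mul_nonneg (sq_nonneg (s : ℝ)) hℓn, mul_nonneg hs0.le hℓn]
  have hker : (1 + 2 / (γ : ℝ)) ^ n * exp (-(r / (64 * (11 * s ^ 2 + s)))) ≤ 1 / n := by
    refine pow_mul_exp_neg_le (by positivity) n hn0 ?_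
    rw [le_div_iff₀ (by positivity)]
    nlinarith
  calc failureBound s γ r n K ≤ 288 * s ^ 2 / n + 2 / n + (1 / n + 1 / n) := by
        rw [failureBound, mul_add, mul_add]
        gcongr
    _ = _ := by ring

/-- The constant in the excess risk bound, in terms of the common sub-Gaussian variance proxy `s`
and of the bounds `z₁`, `e₂`, `r₁`, `b` on the model. -/
def riskConstant (s z₁ e₂ r₁ b : ℝ) : ℝ :=
  4 * (1 + 512 * s) * ((256 * s + 1) * e₂) * (b / z₁) + 512 * s * (1 + 512 * s) + 512 * s / r₁

theorem excessBound_le {s r O t a l z₁ e₂ r₁ b v : ℝ} {n p K : ℕ} (hs : 0 ≤ s) (hn : 0 < n)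
    (hnp : n ≤ p) (hr₁ : 0 < r₁) (hr : r₁ * p ≤ r) (hrp : r ≤ p) (hO : 0 ≤ O) (hOe : O ≤ e₂)
    (hz : 0 < z₁) (hb : 0 ≤ b) (hl : 0 ≤ l) (ha : 0 ≤ a) (hal : a ≤ b * K / z₁ / l) (hv : 0 ≤ v)
    (ht : t ≤ 8 * s * v) :
    excessBound s r O t a n K ≤
      riskConstant s z₁ e₂ r₁ b * ((K : ℝ) / l * (p / n) + v * (n / p + K / n)) := by
  have hn0 : (0 : ℝ) < n := by exact_mod_cast hn
  have hnp' : (n : ℝ) ≤ p := by exact_mod_cast hnp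
  have hp0 : (0 : ℝ) < p := hn0.trans_le hnp'
  have he₂ : 0 ≤ e₂ := hO.trans hOe
  have hscale : 256 * s * (r / n) + 1 ≤ (256 * s + 1) * (p / n) := by
    have := (one_le_div₀ hn0).2 hnp'
    have : 256 * s * (r / n) ≤ 256 * s * (p / n) := by gcongr
    linarith
  have hbias : 4 * (1 + 512 * s) * ((256 * s * (r / n) + 1) * O) * a ≤
      4 * (1 + 512 * s) * ((256 * s + 1) * e₂) * (b / z₁) * ((K : ℝ) / l * (p / n)) := by
    calc _ ≤ 4 * (1 + 512 * s) * ((256 * s + 1) * (p / n) * e₂) * (b * K / z₁ / l) := by gcongr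
      _ = _ := by ring
  have hvariance : 64 * (1 + 512 * s) * t * (K / n) ≤
      512 * s * (1 + 512 * s) * (v * (K / n)) := by
    calc _ ≤ 64 * (1 + 512 * s) * (8 * s * v) * (K / n) := by gcongr
      _ = _ := by ring
  have hnoise : 64 * t * (n / r) ≤ 512 * s / r₁ * (v * (n / p)) := by
    have : 0 < r := (mul_pos hr₁ hp0).trans_le hr
    calc _ ≤ 64 * (8 * s * v) * (n / (r₁ * p)) := by gcongr
      _ = _ := by ring
  calc excessBound s r O t a n K
      ≤ 4 * (1 + 512 * s) * ((256 * s + 1) * e₂) * (b / z₁) * ((K : ℝ) / l * (p / n)) +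
        512 * s * (1 + 512 * s) * (v * (K / n)) + 512 * s / r₁ * (v * (n / p)) :=
        add_le_add (add_le_add hbias hvariance) hnoise
    _ ≤ riskConstant s z₁ e₂ r₁ b * (K / l * (p / n)) +
        riskConstant s z₁ e₂ r₁ b * (v * (K / n)) + riskConstant s z₁ e₂ r₁ b * (v * (n / p)) := by
      have hc₁ : 0 ≤ 4 * (1 + 512 * s) * ((256 * s + 1) * e₂) * (b / z₁) := by positivity
      have hc₂ : 0 ≤ 512 * s * (1 + 512 * s) := by positivity
      have hc₃ : 0 ≤ 512 * s / r₁ := by positivity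
      gcongr <;> rw [riskConstant] <;> linarith
    _ = _ := by ring

/-- The lower bound for the ratios `n / K` and `r / n` of the dimensions in terms of the common
sub-Gaussian variance proxy `s`. Here `1024 * s + 5 = 1 + 2 / γ` for the mesh
`γ = (512 * s + 2)⁻¹`. -/
def ratioConstant (s : ℝ) : ℝ :=
  (2 + 64 * (11 * s ^ 2 + s)) * (Real.log (1024 * s + 5) + 1)

theorem two_le_ratioConstant {s : ℝ} (hs : 0 ≤ s) : 2 ≤ ratioConstant s := by
  have := Real.log_nonneg (x := 1024 * s + 5) (by linarith)
  rw [ratioConstant]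
  nlinarith [mul_nonneg (sq_nonneg s) this, mul_nonneg hs this]

theorem mul_ratio_add_le {D a l v : ℝ} {n p K : ℕ} (hD : 0 ≤ D) (ha : 0 < a) (hv : 0 ≤ v)
    (hK : 0 < K) (hl : a * ((p : ℝ) / K) ≤ l) :
    D * ((K : ℝ) / l * ((p : ℝ) / n) + v) ≤ D * (1 + 1 / a) * ((K : ℝ) ^ 2 / n + v) := by
  have hK0 : (0 : ℝ) < K := by exact_mod_cast hK
  have hratio : (K : ℝ) / l * p ≤ 1 / a * K ^ 2 := by
    rcases (hl.trans' (by positivity)).eq_or_lt with rfl | hl0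
    · simp only [div_zero, zero_mul]
      positivity
    · rw [← mul_div_assoc, div_le_iff₀ hK0] at hl
      rw [div_mul_eq_mul_div, div_le_iff₀ hl0, div_mul_eq_mul_div, one_mul, div_mul_eq_mul_div,
        le_div_iff₀ ha]
      nlinarith
  calc D * (K / l * (p / n) + v) = D * (K / l * p / n + v) := by rw [mul_div_assoc]
    _ ≤ D * (1 / a * K ^ 2 / n + v) := by gcongr
    _ ≤ D * (1 / a * K ^ 2 / n + v) + D * (K ^ 2 / n + 1 / a * v) :=
      le_add_of_nonneg_right (by positivity)
    _ = _ := by ring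

section ExcessRisk

variable {Ω Ω' : Type*} [MeasurableSpace Ω] {P : Measure Ω} [IsProbabilityMeasure P] {n p K : ℕ}
  {A : Matrix (Fin p) (Fin K) ℝ} {Z : Ω → EuclideanSpace ℝ (Fin K)}
  {E : Ω → EuclideanSpace ℝ (Fin p)} {ε : Ω → ℝ}

theorem IsGoodSample.risk_sub_variance_le {Zs : Fin n → Ω' → EuclideanSpace ℝ (Fin K)}
    {Es : Fin n → Ω' → EuclideanSpace ℝ (Fin p)} {εs : Fin n → Ω' → ℝ} {ω : Ω'} {s t : ℝ}
    (hgood : IsGoodSample A (psdSqrt (covMatrix Z P)) (rowMatrix (Zs · ω)) (rowMatrix (Es · ω))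
      (n / 16) (16 * s * (covMatrix E P).trace) ((covMatrix E P).trace / 32))
    (hF : IsFactorModel P Z E ε) (hZ : MemLp Z 2 P) (hE : MemLp E 2 P) (hε : MemLp ε 2 P)
    (hn : 0 < n) (hs : 0 ≤ s) (hr : 1 < effRank (covMatrix E P)) (α₀ : EuclideanSpace ℝ (Fin p))
    (ht : 0 ≤ t) (hεs : ‖WithLp.toLp 2 (εs · ω)‖ ^ 2 ≤ t * n)
    (hWε : ‖toEuclideanLin (psdSqrt (covMatrix Z P) * A.transpose *
        rightInv (rowMatrix (Zs · ω) * A.transpose + rowMatrix (Es · ω)))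
        (WithLp.toLp 2 (εs · ω))‖ ^ 2 ≤
      t * frobeniusSq (psdSqrt (covMatrix Z P) * A.transpose *
        rightInv (rowMatrix (Zs · ω) * A.transpose + rowMatrix (Es · ω)))) :
    risk P (feature A Z E) (response (toEuclideanLin A.transpose α₀) Z ε)
        (glsEstimator A (toEuclideanLin A.transpose α₀) Zs Es εs ω) - Var[ε; P] ≤
      excessBound s (effRank (covMatrix E P)) ‖covMatrix E P‖ t (‖α₀‖ ^ 2) n K := by
  have hO := norm_pos_of_one_lt_effRank hr
  have hr0 := one_pos.trans hr
  rw [← effRank_mul_norm] at hgood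
  have hnoise (α : EuclideanSpace ℝ (Fin p)) :
      ‖toEuclideanLin (psdSqrt (covMatrix E P)) α‖ ^ 2 ≤ ‖covMatrix E P‖ * ‖α‖ ^ 2 := by
    calc _ ≤ (‖psdSqrt (covMatrix E P)‖ * ‖α‖) ^ 2 := by gcongr; exact norm_toEuclideanLin_le _ α
      _ = _ := by rw [mul_pow, norm_psdSqrt_sq (covMatrix_posSemidef hE)]
  rw [risk_eq hF hZ hE hε, ← add_assoc, add_sub_cancel_right, glsEstimator_eq_minNormEstimator]
  refine ((add_le_add_iff_left _).2 (hnoise _)).trans ((hgood.excess_le hn hs (by positivity) α₀ ht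
    hO.le hεs hWε).trans_eq ?_)
  rw [excessBound]
  field_simp

variable {M s γ : ℝ≥0}

theorem IsSubGaussianModel.measure_not_factor_lower_le (h : IsSubGaussianModel M P Z E ε)
    (hM : 0 < M) (hs : s = 8 * M ^ 2) (hF : IsFactorModel P Z E ε) (hZ : (covMatrix Z P).PosDef)
    (hγ0 : 0 < γ) (hγ : (γ : ℝ) ≤ 1 / 2) (hγs : 512 * s * (γ : ℝ) ^ 2 ≤ 1) :
    Measure.pi (fun _ : Fin n => P.map fun ω => (Z ω, E ω)) {x | ¬ ∀ w,
        (n : ℝ) / 16 * ‖toEuclideanLin (psdSqrt (covMatrix Z P)) w‖ ^ 2 ≤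
          ‖toEuclideanLin (rowMatrix fun i => (x i).1) w‖ ^ 2} ≤
      ofReal ((1 + 2 / γ) ^ K * (exp (-(n / (144 * s ^ 2))) + exp (-n))) := by
  have hZm := hF.measurable_Z
  have hZE : Measurable fun ω => (Z ω, E ω) := hZm.prodMk hF.measurable_E
  have := Measure.isProbabilityMeasure_map (μ := P) hZE.aemeasurable
  refine FactorRegression.measure_not_factor_lower_le measurable_fst (psdSqrt_surjective hZ)
    (fun w => ?_) (fun w => ?_) hγ0 hγ hγs
  · rw [hs]
    exact (h.hasSubgaussianMGF_inner_factor hM w).congr_identDistrib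
      ⟨by fun_prop, by fun_prop, by rw [Measure.map_map (by fun_prop) hZE]; rfl⟩
  · rw [integral_map hZE.aemeasurable (by fun_prop)]
    exact integral_inner_sq_eq_norm_psdSqrt_sq (h.memLp_factor hM) hF.mean_Z w

theorem IsSubGaussianModel.measure_not_noise_bounds_le (h : IsSubGaussianModel M P Z E ε)
    (hM : 0 < M) (hs : s = 8 * M ^ 2) (hF : IsFactorModel P Z E ε)
    (hA : IsUnit (A.transpose * A)) (hr : 1 < effRank (covMatrix E P))
    (hrK : 2 * K ≤ effRank (covMatrix E P)) (hγ0 : 0 < γ) (hγ : (γ : ℝ) ≤ 1 / 2)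
    (hγs : 512 * s * (γ : ℝ) ^ 2 ≤ 1) :
    Measure.pi (fun _ : Fin n => P.map fun ω => (Z ω, E ω)) {x |
        ¬(‖rowMatrix fun i => (x i).2‖ ^ 2 ≤ 16 * s * (covMatrix E P).trace ∧
          ∀ v, (covMatrix E P).trace / 32 * ‖v‖ ^ 2 ≤ ‖toEuclideanLin (kerProj A.transpose)
            (toEuclideanLin (rowMatrix fun i => (x i).2).transpose v)‖ ^ 2)} ≤
      ofReal ((1 + 2 / γ) ^ n * (exp (-(effRank (covMatrix E P) / 2)) +
        exp (-(effRank (covMatrix E P) / (64 * (11 * s ^ 2 + s)))))) := by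
  have hZE : Measurable fun ω => (Z ω, E ω) := hF.measurable_Z.prodMk hF.measurable_E
  have := Measure.isProbabilityMeasure_map (μ := P) hZE.aemeasurable
  have hQE := covMatrix_posSemidef (h.memLp_noise hM)
  have hO := norm_pos_of_one_lt_effRank hr
  obtain ⟨μ, _, hμ, hμ2, hlaw⟩ := h.exists_law_noise hM
  have hlaw' : (P.map fun ω => (Z ω, E ω)).map Prod.snd = (Measure.pi μ).map
      fun x => toEuclideanLin (psdSqrt (covMatrix E P)) (WithLp.toLp 2 x) := by
    rw [Measure.map_map measurable_snd hZE, ← hlaw]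
    rfl
  have hker : frobeniusSq (psdSqrt (covMatrix E P)) ≤
      2 * frobeniusSq (kerProj A.transpose * psdSqrt (covMatrix E P)) := by
    have hadd := frobeniusSq_le_frobeniusSq_kerProj_mul_add (X := A.transpose) hA
      (psdSqrt (covMatrix E P))
    have hmul := mul_le_mul_of_nonneg_right hrK hO.le
    rw [norm_psdSqrt_sq hQE] at hadd
    rw [effRank_mul_norm, ← frobeniusSq_psdSqrt hQE] at hmul
    linarith
  have hnoise := FactorRegression.measure_not_noise_bounds_le (n := n) measurable_snd (hs ▸ hμ) hμ2
    hlaw' hO (norm_psdSqrt_sq hQE).le (norm_kerProj_apply_le hA) hker hγ0 hγ hγs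
  rw [frobeniusSq_psdSqrt hQE] at hnoise
  have hexp (c : ℝ) : (covMatrix E P).trace / (c * ‖covMatrix E P‖) =
      effRank (covMatrix E P) / c := by
    rw [← effRank_mul_norm, mul_div_mul_right _ _ hO.ne']
  rwa [hexp, hexp] at hnoise

theorem IsSubGaussianModel.measure_not_isGoodSample_le (h : IsSubGaussianModel M P Z E ε)
    (hM : 0 < M) (hs : s = 8 * M ^ 2) (hF : IsFactorModel P Z E ε)
    (hA : IsUnit (A.transpose * A)) (hZ : (covMatrix Z P).PosDef)
    (hr : 1 < effRank (covMatrix E P)) (hrK : 2 * K ≤ effRank (covMatrix E P)) (hγ0 : 0 < γ)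
    (hγ : (γ : ℝ) ≤ 1 / 2) (hγs : 512 * s * (γ : ℝ) ^ 2 ≤ 1) :
    Measure.pi (fun _ : Fin n => P.map fun ω => (Z ω, E ω)) {x |
        ¬IsGoodSample A (psdSqrt (covMatrix Z P)) (rowMatrix fun i => (x i).1)
          (rowMatrix fun i => (x i).2) (n / 16) (16 * s * (covMatrix E P).trace)
          ((covMatrix E P).trace / 32)} ≤
      ofReal (failureBound s γ (effRank (covMatrix E P)) n K) := by
  rw [failureBound, ENNReal.ofReal_add (by positivity) (by positivity)]
  refine (measure_mono fun x hx => ?_).trans ((measure_union_le _ _).trans (add_le_add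
    (h.measure_not_factor_lower_le hM hs hF hZ hγ0 hγ hγs)
    (h.measure_not_noise_bounds_le hM hs hF hA hr hrK hγ0 hγ hγs)))
  by_contra hcon
  rw [Set.mem_union, not_or] at hcon
  obtain ⟨hfactor, hnoise⟩ := hcon.imp not_not.1 not_not.1
  exact hx (isGoodSample_of_kerProj hA hfactor hnoise.1 hnoise.2)

theorem IsSubGaussianModel.measure_excess_gt_le [MeasurableSpace Ω'] {P' : Measure Ω'}
    [IsProbabilityMeasure P'] {Zs : Fin n → Ω' → EuclideanSpace ℝ (Fin K)}
    {Es : Fin n → Ω' → EuclideanSpace ℝ (Fin p)} {εs : Fin n → Ω' → ℝ}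
    (h : IsSubGaussianModel M P Z E ε) (hM : 0 < M) (hs : s = 8 * M ^ 2)
    (hF : IsFactorModel P Z E ε) (hS : IsIIDSample P Z E ε P' Zs Es εs)
    (hA : IsUnit (A.transpose * A)) (hZ : (covMatrix Z P).PosDef) (hn : 0 < n)
    (hr : 1 < effRank (covMatrix E P)) (hrK : 2 * K ≤ effRank (covMatrix E P)) (hγ0 : 0 < γ)
    (hγ : (γ : ℝ) ≤ 1 / 2) (hγs : 512 * s * (γ : ℝ) ^ 2 ≤ 1) {ρ : ℝ} (hρ : 0 ≤ ρ)
    (α₀ : EuclideanSpace ℝ (Fin p)) :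
    P' {ω | excessBound s (effRank (covMatrix E P)) ‖covMatrix E P‖
          ((4 * ρ + 2) * (s * Var[ε; P])) (‖α₀‖ ^ 2) n K <
        risk P (feature A Z E) (response (toEuclideanLin A.transpose α₀) Z ε)
          (glsEstimator A (toEuclideanLin A.transpose α₀) Zs Es εs ω) - Var[ε; P]} ≤
      ofReal (failureBound s γ (effRank (covMatrix E P)) n K) +
        (ofReal (exp (-ρ)) + ofReal (exp (-ρ))) := by
  have hZE : Measurable fun ω => (Z ω, E ω) := hF.measurable_Z.prodMk hF.measurable_E
  have := Measure.isProbabilityMeasure_map (μ := P) hZE.aemeasurable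
  have := Measure.isProbabilityMeasure_map (μ := P) hF.measurable_ε.aemeasurable
  have hν : HasSubgaussianMGF id (s * ‖√(Var[ε; P])‖₊ ^ 2) (P.map ε) := by
    rw [HasSubgaussianMGF.id_map_iff hF.measurable_ε.aemeasurable, hs]
    exact h.hasSubgaussianMGF_response_noise hM
  have hvar : ((s * ‖√(Var[ε; P])‖₊ ^ 2 : ℝ≥0) : ℝ) = s * Var[ε; P] := by
    simp [Real.sq_sqrt (variance_nonneg ε P)]
  have hX (i : Fin n) (j : Fin p) :
      Measurable fun x : Fin n → EuclideanSpace ℝ (Fin K) × EuclideanSpace ℝ (Fin p) =>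
        (rowMatrix (fun i => (x i).1) * A.transpose + rowMatrix fun i => (x i).2) i j := by
    simp only [Matrix.add_apply, Matrix.mul_apply, rowMatrix, Matrix.of_apply]
    fun_prop
  have hbad := (measure_prod_pi_not_good_le hν
    (measurable_mul_apply (X := fun _ => psdSqrt (covMatrix Z P) * A.transpose)
      (fun _ _ => measurable_const) (measurable_rightInv_apply hX)) ρ _).trans
    (add_le_add (h.measure_not_isGoodSample_le hM hs hF hA hZ hr hrK hγ0 hγ hγs) le_rfl)
  rw [← hS.map_eq_prod hF] at hbad
  refine (measure_mono fun ω hω hgood => ?_).trans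
    ((Measure.le_map_apply hS.aemeasurable_sample _).trans hbad)
  have ht : 0 ≤ (4 * ρ + 2) * (s * Var[ε; P]) :=
    mul_nonneg (by linarith) (mul_nonneg s.2 (variance_nonneg ε P))
  obtain ⟨hsample, hWε, hεs⟩ := hgood
  rw [hvar] at hWε hεs
  exact (Set.mem_ofPred_eq ▸ hω).not_ge ((not_not.1 hsample).risk_sub_variance_le hF
    (h.memLp_factor hM) (h.memLp_noise hM) (h.memLp_response_noise hM) hn s.2 hr α₀ ht hεs hWε)

theorem IsSubGaussianModel.measure_excess_gt_le_div [MeasurableSpace Ω'] {P' : Measure Ω'}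
    [IsProbabilityMeasure P'] {Zs : Fin n → Ω' → EuclideanSpace ℝ (Fin K)}
    {Es : Fin n → Ω' → EuclideanSpace ℝ (Fin p)} {εs : Fin n → Ω' → ℝ}
    (h : IsSubGaussianModel M P Z E ε) (hM : 0 < M)
    (hs : s = 8 * M ^ 2) (hF : IsFactorModel P Z E ε) (hS : IsIIDSample P Z E ε P' Zs Es εs)
    (hA : IsUnit (A.transpose * A)) (hZ : (covMatrix Z P).PosDef) (hn : 0 < n)
    (hK : ratioConstant s * K ≤ n) (hr : ratioConstant s * n ≤ effRank (covMatrix E P))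
    (α₀ : EuclideanSpace ℝ (Fin p)) :
    P' {ω | excessBound s (effRank (covMatrix E P)) ‖covMatrix E P‖
          ((4 * Real.log n + 2) * (s * Var[ε; P])) (‖α₀‖ ^ 2) n K <
        risk P (feature A Z E) (response (toEuclideanLin A.transpose α₀) Z ε)
          (glsEstimator A (toEuclideanLin A.transpose α₀) Zs Es εs ω) - Var[ε; P]} ≤
      ofReal ((288 * s ^ 2 + 6) / n) := by
  have hs0 : 0 < s := hs ▸ by positivity
  have hs0' : (0 : ℝ) < s := by exact_mod_cast hs0
  have hn1 : (1 : ℝ) ≤ n := by exact_mod_cast hn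
  have htwo := two_le_ratioConstant hs0'.le
  have hmesh : (1 : ℝ) + 2 / ((512 * s + 2)⁻¹ : ℝ≥0) = 1024 * s + 5 := by
    push_cast
    field_simp
    ring
  have hfail : failureBound s (512 * s + 2)⁻¹ (effRank (covMatrix E P)) n K ≤
      (288 * s ^ 2 + 4) / n :=
    failureBound_le hs0 (by positivity) hn (by rwa [hmesh]) (by rwa [hmesh])
  refine (h.measure_excess_gt_le hM hs hF hS hA hZ hn (by nlinarith) ?_
    (γ := (512 * s + 2)⁻¹) (by positivity) ?_ ?_ (Real.log_nonneg hn1) α₀).trans ?_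
  · nlinarith [mul_le_mul_of_nonneg_right htwo K.cast_nonneg]
  · push_cast
    rw [one_div]
    exact inv_anti₀ two_pos (by linarith)
  · push_cast
    rw [inv_pow, mul_inv_le_iff₀ (by positivity)]
    nlinarith
  · have hlog : exp (-Real.log n) = 1 / n := by
      rw [Real.exp_neg, Real.exp_log (by positivity), one_div]
    rw [hlog, ← ENNReal.ofReal_add (by positivity) (by positivity),
      ← ENNReal.ofReal_add (by rw [failureBound]; positivity) (by positivity)]
    refine ENNReal.ofReal_le_ofReal ?_
    calc _ ≤ (288 * (s : ℝ) ^ 2 + 4) / n + (1 / n + 1 / n) := by gcongr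
      _ = _ := by ring

theorem IsSubGaussianModel.one_sub_le_measureReal_excess_le [MeasurableSpace Ω']
    {P' : Measure Ω'} [IsProbabilityMeasure P'] {β : EuclideanSpace ℝ (Fin K)}
    {Zs : Fin n → Ω' → EuclideanSpace ℝ (Fin K)} {Es : Fin n → Ω' → EuclideanSpace ℝ (Fin p)}
    {εs : Fin n → Ω' → ℝ} {z₁ e₂ r₁ b : ℝ} (h : IsSubGaussianModel M P Z E ε) (hM : 0 < M)
    (hs : s = 8 * M ^ 2) (hF : IsFactorModel P Z E ε) (hS : IsIIDSample P Z E ε P' Zs Es εs)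
    (hK : 1 ≤ K) (hA : A.rank = K) (hn : ratioConstant s * K < n)
    (hr : ratioConstant s * n < effRank (covMatrix E P)) (hz : 0 < z₁)
    (hz₁ : z₁ ≤ kthEigenvalue K (covMatrix Z P)) (he₂ : opNorm (covMatrix E P) ≤ e₂)
    (hr₁ : 0 < r₁) (hre : r₁ * p ≤ effRank (covMatrix E P)) (hb : 0 ≤ b)
    (hβ : quadForm (covMatrix Z P) β ≤ b * K) :
    1 - (288 * s ^ 2 + 6) / n ≤ P'.real {ω | risk P (feature A Z E) (response β Z ε)
        (glsEstimator A β Zs Es εs ω) - Var[ε; P] ≤ riskConstant s z₁ e₂ r₁ b *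
          ((K : ℝ) / kthEigenvalue K (A.transpose * A) * ((p : ℝ) / n) +
            Var[ε; P] * (((n : ℝ) / p + (K : ℝ) / n) * Real.log n))} := by
  rw [opNorm_eq_norm] at he₂
  have hQZ := (covMatrix_posSemidef (h.memLp_factor hM)).1
  have hQE := covMatrix_posSemidef (h.memLp_noise hM)
  have hAA := posDef_transpose_mul_self_of_rank_eq hA
  have htwo := two_le_ratioConstant s.coe_nonneg
  have hK1 : (1 : ℝ) ≤ K := by exact_mod_cast hK
  have hn2 : (2 : ℝ) ≤ n := by nlinarith
  have hn0 : 0 < n := by exact_mod_cast two_pos.trans_le hn2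
  have hnr : n < effRank (covMatrix E P) := by nlinarith
  have hrp := effRank_le_of_posSemidef hQE (by linarith)
  have hβeq : toEuclideanLin A.transpose (toEuclideanLin (rightInv A.transpose) β) = β :=
    toEuclideanLin_rightInv_apply (by simpa using hAA.isUnit) β
  have hlog : 1 / 2 ≤ Real.log n := by
    have := Real.log_two_gt_d9
    have := Real.log_le_log two_pos hn2
    linarith
  have hbad := h.measure_excess_gt_le_div hM hs hF hS hAA.isUnit
    ((kthEigenvalue_pos_iff_posDef hK hQZ).1 (hz.trans_le hz₁)) hn0 hn.le hr.le
    (toEuclideanLin (rightInv A.transpose) β)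
  have hexcess := excessBound_le (t := (4 * Real.log n + 2) * (s * Var[ε; P]))
    (v := Var[ε; P] * Real.log n) s.coe_nonneg hn0 (by exact_mod_cast hnr.le.trans hrp) hr₁ hre hrp
    (norm_nonneg _) he₂ hz hb ((kthEigenvalue_pos_iff_posDef hK hAA.1).2 hAA).le (sq_nonneg _)
    (norm_rightInv_transpose_apply_sq_le hK hA hQZ hz hz₁ hβ)
    (mul_nonneg (variance_nonneg _ _) (by linarith))
    (by nlinarith [mul_nonneg s.coe_nonneg (variance_nonneg ε P)])
  rw [hβeq] at hbad
  refine one_sub_le_measureReal_of_compl_subset (by positivity) hbad fun ω hω => ?_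
  rw [Set.mem_compl_iff, Set.mem_ofPred_eq, not_lt] at hω
  exact hω.trans (hexcess.trans_eq (by ring))

end ExcessRisk

end FactorRegression

end

open FactorRegression in
theorem mainTheorem9_general :
    ∀ M : ℝ, 0 < M →
    ∃ C > (0 : ℝ), ∃ c > (0 : ℝ),
    ∀ z₁ e₂ r₁ b : ℝ, 0 < z₁ → 0 < e₂ → 0 < r₁ → 0 < b →
    ∃ D > (0 : ℝ), ∀ a > (0 : ℝ), ∃ D' > (0 : ℝ),
    ∀ (n p K : ℕ)
      (Ω : Type*) [MeasurableSpace Ω] (P : Measure Ω) [IsProbabilityMeasure P]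
      (Ω' : Type*) [MeasurableSpace Ω'] (P' : Measure Ω') [IsProbabilityMeasure P']
      (A : Matrix (Fin p) (Fin K) ℝ) (β : EuclideanSpace ℝ (Fin K))
      (Z : Ω → EuclideanSpace ℝ (Fin K)) (E : Ω → EuclideanSpace ℝ (Fin p)) (ε : Ω → ℝ)
      (Zs : Fin n → Ω' → EuclideanSpace ℝ (Fin K))
      (Es : Fin n → Ω' → EuclideanSpace ℝ (Fin p)) (εs : Fin n → Ω' → ℝ),
      1 ≤ K →
      IsFactorModel P Z E ε →
      IsIIDSample P Z E ε P' Zs Es εs →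
      A.rank = K →
      IsSubGaussianModel M P Z E ε →
      C * K < n →
      C * n < effRank (covMatrix E P) →
      z₁ ≤ kthEigenvalue K (covMatrix Z P) →
      opNorm (covMatrix E P) ≤ e₂ →
      r₁ * p ≤ effRank (covMatrix E P) →
      quadForm (covMatrix Z P) β ≤ b * K →
      let R : EuclideanSpace ℝ (Fin p) → ℝ := risk P (feature A Z E) (response β Z ε)
      let αhat : Ω' → EuclideanSpace ℝ (Fin p) := glsEstimator A β Zs Es εs
      let lamA : ℝ := kthEigenvalue K (A.transpose * A)
      let V : ℝ := Var[ε; P] * (((n : ℝ) / p + (K : ℝ) / n) * Real.log n)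
      (∃ αstar, IsMinOn R Set.univ αstar) ∧
      ∀ αstar, IsMinOn R Set.univ αstar →
        1 - c / n ≤ P'.real {ω | R (αhat ω) - R αstar ≤ R (αhat ω) - Var[ε; P] ∧
          R (αhat ω) - Var[ε; P] ≤ D * ((K : ℝ) / lamA * ((p : ℝ) / n) + V)} ∧
        (a * ((p : ℝ) / K) ≤ lamA →
          1 - c / n ≤ P'.real {ω | R (αhat ω) - R αstar ≤ R (αhat ω) - Var[ε; P] ∧
            R (αhat ω) - Var[ε; P] ≤ D' * ((K : ℝ) ^ 2 / n + V)}) := by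
  intro M hM
  lift M to NNReal using hM.le
  refine ⟨ratioConstant (8 * M ^ 2 : NNReal),
    two_pos.trans_le (two_le_ratioConstant (by positivity)), 288 * (8 * M ^ 2 : NNReal) ^ 2 + 6,
    by positivity, fun z₁ e₂ r₁ b hz₁ he₂ hr₁ hb => ?_⟩
  have hD : 0 < riskConstant (8 * M ^ 2 : NNReal) z₁ e₂ r₁ b := by rw [riskConstant]; positivity
  refine ⟨_, hD, fun a ha => ⟨_, mul_pos hD (show 0 < 1 + 1 / a by positivity), ?_⟩⟩
  intro n p K Ω _ P _ Ω' _ P' _ A β Z E ε Zs Es εs hK hF hS hA h hn hr hz he hre hβ R αhat lamA V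
  have hZ := h.memLp_factor hM
  have hE := h.memLp_noise hM
  have hε := h.memLp_response_noise hM
  have hexcess := h.one_sub_le_measureReal_excess_le hM rfl hF hS hK hA hn hr hz₁ hz he hr₁ hre
    hb.le hβ
  have hV : 0 ≤ V := mul_nonneg (variance_nonneg _ _)
    (mul_nonneg (by positivity) (Real.log_natCast_nonneg n))
  refine ⟨exists_isMinOn_risk hF hZ hE hε A β, fun αstar _ => ?_⟩
  have hstar (ω : Ω') : R (αhat ω) - R αstar ≤ R (αhat ω) - Var[ε; P] :=
    sub_le_sub_left (variance_le_risk hF hZ hE hε A β αstar) _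
  exact ⟨hexcess.trans (measureReal_mono fun ω hω => ⟨hstar ω, hω⟩), fun hlamA =>
    hexcess.trans (measureReal_mono fun ω hω => ⟨hstar ω, hω.trans
      (mul_ratio_add_le hD.le ha hV hK hlamA)⟩)⟩

theorem mainTheorem9 :
    ∀ M : ℝ, 0 < M →
    ∃ C > (0 : ℝ), ∃ c > (0 : ℝ),
    ∀ z₁ z₂ e₁ e₂ r₁ r₂ b : ℝ,
      0 < z₁ → 0 < z₂ → 0 < e₁ → 0 < e₂ → 0 < r₁ → 0 < r₂ → 0 < b →
    ∃ D > (0 : ℝ), ∀ a > (0 : ℝ), ∃ D' > (0 : ℝ),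
    ∀ (n p K : ℕ)
      (Ω : Type*) [MeasurableSpace Ω] (P : Measure Ω) [IsProbabilityMeasure P]
      (Ω' : Type*) [MeasurableSpace Ω'] (P' : Measure Ω') [IsProbabilityMeasure P']
      (A : Matrix (Fin p) (Fin K) ℝ) (β : EuclideanSpace ℝ (Fin K))
      (Z : Ω → EuclideanSpace ℝ (Fin K)) (E : Ω → EuclideanSpace ℝ (Fin p)) (ε : Ω → ℝ)
      (Zs : Fin n → Ω' → EuclideanSpace ℝ (Fin K))
      (Es : Fin n → Ω' → EuclideanSpace ℝ (Fin p)) (εs : Fin n → Ω' → ℝ),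
      1 ≤ K →
      FactorRegression.IsFactorModel P Z E ε →
      FactorRegression.IsIIDSample P Z E ε P' Zs Es εs →
      A.rank = K →
      (FactorRegression.covMatrix Z P).rank = K →
      FactorRegression.IsSubGaussianModel M P Z E ε →
      C * K < n →
      C * n < FactorRegression.effRank (FactorRegression.covMatrix E P) →
      z₁ ≤ FactorRegression.kthEigenvalue K (FactorRegression.covMatrix Z P) →
      FactorRegression.kthEigenvalue K (FactorRegression.covMatrix Z P) ≤ z₂ →
      e₁ ≤ FactorRegression.opNorm (FactorRegression.covMatrix E P) →
      FactorRegression.opNorm (FactorRegression.covMatrix E P) ≤ e₂ →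
      r₁ * p ≤ FactorRegression.effRank (FactorRegression.covMatrix E P) →
      FactorRegression.effRank (FactorRegression.covMatrix E P) ≤ r₂ * p →
      FactorRegression.quadForm (FactorRegression.covMatrix Z P) β ≤ b * K →
      let R : EuclideanSpace ℝ (Fin p) → ℝ := FactorRegression.risk P
        (FactorRegression.feature A Z E) (FactorRegression.response β Z ε)
      let αhat : Ω' → EuclideanSpace ℝ (Fin p) := FactorRegression.glsEstimator A β Zs Es εs
      let lamA : ℝ := FactorRegression.kthEigenvalue K (A.transpose * A)
      let V : ℝ := Var[ε; P] * (((n : ℝ) / p + (K : ℝ) / n) * Real.log n)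
      (∃ αstar, IsMinOn R Set.univ αstar) ∧
      ∀ αstar, IsMinOn R Set.univ αstar →
        1 - c / n ≤ P'.real {ω | R (αhat ω) - R αstar ≤ R (αhat ω) - Var[ε; P] ∧
          R (αhat ω) - Var[ε; P] ≤ D * ((K : ℝ) / lamA * ((p : ℝ) / n) + V)} ∧
        (a * ((p : ℝ) / K) ≤ lamA →
          1 - c / n ≤ P'.real {ω | R (αhat ω) - R αstar ≤ R (αhat ω) - Var[ε; P] ∧
            R (αhat ω) - Var[ε; P] ≤ D' * ((K : ℝ) ^ 2 / n + V)}) := by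
  intro M hM
  obtain ⟨C, hC, c, hc, h⟩ := mainTheorem9_general M hM
  refine ⟨C, hC, c, hc, fun z₁ z₂ e₁ e₂ r₁ r₂ b hz₁ _ _ he₂ hr₁ _ hb => ?_⟩
  obtain ⟨D, hD, h⟩ := h z₁ e₂ r₁ b hz₁ he₂ hr₁ hb
  refine ⟨D, hD, fun a ha => ?_⟩
  obtain ⟨D', hD', h⟩ := h a ha
  exact ⟨D', hD', fun n p K Ω _ P _ Ω' _ P' _ A β Z E ε Zs Es εs hK hF hS hA _ hsub hn hr hz₁ _ _
    he₂ hre _ => h n p K Ω P Ω' P' A β Z E ε Zs Es εs hK hF hS hA hsub hn hr hz₁ he₂ hre⟩
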